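/- **Theorem (Hamiltonian evolution).** *Setting.* Let $n\ge 0$, $r_\infty\ge 1$ and $r_1,\dots,r_n\ge 1$ be integers, put $g=r_\infty+\sum_{s=1}^n r_s-3$ and assume $g>0$. Let $\hbar\in\mathbb C\setminus\{0\}$. Fix complex numbers (monodromies) $t_{\infty^{(i)},0}$, $t_{X_s^{(i)},0}$ ($i=1,2$, $1\le s\le n$). The deformation parameters are the irregular times $t_{\infty^{(i)},k}$ ($1\le k\le r_\infty-1$), $t_{X_s^{(i)},k}$ ($1\le k\le r_s-1$) and the finite poles $X_1,\dots,X_n\in\mathbb C$. Let $U$ be an open set of such parameters on which the $X_s$ are distinct, $t_{\infty^{(1)},r_\infty-1}\ne t_{\infty^{(2)},r_\infty-1}$ and $t_{X_s^{(1)},r_s-1}\ne t_{X_s^{(2)},r_s-1}$ for all $s$; if $r_s=1$ assume also $t_{X_s^{(1)},0}-t_{X_s^{(2)},0}\ne\pm\hbar$. For every point of $U$ let $$L(\lambda)=\sum_{k=1}^{r_\infty-1}L^{[\infty,k]}\lambda^{k-1}+\sum_{s=1}^n\sum_{k=0}^{r_s-1}\frac{L^{[X_s,k]}}{(\lambda-X_s)^{k+1}},\qquad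 L^{[p,k]}\in\mathfrak{gl}_2(\mathbb C),$$ with coefficients holomorphic on $U$, such that: (a) (normalization) the coefficient of $\lambda^{r_\infty-2}$ in the expansion of $L$ at $\infty$ is $\mathrm{diag}(-t_{\infty^{(1)},r_\infty-1},-t_{\infty^{(2)},r_\infty-1})$ and the $(1,2)$ entry of the coefficient of $\lambda^{r_\infty-3}$ is $1$; (b) $L$ has the given times and monodromies: there are gauge matrices $G_\infty$, $G_{X_s}$, holomorphic and invertible near $\infty$, resp. $X_s$, such that $$G_\infty LG_\infty^{-1}+\hbar(\partial_\lambda G_\infty)G_\infty^{-1}=\mathrm{diag}_{i=1,2}\Big(-\sum_{k=0}^{r_\infty-1}t_{\infty^{(i)},k}\lambda^{k-1}\Big)+O(\lambda^{-2})\ \ (\lambda\to\infty),$$ $$G_{X_s}LG_{X_s}^{-1}+\hbar(\partial_\lambda G_{X_s})G_{X_s}^{-1}=\mathrm{diag}_{i=1,2}\Big(\sum_{k=0}^{r_s-1}t_{X_s^{(i)},k}(\lambda-X_s)^{-k-1}\Big)+O(1)\ \ (\lambda\to X_s).$$ Let $\boldsymbol\alpha$ be a vector field on $U$ with components $\alpha_{\infty^{(i)},k}$,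 $\alpha_{X_s^{(i)},k}$ ($k\ge1$), $\alpha_{X_s}$, and $$\mathcal L_{\boldsymbol\alpha}=\hbar\sum_{i,k}\alpha_{\infty^{(i)},k}\,\partial_{t_{\infty^{(i)},k}}+\hbar\sum_{i,s,k}\alpha_{X_s^{(i)},k}\,\partial_{t_{X_s^{(i)},k}}+\hbar\sum_s\alpha_{X_s}\,\partial_{X_s}.$$ Assume that the family is isomonodromic along $\boldsymbol\alpha$: at each point of $U$ there is a rational matrix $A(\lambda)=\sum_{k=0}^{r_\infty-1}A^{[\infty,k]}\lambda^k+\sum_s\sum_{k=1}^{r_s}A^{[X_s,k]}(\lambda-X_s)^{-k}$ with $\mathcal L_{\boldsymbol\alpha}[L]=[A,L]+\hbar\,\partial_\lambda A$. Finally let $q_1,\dots,q_g$ be holomorphic functions on $U$, pairwise distinct and distinct from $X_1,\dots,X_n$ at every point, with $[L(q_j)]_{1,2}=0$, and put $p_j=[L(q_j)]_{1,1}$. *Coefficients.* Sums over empty index sets are zero, and $\delta_{\mathcal P}=1$ if $\mathcal P$ holds, $0$ otherwise. For a pole $p$ of order $r_p$ let $M_p$ be the $(r_p-1)\times(r_p-1)$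 lower triangular Toeplitz matrix with $(a,b)$ entry $t_{p^{(1)},r_p-1-(a-b)}-t_{p^{(2)},r_p-1-(a-b)}$ for $b\le a$. Define $c_{p,k}$ ($1\le k\le r_p-1$) by $$M_p\,(c_{p,r_p-1},\dots,c_{p,1})^t=\Big(\sum_{k=r_p-a}^{r_p-1}\tfrac1k\big(t_{p^{(2)},2r_p-1-a-k}\,\alpha_{p^{(1)},k}-t_{p^{(1)},2r_p-1-a-k}\,\alpha_{p^{(2)},k}\big)\Big)_{1\le a\le r_p-1},$$ let $c_{\infty,0}\in\mathbb C$ be an arbitrary constant, and let $\nu_{X_s,0}=-\alpha_{X_s}$ and $$M_{X_s}(\nu_{X_s,1},\dots,\nu_{X_s,r_s-1})^t=-\Big(\tfrac{\alpha_{X_s^{(1)},r_s-a}-\alpha_{X_s^{(2)},r_s-a}}{r_s-a}\Big)_{1\le a\le r_s-1},$$ $$M_\infty(\nu_{\infty,-1},\nu_{\infty,0},\dots,\nu_{\infty,r_\infty-3})^t=\Big(\tfrac{\alpha_{\infty^{(1)},r_\infty-a}-\alpha_{\infty^{(2)},r_\infty-a}}{r_\infty-a}\Big)_{1\le a\le r_\infty-1};$$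 for $r_\infty=2$ the last system determines $\nu_{\infty,-1}$ only, and for $r_\infty=1$ it is void. For $q=(q_1,\dots,q_g)$ with distinct entries, all different from the $X_s$, the numbers $\mu_j$, together with $\nu_{\infty,0}$ if $r_\infty=2$ and with $\nu_{\infty,-1},\nu_{\infty,0}$ if $r_\infty=1$, are the solution of $$\sum_{j}\mu_jq_j^{k-1}=\nu_{\infty,k}\ (1\le k\le r_\infty-3),\qquad \sum_j\frac{\mu_j}{(q_j-X_s)^{k+1}}=-\nu_{X_s,k}+\delta_{k=0}(\nu_{\infty,0}+\nu_{\infty,-1}X_s)+\delta_{k=1}\nu_{\infty,-1}\ (1\le s\le n,\ 0\le k\le r_s-1).$$ Let $$P_1(\lambda)=-\sum_{j=0}^{r_\infty-2}(t_{\infty^{(1)},j+1}+t_{\infty^{(2)},j+1})\lambda^j+\sum_s\sum_{j=1}^{r_s}\frac{t_{X_s^{(1)},j-1}+t_{X_s^{(2)},j-1}}{(\lambda-X_s)^j},$$ $$\tilde P_2(\lambda)=\sum_{j=\max(0,r_\infty-3)}^{2r_\infty-4}P^{(2)}_{\infty,j}\lambda^j+\sum_s\sum_{j=r_s+1}^{2r_s}\frac{P^{(2)}_{X_s,j}}{(\lambda-X_s)^j},$$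 $$P^{(2)}_{\infty,2r_\infty-4-k}=\sum_{j=0}^kt_{\infty^{(1)},r_\infty-1-j}\,t_{\infty^{(2)},r_\infty-1-(k-j)},\qquad P^{(2)}_{X_s,2r_s-k}=\sum_{j=0}^kt_{X_s^{(1)},r_s-1-j}\,t_{X_s^{(2)},r_s-1-(k-j)}.$$ The isospectral coefficients $H_{\infty,k}$ ($0\le k\le r_\infty-4$), $H_{X_s,k}$ ($1\le k\le r_s$) are the functions of $(q,p)$ that solve, for $1\le j\le g$, $$\sum_kH_{\infty,k}q_j^k+\sum_{s,k}\frac{H_{X_s,k}}{(q_j-X_s)^k}=p_j^2-P_1(q_j)p_j+p_j\sum_s\frac{\hbar r_s}{q_j-X_s}+\tilde P_2(q_j)+\hbar\sum_{i\ne j}\frac{p_i-p_j}{q_j-q_i}+\hbar\,t_{\infty^{(1)},r_\infty-1}q_j^{r_\infty-3}\delta_{r_\infty\ge3},$$ together with, if $r_\infty=2$, $\sum_sH_{X_s,1}=\hbar\sum_jp_j-(t_{\infty^{(1)},1}t_{\infty^{(2)},0}+t_{\infty^{(2)},1}t_{\infty^{(1)},0}+\hbar t_{\infty^{(1)},1})$,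 and, if $r_\infty=1$, $\sum_sH_{X_s,1}=\hbar\sum_jp_j$ and $\sum_s(X_sH_{X_s,1}+H_{X_s,2}\delta_{r_s\ge2})=\hbar\sum_jq_jp_j+\sum_st_{X_s^{(1)},0}t_{X_s^{(2)},0}\delta_{r_s=1}-t_{\infty^{(1)},0}(t_{\infty^{(2)},0}+\hbar)$. Define $$\begin{aligned}\mathrm{Ham}^{(\boldsymbol\alpha)}(q,p)=&\sum_{k=0}^{r_\infty-4}\nu_{\infty,k+1}H_{\infty,k}-\sum_s\sum_{k=2}^{r_s}\nu_{X_s,k-1}H_{X_s,k}+\sum_s\alpha_{X_s}H_{X_s,1}\\&-\hbar\sum_{j}\Big[\sum_{k=0}^{r_\infty-1}c_{\infty,k}q_j^k+\sum_s\sum_{k=1}^{r_s-1}\frac{c_{X_s,k}}{(q_j-X_s)^k}\Big]\\&+\nu_{\infty,-1}\sum_s(X_sH_{X_s,1}+H_{X_s,2}\delta_{r_s\ge2})+\nu_{\infty,0}\sum_sH_{X_s,1}\\&-\delta_{r_\infty\in\{1,2\}}\Big(\sum_sH_{X_s,1}-\hbar\sum_jp_j\Big)\nu_{\infty,0}\\&-\delta_{r_\infty=1}\Big(\sum_s(X_sH_{X_s,1}+H_{X_s,2}\delta_{r_s\ge2})-\hbar\sum_jq_jp_j\Big)\nu_{\infty,-1}\\&-\hbar\nu_{\infty,0}\sum_jp_j-\hbar\nu_{\infty,-1}\sum_jq_jp_j.\end{aligned}$$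 *Conclusion.* At every point of $U$ the linear systems for $(\mu_j)$ and the free $\nu_{\infty,\cdot}$, and for the $H$'s, have a unique solution for all $q$ with distinct entries different from the $X_s$ and all $p$, and for every $j\in\{1,\dots,g\}$ $$\mathcal L_{\boldsymbol\alpha}[q_j]=2\mu_j\Big(p_j-\tfrac12P_1(q_j)+\tfrac12\sum_s\frac{\hbar r_s}{q_j-X_s}\Big)-\hbar\nu_{\infty,0}-\hbar\nu_{\infty,-1}q_j-\hbar\sum_{i\ne j}\frac{\mu_j+\mu_i}{q_j-q_i},$$ $$\begin{aligned}\mathcal L_{\boldsymbol\alpha}[p_j]=&\ \hbar\sum_{i\ne j}\frac{(\mu_i+\mu_j)(p_i-p_j)}{(q_j-q_i)^2}+\mu_j\Big(p_jP_1'(q_j)+p_j\sum_s\frac{\hbar r_s}{(q_j-X_s)^2}-\tilde P_2'(q_j)+\sum_{k=1}^{r_\infty-4}kH_{\infty,k}q_j^{k-1}\\&-\sum_s\sum_{k=1}^{r_s}\frac{kH_{X_s,k}}{(q_j-X_s)^{k+1}}-\hbar(r_\infty-3)t_{\infty^{(1)},r_\infty-1}q_j^{r_\infty-4}\delta_{r_\infty\ge3}\Big)\\&+\hbar\nu_{\infty,-1}p_j+\hbar\sum_{k=1}^{r_\infty-1}kc_{\infty,k}q_j^{k-1}-\hbar\sum_s\sum_{k=1}^{r_s-1}\frac{kc_{X_s,k}}{(q_j-X_s)^{k+1}},\end{aligned}$$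 and these evolutions are Hamiltonian: $$\mathcal L_{\boldsymbol\alpha}[q_j]=\frac{\partial\,\mathrm{Ham}^{(\boldsymbol\alpha)}}{\partial p_j},\qquad \mathcal L_{\boldsymbol\alpha}[p_j]=-\frac{\partial\,\mathrm{Ham}^{(\boldsymbol\alpha)}}{\partial q_j},$$ the partial derivatives being taken at fixed parameters and fixed $\boldsymbol\alpha$, with $H_{p,k}$ and (for $r_\infty\le2$) the free $\nu_{\infty,\cdot}$ regarded as functions of $(q,p)$. -/

import Mathlib

open Filter Topology Asymptotics

noncomputable section

/-! ### Meromorphic connections, normalization at infinity, irregular times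

Throughout, `rInf` and `r s` are the orders of the poles `∞` and `X s`, and `hbar` is the scaling
parameter.  The exponent labels `(1)` and `(2)` are the indices `0` and `1` of `Fin 2`; likewise for
rows and columns of matrices. -/

/-- Coefficients of a rational `2 × 2` matrix with poles at `∞` and at `X 1, …, X n`.  Only finitely
many of them are used, see `laxMatrix` and `auxMatrix`. -/
structure PolarCoeffs (n : ℕ) where
  /-- coefficients at infinity -/
  inf : ℕ → Matrix (Fin 2) (Fin 2) ℂ
  /-- coefficients at the finite poles -/
  fin : Fin n → ℕ → Matrix (Fin 2) (Fin 2) ℂ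

/-- `L(z) = ∑_{k=1}^{rInf-1} L^{[∞,k]} z^{k-1} + ∑_s ∑_{k=0}^{r_s-1} L^{[X_s,k]} / (z - X_s)^{k+1}`. -/
def laxMatrix {n : ℕ} (rInf : ℕ) (r : Fin n → ℕ) (X : Fin n → ℂ) (C : PolarCoeffs n) (z : ℂ) :
    Matrix (Fin 2) (Fin 2) ℂ :=
  ∑ k ∈ Finset.Icc 1 (rInf - 1), z ^ (k - 1) • C.inf k
    + ∑ s, ∑ k ∈ Finset.range (r s), ((z - X s) ^ (k + 1))⁻¹ • C.fin s k

/-- The general rational matrix whose poles are dominated by those of `L`: order at most `r_s` at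
`X_s`, growth at most `z^{rInf-1}` at infinity (`L(z) dz` having a pole of order `rInf` there). -/
def auxMatrix {n : ℕ} (rInf : ℕ) (r : Fin n → ℕ) (X : Fin n → ℂ) (C : PolarCoeffs n) (z : ℂ) :
    Matrix (Fin 2) (Fin 2) ℂ :=
  ∑ k ∈ Finset.range rInf, z ^ k • C.inf k
    + ∑ s, ∑ k ∈ Finset.range (r s), ((z - X s) ^ (k + 1))⁻¹ • C.fin s k

/-- Leading coefficient (that of `z^{rInf-2}`) of `L` at infinity. -/
def leadAtInfinity {n : ℕ} (rInf : ℕ) (C : PolarCoeffs n) : Matrix (Fin 2) (Fin 2) ℂ :=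
  if 2 ≤ rInf then C.inf (rInf - 1) else ∑ s, C.fin s 0

/-- Subleading coefficient (that of `z^{rInf-3}`) of `L` at infinity. -/
def subleadAtInfinity {n : ℕ} (rInf : ℕ) (r : Fin n → ℕ) (X : Fin n → ℂ) (C : PolarCoeffs n) :
    Matrix (Fin 2) (Fin 2) ℂ :=
  if 3 ≤ rInf then C.inf (rInf - 2)
  else if rInf = 2 then ∑ s, C.fin s 0
  else ∑ s, ((if 2 ≤ r s then C.fin s 1 else 0) + X s • C.fin s 0)

/-- `C` is the representative normalized at infinity: the leading coefficient is
`diag(-t_{∞^{(1)},rInf-1}, -t_{∞^{(2)},rInf-1})` and the `(1,2)` entry of the subleading one is `1`. -/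
def NormalizedAtInfinity {n : ℕ} (rInf : ℕ) (r : Fin n → ℕ) (X : Fin n → ℂ)
    (tInf : Fin 2 → ℕ → ℂ) (C : PolarCoeffs n) : Prop :=
  leadAtInfinity rInf C = Matrix.diagonal (fun a => -tInf a (rInf - 1)) ∧
    subleadAtInfinity rInf r X C 0 1 = 1

/-- Gauge transform `G L G⁻¹ + hbar (∂_z G) G⁻¹` of the connection `hbar ∂_z - L`. -/
def gaugeTransform (hbar : ℂ) (G L : ℂ → Matrix (Fin 2) (Fin 2) ℂ) (z : ℂ) :
    Matrix (Fin 2) (Fin 2) ℂ :=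
  G z * L z * (G z)⁻¹ + hbar • (Matrix.of fun i j => deriv (fun w => G w i j) z) * (G z)⁻¹

/-- `L` has irregular times `t a k`, `1 ≤ k < R`, and residues (monodromies) `t a 0` at the finite
pole `x`: a local holomorphic gauge transformation takes the singular part of `L` to
`diag (∑_{k<R} t a k (z - x)^{-k-1})`. -/
def HasTimesAt (hbar : ℂ) (L : ℂ → Matrix (Fin 2) (Fin 2) ℂ) (x : ℂ) (R : ℕ)
    (t : Fin 2 → ℕ → ℂ) : Prop :=
  ∃ G : ℂ → Matrix (Fin 2) (Fin 2) ℂ,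
    (∀ i j, AnalyticAt ℂ (fun z => G z i j) x) ∧ (G x).det ≠ 0 ∧
      ∀ i j, (fun z => (gaugeTransform hbar G L z - Matrix.diagonal
        (fun a => ∑ k ∈ Finset.range R, t a k * ((z - x) ^ (k + 1))⁻¹)) i j)
          =O[𝓝[≠] x] (fun _ => (1 : ℂ))

/-- `L` has irregular times `t a k`, `1 ≤ k < R`, and residues (monodromies) `t a 0` at infinity: a
gauge transformation `z ↦ G (1/z)`, holomorphic at infinity, takes the singular part of `L` to
`diag (-∑_{k<R} t a k z^{k-1})`. -/
def HasTimesAtInfinity (hbar : ℂ) (L : ℂ → Matrix (Fin 2) (Fin 2) ℂ) (R : ℕ)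
    (t : Fin 2 → ℕ → ℂ) : Prop :=
  ∃ G : ℂ → Matrix (Fin 2) (Fin 2) ℂ,
    (∀ i j, AnalyticAt ℂ (fun w => G w i j) 0) ∧ (G 0).det ≠ 0 ∧
      ∀ i j, (fun z => (gaugeTransform hbar (fun u => G u⁻¹) L z - Matrix.diagonal
        (fun a => -∑ k ∈ Finset.range R, t a k * z ^ ((k : ℤ) - 1))) i j)
          =O[Bornology.cobounded ℂ] (fun z => z ^ (-2 : ℤ))

/-! ### The space of deformation parameters -/

/-- The deformation parameters: irregular times `t_{∞^{(i)},k}` with `1 ≤ k ≤ rInf - 1` (stored at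
index `k - 1`), irregular times `t_{X_s^{(i)},k}` with `1 ≤ k ≤ r_s - 1` (stored at index `k - 1`),
and positions `X_s` of the finite poles.  It is also the space of deformation vectors `α`. -/
abbrev TimeSpace (n rInf : ℕ) (r : Fin n → ℕ) : Type :=
  (Fin 2 → Fin (rInf - 1) → ℂ) × ((s : Fin n) → Fin 2 → Fin (r s - 1) → ℂ) × (Fin n → ℂ)

/-- Sequence whose term of index `0` is `a` and whose terms of index `1, …, m` are given by `v`. -/
def withZeroth {m : ℕ} (a : ℂ) (v : Fin m → ℂ) (k : ℕ) : ℂ :=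
  if k = 0 then a else if h : k - 1 < m then v ⟨k - 1, h⟩ else 0

/-- Entry of index `k` of a finite vector (zero beyond its length). -/
def entryAt {m : ℕ} (v : Fin m → ℂ) (k : ℕ) : ℂ := if h : k < m then v ⟨k, h⟩ else 0

/-- The general deformation operator
`L_α = hbar ∑ α_{∞^{(i)},k} ∂_{t_{∞^{(i)},k}} + hbar ∑ α_{X_s^{(i)},k} ∂_{t_{X_s^{(i)},k}}
  + hbar ∑ α_{X_s} ∂_{X_s}`,
i.e. `hbar` times the derivative along the vector field `α`. -/
def deformationOp {n rInf : ℕ} {r : Fin n → ℕ} (hbar : ℂ)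
    (α : TimeSpace n rInf r → TimeSpace n rInf r) (f : TimeSpace n rInf r → ℂ)
    (τ : TimeSpace n rInf r) : ℂ :=
  hbar * fderiv ℂ f τ (α τ)

/-- The family `L τ`, `τ ∈ U`, is isomonodromic along `α`: there is a Lax pair, i.e. a rational
`A(z)`, with poles dominated by those of `L`, satisfying the zero-curvature equation
`L_α[L] = [A, L] + hbar ∂_z A`. -/
def IsIsomonodromicAlong {n rInf : ℕ} {r : Fin n → ℕ} (hbar : ℂ) (U : Set (TimeSpace n rInf r))
    (α : TimeSpace n rInf r → TimeSpace n rInf r)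
    (C : TimeSpace n rInf r → PolarCoeffs n) : Prop :=
  ∀ τ ∈ U, ∃ B : PolarCoeffs n, ∀ z : ℂ, (∀ s, z ≠ τ.2.2 s) → ∀ i j,
    deformationOp hbar α (fun σ => laxMatrix rInf r σ.2.2 (C σ) z i j) τ =
      (auxMatrix rInf r τ.2.2 B z * laxMatrix rInf r τ.2.2 (C τ) z
        - laxMatrix rInf r τ.2.2 (C τ) z * auxMatrix rInf r τ.2.2 B z) i j
      + hbar * deriv (fun w => auxMatrix rInf r τ.2.2 B w i j) z

/-! ### The coefficients entering the evolution equations -/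

/-- All the data that is fixed when the Hamiltonian is considered as a function of `(q, p)`. -/
structure DeformationData (n : ℕ) where
  /-- scaling parameter -/
  hbar : ℂ
  /-- order of the pole at infinity -/
  rInf : ℕ
  /-- orders of the finite poles -/
  r : Fin n → ℕ
  /-- finite poles -/
  X : Fin n → ℂ
  /-- `tInf i k = t_{∞^{(i)},k}`, `0 ≤ k ≤ rInf - 1` -/
  tInf : Fin 2 → ℕ → ℂ
  /-- `tX s i k = t_{X_s^{(i)},k}`, `0 ≤ k ≤ r_s - 1` -/
  tX : Fin n → Fin 2 → ℕ → ℂ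
  /-- `aInf i k = α_{∞^{(i)},k}`, `1 ≤ k ≤ rInf - 1` -/
  aInf : Fin 2 → ℕ → ℂ
  /-- `aX s i k = α_{X_s^{(i)},k}`, `1 ≤ k ≤ r_s - 1` -/
  aX : Fin n → Fin 2 → ℕ → ℂ
  /-- `aPole s = α_{X_s}` -/
  aPole : Fin n → ℂ

/-- The data at a point `τ` of the parameter space, for monodromies `mInf i = t_{∞^{(i)},0}`,
`mX s i = t_{X_s^{(i)},0}` and a deformation vector `a`. -/
def deformationData {n rInf : ℕ} {r : Fin n → ℕ} (hbar : ℂ) (mInf : Fin 2 → ℂ)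
    (mX : Fin n → Fin 2 → ℂ) (τ a : TimeSpace n rInf r) : DeformationData n where
  hbar := hbar
  rInf := rInf
  r := r
  X := τ.2.2
  tInf i := withZeroth (mInf i) (τ.1 i)
  tX s i := withZeroth (mX s i) (τ.2.1 s i)
  aInf i := withZeroth 0 (a.1 i)
  aX s i := withZeroth 0 (a.2.1 s i)
  aPole := a.2.2

/-- The lower triangular Toeplitz matrix `M` of size `R - 1` attached to a pole of order `R` with
times `t`: entry `(i, j)`, `j ≤ i`, is `t^{(1)}_{R-1-(i-j)} - t^{(2)}_{R-1-(i-j)}`. -/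
def toeplitzM (R : ℕ) (t : Fin 2 → ℕ → ℂ) : Matrix (Fin (R - 1)) (Fin (R - 1)) ℂ :=
  Matrix.of fun i j => if (j : ℕ) ≤ i then
    t 0 (R - 1 - ((i : ℕ) - j)) - t 1 (R - 1 - ((i : ℕ) - j)) else 0

/-- Solution `v` of `M v = ((α^{(1)}_{R-1} - α^{(2)}_{R-1})/(R-1), …, (α^{(1)}_1 - α^{(2)}_1)/1)`. -/
def nuVec (R : ℕ) (t a : Fin 2 → ℕ → ℂ) : Fin (R - 1) → ℂ :=
  ((toeplitzM R t)⁻¹).mulVec fun i =>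
    (a 0 (R - 1 - (i : ℕ)) - a 1 (R - 1 - (i : ℕ))) / ((R - 1 - (i : ℕ) : ℕ) : ℂ)

/-- The vector `(c_{R-1}, …, c_1)`, solution of `M c = b`, where for `i = 1, …, R - 1`
`b_i = ∑_{k=R-i}^{R-1} (t^{(2)}_{2R-1-i-k} α^{(1)}_k - t^{(1)}_{2R-1-i-k} α^{(2)}_k) / k`. -/
def cVec (R : ℕ) (t a : Fin 2 → ℕ → ℂ) : Fin (R - 1) → ℂ :=
  ((toeplitzM R t)⁻¹).mulVec fun i => ∑ k ∈ Finset.Icc (R - 1 - (i : ℕ)) (R - 1),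
    (t 1 (2 * R - 2 - (i : ℕ) - k) * a 0 k - t 0 (2 * R - 2 - (i : ℕ) - k) * a 1 k) / (k : ℂ)

/-- Genericity of a pole: the two exponents of highest order are distinct. -/
def DistinctLeading (R : ℕ) (t : Fin 2 → ℕ → ℂ) : Prop := t 0 (R - 1) ≠ t 1 (R - 1)

namespace DeformationData

variable {n g : ℕ} (D : DeformationData n)

/-- `c_{∞,k}`, `1 ≤ k ≤ rInf - 1`. -/
def cInf (k : ℕ) : ℂ := entryAt (cVec D.rInf D.tInf D.aInf) (D.rInf - 1 - k)

/-- `c_{X_s,k}`, `1 ≤ k ≤ r_s - 1`. -/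
def cX (s : Fin n) (k : ℕ) : ℂ := entryAt (cVec (D.r s) (D.tX s) (D.aX s)) (D.r s - 1 - k)

/-- The coefficients at infinity determined by `M_∞` alone: the value at `m` is `ν_{∞,m-1}`, for
`0 ≤ m ≤ rInf - 2`. -/
def nuInfShifted (m : ℕ) : ℂ := entryAt (nuVec D.rInf D.tInf D.aInf) m

/-- `ν_{X_s,k}`, `0 ≤ k ≤ r_s - 1`. -/
def nuX (s : Fin n) (k : ℕ) : ℂ :=
  if k = 0 then -D.aPole s else -entryAt (nuVec (D.r s) (D.tX s) (D.aX s)) (k - 1)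

/-- The rational function `P_1`. -/
def P1 (z : ℂ) : ℂ :=
  ∑ j ∈ Finset.range (D.rInf - 1), -(D.tInf 0 (j + 1) + D.tInf 1 (j + 1)) * z ^ j
    + ∑ s, ∑ j ∈ Finset.range (D.r s), (D.tX s 0 j + D.tX s 1 j) / (z - D.X s) ^ (j + 1)

/-- `P^{(2)}_{∞, 2 rInf - 4 - k}`, `0 ≤ k ≤ rInf - 1`. -/
def P2InfCoeff (k : ℕ) : ℂ :=
  ∑ j ∈ Finset.range (k + 1), D.tInf 0 (D.rInf - 1 - j) * D.tInf 1 (D.rInf - 1 - (k - j))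

/-- `P^{(2)}_{X_s, 2 r_s - k}`, `0 ≤ k ≤ r_s - 1`. -/
def P2XCoeff (s : Fin n) (k : ℕ) : ℂ :=
  ∑ j ∈ Finset.range (k + 1), D.tX s 0 (D.r s - 1 - j) * D.tX s 1 (D.r s - 1 - (k - j))

/-- The rational function
`P̃_2 = ∑_{j=max(0,rInf-3)}^{2rInf-4} P^{(2)}_{∞,j} z^j + ∑_s ∑_{j=r_s+1}^{2r_s} P^{(2)}_{X_s,j} (z-X_s)^{-j}`
(with `j = 2 rInf - 4 - k`, respectively `j = 2 r_s - k`). -/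
def P2tilde (z : ℂ) : ℂ :=
  (∑ k ∈ Finset.range D.rInf,
      if k + 4 ≤ 2 * D.rInf then D.P2InfCoeff k * z ^ (2 * D.rInf - 4 - k) else 0)
    + ∑ s, ∑ k ∈ Finset.range (D.r s), D.P2XCoeff s k / (z - D.X s) ^ (2 * D.r s - k)

/-- The linear system for `(ν_{∞,-1}, ν_{∞,0}, (μ_j)_j)` at `q`.  For `rInf ≥ 3` both `ν_{∞,-1}` and
`ν_{∞,0}` are given by `M_∞`, for `rInf = 2` only `ν_{∞,-1}` is, and for `rInf = 1` none of them; the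
remaining ones are unknowns of the system `V μ = ν`. -/
def IsNuMu (q : Fin g → ℂ) (y : ℂ × ℂ × (Fin g → ℂ)) : Prop :=
  (2 ≤ D.rInf → y.1 = D.nuInfShifted 0) ∧
  (3 ≤ D.rInf → y.2.1 = D.nuInfShifted 1) ∧
  (∀ k ∈ Finset.Icc 1 (D.rInf - 3), ∑ j, y.2.2 j * q j ^ (k - 1) = D.nuInfShifted (k + 1)) ∧
  (∀ s, ∀ k ∈ Finset.range (D.r s), ∑ j, y.2.2 j / (q j - D.X s) ^ (k + 1) =
    -D.nuX s k + (if k = 0 then y.2.1 + y.1 * D.X s else 0) + (if k = 1 then y.1 else 0))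

/-- The solution of the previous system. -/
def nuMu (q : Fin g → ℂ) : ℂ × ℂ × (Fin g → ℂ) := Classical.epsilon (D.IsNuMu q)

/-- `ν_{∞,-1}` -/
def nuInfNegOne (q : Fin g → ℂ) : ℂ := (D.nuMu q).1

/-- `ν_{∞,0}` -/
def nuInfZero (q : Fin g → ℂ) : ℂ := (D.nuMu q).2.1

/-- `μ_j` -/
def mu (q : Fin g → ℂ) (j : Fin g) : ℂ := (D.nuMu q).2.2 j

/-- The type of the isospectral coefficients `(H_{∞,k})_{0≤k≤rInf-4}`, `(H_{X_s,k})_{1≤k≤r_s}`, the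
latter being stored at index `k - 1`. -/
abbrev HType : Type := (Fin (D.rInf - 3) → ℂ) × ((s : Fin n) → Fin (D.r s) → ℂ)

/-- The linear system that determines the isospectral coefficients at `(q, p)`. -/
def IsH (q p : Fin g → ℂ) (h : D.HType) : Prop :=
  (∀ j, ∑ k, h.1 k * q j ^ (k : ℕ) + ∑ s, ∑ k, h.2 s k / (q j - D.X s) ^ ((k : ℕ) + 1) =
    p j ^ 2 - D.P1 (q j) * p j + p j * ∑ s, D.hbar * D.r s / (q j - D.X s) + D.P2tilde (q j)
      + D.hbar * ∑ i ∈ Finset.univ.erase j, (p i - p j) / (q j - q i)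
      + if 3 ≤ D.rInf then D.hbar * D.tInf 0 (D.rInf - 1) * q j ^ (D.rInf - 3) else 0) ∧
  (D.rInf = 2 → ∑ s, entryAt (h.2 s) 0 = D.hbar * ∑ j, p j
    - (D.tInf 0 1 * D.tInf 1 0 + D.tInf 1 1 * D.tInf 0 0 + D.hbar * D.tInf 0 1)) ∧
  (D.rInf = 1 → ∑ s, entryAt (h.2 s) 0 = D.hbar * ∑ j, p j ∧
    ∑ s, D.X s * entryAt (h.2 s) 0 + (∑ s, if 2 ≤ D.r s then entryAt (h.2 s) 1 else 0) =
      D.hbar * ∑ j, q j * p j + (∑ s, if D.r s = 1 then D.tX s 0 0 * D.tX s 1 0 else 0)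
        - D.tInf 0 0 * (D.tInf 1 0 + D.hbar))

/-- The solution of the previous system. -/
def solH (q p : Fin g → ℂ) : D.HType := Classical.epsilon (D.IsH q p)

/-- `H_{∞,k}`, `0 ≤ k ≤ rInf - 4` -/
def HInf (q p : Fin g → ℂ) (k : ℕ) : ℂ := entryAt (D.solH q p).1 k

/-- `H_{X_s,k}`, `1 ≤ k ≤ r_s` -/
def HX (q p : Fin g → ℂ) (s : Fin n) (k : ℕ) : ℂ := entryAt ((D.solH q p).2 s) (k - 1)

/-- The Hamiltonian; `c0` is the (irrelevant, undetermined) constant `c_{∞,0}`. -/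
def Ham (c0 : ℂ) (q p : Fin g → ℂ) : ℂ :=
  ∑ k ∈ Finset.range (D.rInf - 3), D.nuInfShifted (k + 2) * D.HInf q p k
  - ∑ s, ∑ k ∈ Finset.Icc 2 (D.r s), D.nuX s (k - 1) * D.HX q p s k
  + ∑ s, D.aPole s * D.HX q p s 1
  - D.hbar * ∑ j, (c0 + ∑ k ∈ Finset.Icc 1 (D.rInf - 1), D.cInf k * q j ^ k
      + ∑ s, ∑ k ∈ Finset.Icc 1 (D.r s - 1), D.cX s k / (q j - D.X s) ^ k)
  + D.nuInfNegOne q * ∑ s, (D.X s * D.HX q p s 1 + if 2 ≤ D.r s then D.HX q p s 2 else 0)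
  + D.nuInfZero q * ∑ s, D.HX q p s 1
  - (if D.rInf = 1 ∨ D.rInf = 2 then
      (∑ s, D.HX q p s 1 - D.hbar * ∑ j, p j) * D.nuInfZero q else 0)
  - (if D.rInf = 1 then
      (∑ s, D.X s * D.HX q p s 1 + (∑ s, if 2 ≤ D.r s then D.HX q p s 2 else 0)
        - D.hbar * ∑ j, q j * p j) * D.nuInfNegOne q else 0)
  - D.hbar * D.nuInfZero q * ∑ j, p j - D.hbar * D.nuInfNegOne q * ∑ j, q j * p j

/-- Right-hand side of the evolution equation of `q_j`. -/
def qEvolution (q p : Fin g → ℂ) (j : Fin g) : ℂ :=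
  2 * D.mu q j * (p j - 1 / 2 * D.P1 (q j) + 1 / 2 * ∑ s, D.hbar * D.r s / (q j - D.X s))
  - D.hbar * D.nuInfZero q - D.hbar * D.nuInfNegOne q * q j
  - D.hbar * ∑ i ∈ Finset.univ.erase j, (D.mu q j + D.mu q i) / (q j - q i)

/-- Right-hand side of the evolution equation of `p_j`. -/
def pEvolution (q p : Fin g → ℂ) (j : Fin g) : ℂ :=
  D.hbar * ∑ i ∈ Finset.univ.erase j, (D.mu q i + D.mu q j) * (p i - p j) / (q j - q i) ^ 2
  + D.mu q j * (p j * deriv D.P1 (q j) + p j * ∑ s, D.hbar * D.r s / (q j - D.X s) ^ 2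
      - deriv D.P2tilde (q j)
      + ∑ k ∈ Finset.Icc 1 (D.rInf - 4), (k : ℂ) * D.HInf q p k * q j ^ (k - 1)
      - ∑ s, ∑ k ∈ Finset.Icc 1 (D.r s), (k : ℂ) * D.HX q p s k / (q j - D.X s) ^ (k + 1)
      - if 3 ≤ D.rInf then
          D.hbar * ((D.rInf - 3 : ℕ) : ℂ) * D.tInf 0 (D.rInf - 1) * q j ^ (D.rInf - 4) else 0)
  + D.hbar * D.nuInfNegOne q * p j
  + D.hbar * ∑ k ∈ Finset.Icc 1 (D.rInf - 1), (k : ℂ) * D.cInf k * q j ^ (k - 1)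
  - D.hbar * ∑ s, ∑ k ∈ Finset.Icc 1 (D.r s - 1), (k : ℂ) * D.cX s k / (q j - D.X s) ^ (k + 1)

end DeformationData

end

/-!
The deformation of `L` is governed by the zero curvature equation `ℒ L = [A, L] + ħ ∂_z A`, which is
used in two ways: its polar parts determine the first row of `A`, and its values at the apparent
singularities `q_j` are the evolution equations.

*First variation.* The trace and the determinant of the polar parts of `L` are invariant under the
gauge transformations to the order that matters, hence determined by the times
(`trace_det_dvd_of_hasTimesAt`, `trace_det_dvd_of_hasTimesAtInfinity`).  Differentiating these
congruences along the vector field leaves purely algebraic conditions at each parameter, collected in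
`IsLaxJet` (`exists_isLaxJet`); everything that follows is a consequence of them.

*The polar parts of `A`.* Near a pole the zero curvature equation says that `A` and `L` nearly
commute.  As the leading eigenvalues of `L` are distinct (and not resonant at a simple pole), `A` is
there a combination `u + v L` of the identity and of `L` (`exists_scalar_combination_finite`,
`exists_scalar_combination_infinity`).  The variation of the trace and of the determinant turns into
equations for the eigenvalues of `u + v L` (`eigenvalue_equation`), and these are the two Toeplitz
systems that define `ν` and `c` (`aux_sub_nu_lax_fin`, `aux_sub_nu_lax_inf`).

*The first row of `A`.* The resolvent `ν_{∞,-1} z + ν_{∞,0} + ∑_i μ_i / (z - q_i)` has, by the linear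
system for `μ`, the expansion `ν` at every pole.  Liouville's theorem then gives `A₁₂` as the
resolvent times `L₁₂`, which vanishes at the `q_i`, and `A₁₁` as the resolvent times `L₁₁` with the
poles at the `q_i` removed, plus the rational function with coefficients `c`
(`IsLaxJet.aux01_eq`, `IsLaxJet.aux00_eq`).

*The linear systems.* Up to auxiliary unknowns making them uniform in `rInf`, the systems for `μ` and
for the isospectral coefficients are transposes of each other
(`evalMap_momentMap_pairing`).  They are uniquely solvable because a rational function with poles of
order at most `r_s` at `X_s`, which is `O(z^{rInf-4})` at infinity and has `g` zeros `q_j`, vanishes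
(`eq_zero_of_interpolation`).  By the same principle the isospectral coefficients are the partial
fraction coefficients of an explicit function built from `P̃_2 - det L` (`IsLaxJet.spectralFun_eq`);
its derivative at `q_j` gives the product `L₁₂'(q_j) L₂₁(q_j)`.

*The evolution.* Inserting this in the zero curvature equation at `q_j` gives the velocities of
`q_j` and `p_j` (`IsLaxJet.eq_qEvolution`, `IsLaxJet.pEvolution_eq`).

*The Hamiltonian.* By transposition the Hamiltonian is `∑_j μ_j` times the right-hand sides of the
system for the isospectral coefficients, plus elementary terms (`ham_eq`).  As `μ` depends on `q`
only, the derivative in `p` is immediate (`hasDerivAt_ham_p`).  For the derivative in `q` the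
isospectral coefficients are frozen at the point considered; the terms containing the derivatives of
`μ` are then multiplied by the defect of the linear system, which vanishes (`hasDerivAt_ham_q`).
-/

namespace Isomonodromy

section

/-! ### Liouville's theorem with finitely many removable singularities -/

/-- Liouville's theorem for a function holomorphic off a finite set, near which and at infinity it is
bounded.  Nothing is asserted about the values of `f` on the exceptional set. -/
theorem exists_const_of_isBigO_one {f : ℂ → ℂ} {S : Set ℂ} (hS : S.Finite)
    (hd : ∀ z ∉ S, DifferentiableAt ℂ f z)
    (hb : ∀ s ∈ S, f =O[𝓝[≠] s] (fun _ => (1 : ℂ)))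
    (hinf : f =O[Bornology.cobounded ℂ] (fun _ => (1 : ℂ))) :
    ∃ c, ∀ z ∉ S, f z = c := by
  have hdev : ∀ z, ∀ᶠ w in 𝓝[≠] z, w ∉ S := by
    intro z
    have h1 : IsOpen (S \ {z})ᶜ := (hS.subset Set.sdiff_subset).isClosed.isOpen_compl
    have h2 : (S \ {z})ᶜ ∈ 𝓝 z := h1.mem_nhds (by simp)
    filter_upwards [mem_nhdsWithin_of_mem_nhds h2, self_mem_nhdsWithin] with w hw hwz hwS
    exact hw ⟨hwS, hwz⟩
  have hbz : ∀ z, f =O[𝓝[≠] z] (fun _ => (1 : ℂ)) := by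
    intro z
    by_cases hz : z ∈ S
    · exact hb z hz
    · exact ((hd z hz).continuousAt.tendsto.isBigO_one ℂ).mono nhdsWithin_le_nhds
  let F : ℂ → ℂ := fun z => limUnder (𝓝[≠] z) f
  have hFf : ∀ z ∉ S, F z = f z := fun z hz =>
    ((hd z hz).continuousAt.tendsto.mono_left nhdsWithin_le_nhds).limUnder_eq
  have hFd : Differentiable ℂ F := by
    intro z
    have hset : {w | w ∉ S} ∈ 𝓝[≠] z := hdev z
    have hlo : (fun w => f w - f z) =o[𝓝[≠] z] fun w => (w - z)⁻¹ := by
      refine IsBoundedUnder.isLittleO_sub_self_inv ?_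
      have : (fun w => f w - f z) =O[𝓝[≠] z] (fun _ => (1 : ℂ)) :=
        (hbz z).sub (isBigO_const_const _ one_ne_zero _)
      exact (isBigO_one_iff ℂ).1 this
    have h := Complex.differentiableOn_update_limUnder_insert_of_isLittleO hset
      (fun w hw => (hd w hw).differentiableWithinAt) hlo
    have h' := h.differentiableAt (insert_mem_nhds_iff.2 hset)
    refine h'.congr_of_eventuallyEq ?_
    have : ∀ᶠ w in 𝓝 z, w ≠ z → w ∉ S := eventually_nhdsWithin_iff.1 (hdev z)
    filter_upwards [this] with w hw
    by_cases hwz : w = z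
    · subst hwz; simp [F]
    · rw [Function.update_of_ne hwz, hFf w (hw hwz)]
  have hbdd : Bornology.IsBounded (Set.range F) := by
    have hF1 : F =O[Bornology.cobounded ℂ] (fun _ => (1 : ℂ)) := by
      refine hinf.congr' ?_ EventuallyEq.rfl
      have : Sᶜ ∈ Bornology.cobounded ℂ := by
        rw [← Bornology.isBounded_def]; exact hS.isBounded
      filter_upwards [this] with z hz
      exact (hFf z hz).symm
    obtain ⟨c, hc⟩ := hF1.bound
    obtain ⟨R, -, hR⟩ := (hasBasis_cobounded_norm (E := ℂ)).eventually_iff.1 hc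
    obtain ⟨M, hM⟩ := (isCompact_closedBall (0 : ℂ) R).exists_bound_of_continuousOn
      hFd.continuous.continuousOn
    rw [isBounded_iff_forall_norm_le]
    refine ⟨max c M, ?_⟩
    rintro _ ⟨z, rfl⟩
    rcases le_total ‖z‖ R with h | h
    · exact le_max_of_le_right (hM z (by simpa using h))
    · exact le_max_of_le_left (by simpa using hR h)
  obtain ⟨c, hc⟩ := hFd.exists_const_forall_eq_of_bounded hbdd
  exact ⟨c, fun z hz => by rw [← hFf z hz, hc]⟩

/-- The form of Liouville's theorem in which the constant is identified by the limit at infinity. -/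
theorem eq_zero_of_tendsto_zero {f : ℂ → ℂ} {S : Set ℂ} (hS : S.Finite)
    (hd : ∀ z ∉ S, DifferentiableAt ℂ f z)
    (hb : ∀ s ∈ S, f =O[𝓝[≠] s] (fun _ => (1 : ℂ)))
    (hinf : Tendsto f (Bornology.cobounded ℂ) (𝓝 0)) :
    ∀ z ∉ S, f z = 0 := by
  obtain ⟨c, hc⟩ := exists_const_of_isBigO_one hS hd hb (hinf.isBigO_one ℂ)
  have h1 : Tendsto f (Bornology.cobounded ℂ) (𝓝 c) := by
    refine tendsto_const_nhds.congr' ?_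
    have : Sᶜ ∈ Bornology.cobounded ℂ := by
      rw [← Bornology.isBounded_def]; exact hS.isBounded
    filter_upwards [this] with z hz
    exact (hc z hz).symm
  intro z hz
  rw [hc z hz]
  exact tendsto_nhds_unique h1 hinf

/-! ### Truncated expansions -/

/-- The polynomial `P` is, modulo `x ^ N`, the Taylor expansion of `f` at the puncture `x = 0`. -/
def HasTrunc (N : ℕ) (f : ℂ → ℂ) (P : Polynomial ℂ) : Prop :=
  (fun x => f x - P.eval x) =O[𝓝[≠] (0 : ℂ)] (fun x => x ^ N)

theorem polynomial_isBigO_one (P : Polynomial ℂ) :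
    (fun x => P.eval x) =O[𝓝[≠] (0 : ℂ)] (fun _ => (1 : ℂ)) :=
  (P.continuous.continuousAt.tendsto.isBigO_one ℂ).mono nhdsWithin_le_nhds

theorem isBigO_pow_of_le {m n : ℕ} (h : m ≤ n) :
    (fun x : ℂ => x ^ n) =O[𝓝[≠] (0 : ℂ)] (fun x => x ^ m) :=
  IsBigO.of_bound 1 (by
    filter_upwards [mem_nhdsWithin_of_mem_nhds (Metric.closedBall_mem_nhds (0 : ℂ) one_pos)]
      with x hx
    rw [norm_pow, norm_pow, one_mul]
    exact pow_le_pow_of_le_one (norm_nonneg _) (by simpa using hx) h)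

namespace HasTrunc

variable {N M : ℕ} {f g : ℂ → ℂ} {P Q : Polynomial ℂ}

theorem mono (h : HasTrunc N f P) (hM : M ≤ N) : HasTrunc M f P :=
  IsBigO.trans h (isBigO_pow_of_le hM)

theorem poly (N : ℕ) (P : Polynomial ℂ) : HasTrunc N (fun x => P.eval x) P := by
  simp [HasTrunc, isBigO_zero]

theorem add (hf : HasTrunc N f P) (hg : HasTrunc N g Q) :
    HasTrunc N (fun x => f x + g x) (P + Q) := by
  refine (IsBigO.add hf hg).congr_left fun x => ?_
  simp only [Polynomial.eval_add]; ring

theorem neg (hf : HasTrunc N f P) : HasTrunc N (fun x => -f x) (-P) := by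
  refine (IsBigO.neg_left hf).congr_left fun x => ?_
  simp only [Polynomial.eval_neg]; ring

theorem sub (hf : HasTrunc N f P) (hg : HasTrunc N g Q) :
    HasTrunc N (fun x => f x - g x) (P - Q) := by
  simpa only [sub_eq_add_neg] using hf.add hg.neg

theorem isBigO_one (hf : HasTrunc N f P) : f =O[𝓝[≠] (0 : ℂ)] (fun _ => (1 : ℂ)) := by
  have h0 : (fun x => f x - P.eval x) =O[𝓝[≠] (0 : ℂ)] (fun _ => (1 : ℂ)) := by
    exact IsBigO.congr_right (hf.mono (Nat.zero_le N)) fun x => pow_zero x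
  simpa using h0.add (polynomial_isBigO_one P)

theorem mul (hf : HasTrunc N f P) (hg : HasTrunc N g Q) :
    HasTrunc N (fun x => f x * g x) (P * Q) := by
  have h1 := IsBigO.mul hf hg.isBigO_one
  have h2 := IsBigO.mul (polynomial_isBigO_one P) hg
  refine ((h1.congr_right fun x => mul_one _).add (h2.congr_right fun x => one_mul _)).congr_left
    fun x => ?_
  simp only [Polynomial.eval_mul]; ring

theorem const_mul (c : ℂ) (hf : HasTrunc N f P) :
    HasTrunc N (fun x => c * f x) (Polynomial.C c * P) := by
  simpa using (poly N (Polynomial.C c)).mul hf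

theorem pow_mul (k : ℕ) (hf : HasTrunc N f P) :
    HasTrunc (N + k) (fun x => x ^ k * f x) (Polynomial.X ^ k * P) := by
  refine (IsBigO.mul (isBigO_refl (fun x : ℂ => x ^ k) _) hf).congr (fun x => ?_) (fun x => ?_)
  · simp only [Polynomial.eval_mul, Polynomial.eval_pow, Polynomial.eval_X]; ring
  · ring

theorem of_pow_mul (k : ℕ) (hf : HasTrunc (N + k) (fun x => x ^ k * f x) (Polynomial.X ^ k * P)) :
    HasTrunc N f P := by
  have h := IsBigO.mul (isBigO_refl (fun x : ℂ => (x ^ k)⁻¹) (𝓝[≠] 0)) hf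
  refine h.congr' ?_ ?_
  · filter_upwards [self_mem_nhdsWithin] with x hx
    have : x ≠ 0 := hx
    simp only [Polynomial.eval_mul, Polynomial.eval_pow, Polynomial.eval_X]
    field_simp
  · filter_upwards [self_mem_nhdsWithin] with x hx
    have : x ≠ 0 := hx
    field_simp; ring

theorem congr' (hf : HasTrunc N f P) (h : f =ᶠ[𝓝[≠] 0] g) : HasTrunc N g P :=
  IsBigO.congr' hf (h.mono fun x hx => by simp only [hx]) EventuallyEq.rfl

theorem congr_of_ne (hf : HasTrunc N f P) (h : ∀ x ≠ 0, f x = g x) : HasTrunc N g P :=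
  hf.congr' (by filter_upwards [self_mem_nhdsWithin] with x hx using h x hx)

theorem sum {ι : Type*} (s : Finset ι) {f : ι → ℂ → ℂ} {P : ι → Polynomial ℂ}
    (h : ∀ i ∈ s, HasTrunc N (f i) (P i)) :
    HasTrunc N (fun x => ∑ i ∈ s, f i x) (∑ i ∈ s, P i) := by
  refine (IsBigO.sum (fun i hi => h i hi)).congr_left fun x => ?_
  simp [Polynomial.eval_finsetSum]

theorem of_isBigO (h : f =O[𝓝[≠] (0 : ℂ)] (fun x => x ^ N)) : HasTrunc N f 0 := by
  simpa [HasTrunc] using h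

theorem isBigO (h : HasTrunc N f 0) : f =O[𝓝[≠] (0 : ℂ)] (fun x => x ^ N) := by
  simpa [HasTrunc] using h

theorem isBigO_of_dvd (h : HasTrunc N f P) (hP : Polynomial.X ^ N ∣ P) :
    f =O[𝓝[≠] (0 : ℂ)] (fun x => x ^ N) := by
  obtain ⟨Q, rfl⟩ := hP
  have h2 : (fun x : ℂ => (Polynomial.X ^ N * Q).eval x) =O[𝓝[≠] (0 : ℂ)] (fun x => x ^ N) := by
    have := IsBigO.mul (isBigO_refl (fun x : ℂ => x ^ N) (𝓝[≠] 0)) (polynomial_isBigO_one Q)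
    simpa using this
  simpa using IsBigO.add h h2

theorem dvd_of_isBigO {P : Polynomial ℂ} :
    ∀ {N : ℕ}, (fun x => P.eval x) =O[𝓝[≠] (0 : ℂ)] (fun x => x ^ N) → Polynomial.X ^ N ∣ P := by
  intro N
  induction N with
  | zero => simp
  | succ N ih =>
    intro h
    obtain ⟨Q, rfl⟩ := ih (h.trans (isBigO_pow_of_le N.le_succ))
    rw [pow_succ]
    refine mul_dvd_mul_left _ ?_
    rw [Polynomial.X_dvd_iff, Polynomial.coeff_zero_eq_eval_zero]
    have h1 : (fun x => Q.eval x) =O[𝓝[≠] (0 : ℂ)] (fun x => x) := by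
      have h2 := IsBigO.mul (isBigO_refl (fun x : ℂ => (x ^ N)⁻¹) (𝓝[≠] 0)) h
      refine h2.congr' ?_ ?_
      · filter_upwards [self_mem_nhdsWithin] with x hx
        have : x ≠ 0 := hx
        simp [this]
      · filter_upwards [self_mem_nhdsWithin] with x hx
        have : x ≠ 0 := hx
        rw [pow_succ]
        field_simp
    have h3 : Tendsto (fun x => Q.eval x) (𝓝[≠] (0 : ℂ)) (𝓝 0) :=
      h1.trans_tendsto (tendsto_id.mono_left nhdsWithin_le_nhds)
    exact tendsto_nhds_unique
      (Q.continuous.continuousAt.tendsto.mono_left nhdsWithin_le_nhds) h3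

/-- Truncated expansions are unique modulo `X ^ N`. -/
theorem dvd_sub (hf : HasTrunc N f P) (hg : HasTrunc N f Q) : Polynomial.X ^ N ∣ P - Q := by
  apply dvd_of_isBigO
  refine (IsBigO.sub hg hf).congr_left fun x => ?_
  simp only [Polynomial.eval_sub]; ring

theorem dvd (hf : HasTrunc N (fun _ => 0) P) : Polynomial.X ^ N ∣ P := by
  have := hf.dvd_sub (poly N (0 : Polynomial ℂ) |>.congr_of_ne (g := fun _ => 0) (by simp))
  simpa using this

end HasTrunc

end

section

/-! ### Rational functions given by their polar parts -/

/-- The rational function with polynomial part `∑_{k<N} c k z^k` and polar parts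
`∑_{k<r_s} b s k (z - X_s)^{-k-1}`. -/
noncomputable def ratFn {n : ℕ} (N : ℕ) (r : Fin n → ℕ) (X : Fin n → ℂ) (c : ℕ → ℂ)
    (b : Fin n → ℕ → ℂ) (z : ℂ) : ℂ :=
  ∑ k ∈ Finset.range N, c k * z ^ k
    + ∑ s, ∑ k ∈ Finset.range (r s), b s k * ((z - X s) ^ (k + 1))⁻¹

theorem laxMatrix_apply {n : ℕ} (rInf : ℕ) (r : Fin n → ℕ) (X : Fin n → ℂ)
    (C : PolarCoeffs n) (z : ℂ) (i j : Fin 2) :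
    laxMatrix rInf r X C z i j =
      ratFn (rInf - 1) r X (fun k => C.inf (k + 1) i j) (fun s k => C.fin s k i j) z := by
  have h : Finset.Icc 1 (rInf - 1) = (Finset.range (rInf - 1)).image (· + 1) := by
    ext k; simp only [Finset.mem_Icc, Finset.mem_image, Finset.mem_range]
    constructor
    · intro h; exact ⟨k - 1, by omega, by omega⟩
    · rintro ⟨a, ha, rfl⟩; omega
  simp only [laxMatrix, ratFn, Matrix.add_apply, Matrix.sum_apply, Matrix.smul_apply, smul_eq_mul,
    h, mul_comm]
  rw [Finset.sum_image (by simp)]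
  simp

theorem auxMatrix_apply {n : ℕ} (rInf : ℕ) (r : Fin n → ℕ) (X : Fin n → ℂ)
    (C : PolarCoeffs n) (z : ℂ) (i j : Fin 2) :
    auxMatrix rInf r X C z i j =
      ratFn rInf r X (fun k => C.inf k i j) (fun s k => C.fin s k i j) z := by
  simp only [auxMatrix, ratFn, Matrix.add_apply, Matrix.sum_apply, Matrix.smul_apply, smul_eq_mul,
    mul_comm]

/-- The derivative of a rational function along a curve in the space of coefficients, poles and
arguments. -/
theorem hasDerivAt_ratFn_curve {n : ℕ} (N : ℕ) (r : Fin n → ℕ) {X : ℂ → Fin n → ℂ}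
    {c : ℂ → ℕ → ℂ} {b : ℂ → Fin n → ℕ → ℂ} {ζ : ℂ → ℂ} {X' : Fin n → ℂ} {c' : ℕ → ℂ}
    {b' : Fin n → ℕ → ℂ} {ζ' e : ℂ}
    (hX : ∀ s, HasDerivAt (fun ε => X ε s) (X' s) e)
    (hc : ∀ k < N, HasDerivAt (fun ε => c ε k) (c' k) e)
    (hb : ∀ s, ∀ k < r s, HasDerivAt (fun ε => b ε s k) (b' s k) e)
    (hζ : HasDerivAt ζ ζ' e) (hne : ∀ s, ζ e ≠ X e s) :
    HasDerivAt (fun ε => ratFn N r (X ε) (c ε) (b ε) (ζ ε))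
      (ratFn N (fun s => r s + 1) (X e) c'
          (fun s k => (if k < r s then b' s k else 0) + k * X' s * b e s (k - 1)) (ζ e)
        + ratFn (N - 1) (fun s => r s + 1) (X e) (fun k => (k + 1) * c e (k + 1))
          (fun s k => -(k : ℂ) * b e s (k - 1)) (ζ e) * ζ') e := by
  have h1 : HasDerivAt (fun ε => ∑ k ∈ Finset.range N, c ε k * ζ ε ^ k)
      (∑ k ∈ Finset.range N, (c' k * ζ e ^ k + c e k * ((k : ℂ) * ζ e ^ (k - 1) * ζ'))) e :=
    HasDerivAt.fun_sum fun k hk => (hc k (Finset.mem_range.1 hk)).mul (hζ.pow k)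
  have h2 : HasDerivAt (fun ε => ∑ s, ∑ k ∈ Finset.range (r s),
      b ε s k * ((ζ ε - X ε s) ^ (k + 1))⁻¹)
      (∑ s, ∑ k ∈ Finset.range (r s), (b' s k * ((ζ e - X e s) ^ (k + 1))⁻¹
        + b e s k * (-(((k + 1 : ℕ) : ℂ) * (ζ e - X e s) ^ (k + 1 - 1) * (ζ' - X' s))
          / ((ζ e - X e s) ^ (k + 1)) ^ 2))) e := by
    refine HasDerivAt.fun_sum fun s _ => HasDerivAt.fun_sum fun k hk => ?_
    exact (hb s k (Finset.mem_range.1 hk)).mul (((hζ.sub (hX s)).pow (k + 1)).inv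
      (pow_ne_zero _ (sub_ne_zero.2 (hne s))))
  refine (h1.add h2).congr_deriv ?_
  have e1 : ∑ k ∈ Finset.range N, c e k * ((k : ℂ) * ζ e ^ (k - 1) * ζ') =
      (∑ k ∈ Finset.range (N - 1), ((k : ℂ) + 1) * c e (k + 1) * ζ e ^ k) * ζ' := by
    cases N with
    | zero => simp
    | succ N =>
      rw [Finset.sum_range_succ']
      simp only [Nat.add_sub_cancel, Nat.cast_zero, zero_mul, mul_zero, add_zero, Finset.sum_mul]
      refine Finset.sum_congr rfl fun k _ => ?_
      push_cast; ring
  have e2 : ∀ s, ∑ k ∈ Finset.range (r s), (b' s k * ((ζ e - X e s) ^ (k + 1))⁻¹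
        + b e s k * (-(((k + 1 : ℕ) : ℂ) * (ζ e - X e s) ^ (k + 1 - 1) * (ζ' - X' s))
          / ((ζ e - X e s) ^ (k + 1)) ^ 2)) =
      ∑ k ∈ Finset.range (r s + 1), ((if k < r s then b' s k else 0) + k * X' s * b e s (k - 1))
        * ((ζ e - X e s) ^ (k + 1))⁻¹
      + (∑ k ∈ Finset.range (r s + 1), -(k : ℂ) * b e s (k - 1) * ((ζ e - X e s) ^ (k + 1))⁻¹)
        * ζ' := by
    intro s
    have hz : ζ e - X e s ≠ 0 := sub_ne_zero.2 (hne s)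
    have a1 : ∑ k ∈ Finset.range (r s + 1), ((if k < r s then b' s k else 0))
        * ((ζ e - X e s) ^ (k + 1))⁻¹ =
        ∑ k ∈ Finset.range (r s), b' s k * ((ζ e - X e s) ^ (k + 1))⁻¹ := by
      rw [Finset.sum_range_succ]
      simp only [lt_irrefl, if_false, zero_mul, add_zero]
      exact Finset.sum_congr rfl fun k hk => by rw [if_pos (Finset.mem_range.1 hk)]
    simp only [add_mul (ite _ _ _)]
    rw [Finset.sum_add_distrib, Finset.sum_add_distrib, a1,
      Finset.sum_range_succ' (fun k : ℕ => (k : ℂ) * X' s * b e s (k - 1)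
        * ((ζ e - X e s) ^ (k + 1))⁻¹),
      Finset.sum_range_succ' (fun k : ℕ => -(k : ℂ) * b e s (k - 1) * ((ζ e - X e s) ^ (k + 1))⁻¹)]
    simp only [Nat.cast_zero, zero_mul, neg_zero, add_zero, Finset.sum_mul]
    rw [add_assoc]
    congr 1
    rw [← Finset.sum_add_distrib]
    refine Finset.sum_congr rfl fun k _ => ?_
    simp only [Nat.add_sub_cancel]
    push_cast
    field_simp
    ring
  simp only [ratFn]
  rw [Finset.sum_add_distrib, e1, Finset.sum_congr rfl fun s _ => e2 s, Finset.sum_add_distrib,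
    add_mul, Finset.sum_mul Finset.univ]
  ring

variable {n : ℕ} (N : ℕ) (r : Fin n → ℕ) (X : Fin n → ℂ) (c : ℕ → ℂ) (b : Fin n → ℕ → ℂ)

/-- The derivative of `ratFn`. -/
noncomputable def ratFnDeriv (z : ℂ) : ℂ :=
  ratFn (N - 1) (fun s => r s + 1) X (fun k => (k + 1) * c (k + 1))
    (fun s k => -(k : ℂ) * b s (k - 1)) z

theorem hasDerivAt_ratFn {z : ℂ} (hz : ∀ s, z ≠ X s) :
    HasDerivAt (ratFn N r X c b) (ratFnDeriv N r X c b z) z := by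
  have := hasDerivAt_ratFn_curve N r (X := fun _ => X) (c := fun _ => c) (b := fun _ => b)
    (ζ := id) (X' := 0) (c' := 0) (b' := 0) (e := z) (ζ' := 1)
    (fun s => hasDerivAt_const _ _) (fun k _ => hasDerivAt_const _ _)
    (fun s k _ => hasDerivAt_const _ _) (hasDerivAt_id z) hz
  refine this.congr_deriv ?_
  simp [ratFn, ratFnDeriv]

theorem differentiableAt_ratFn {z : ℂ} (hz : ∀ s, z ≠ X s) :
    DifferentiableAt ℂ (ratFn N r X c b) z :=
  (hasDerivAt_ratFn N r X c b hz).differentiableAt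

theorem isOpen_off_poles (X : Fin n → ℂ) : IsOpen {z : ℂ | ∀ s, z ≠ X s} := by
  have : {z : ℂ | ∀ s, z ≠ X s} = (Set.range X)ᶜ := by
    ext z; simp [eq_comm]
  rw [this]
  exact (Set.finite_range X).isClosed.isOpen_compl

theorem ratFn_add (c' : ℕ → ℂ) (b' : Fin n → ℕ → ℂ) (z : ℂ) :
    ratFn N r X (fun k => c k + c' k) (fun s k => b s k + b' s k) z =
      ratFn N r X c b z + ratFn N r X c' b' z := by
  simp only [ratFn, add_mul, Finset.sum_add_distrib]; ring

/-- The polynomial `∑_{k<R} β k x^{R-1-k}`, which is `x^R` times the polar part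
`∑_{k<R} β k x^{-k-1}`. -/
noncomputable def polarPoly (R : ℕ) (β : ℕ → ℂ) : Polynomial ℂ :=
  ∑ k ∈ Finset.range R, Polynomial.C (β k) * Polynomial.X ^ (R - 1 - k)

theorem coeff_polarPoly (R : ℕ) (β : ℕ → ℂ) (m : ℕ) :
    (polarPoly R β).coeff m = if m < R then β (R - 1 - m) else 0 := by
  simp only [polarPoly, Polynomial.finsetSum_coeff, Polynomial.coeff_C_mul,
    Polynomial.coeff_X_pow, mul_ite, mul_one, mul_zero]
  split_ifs with h
  · rw [Finset.sum_eq_single (R - 1 - m)]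
    · rw [if_pos (by omega)]
    · intro k hk hne
      rw [Finset.mem_range] at hk
      rw [if_neg (by omega)]
    · intro hk; simp at hk; omega
  · refine Finset.sum_eq_zero fun k hk => ?_
    rw [Finset.mem_range] at hk
    rw [if_neg (by omega)]

theorem isBigO_shift {f g : ℂ → ℂ} {a : ℂ} :
    (fun x => f (a + x)) =O[𝓝[≠] (0 : ℂ)] (fun x => g (a + x)) ↔ f =O[𝓝[≠] a] g := by
  have h : Filter.map (fun x => a + x) (𝓝[≠] (0 : ℂ)) = 𝓝[≠] a := by
    have h := (Homeomorph.addLeft a).map_punctured_nhds_eq 0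
    simp only [Homeomorph.coe_addLeft, add_zero] at h
    exact h
  rw [← h, isBigO_map]
  rfl

theorem isBigO_inv {f g : ℂ → ℂ} :
    (fun x => f x⁻¹) =O[𝓝[≠] (0 : ℂ)] (fun x => g x⁻¹) ↔ f =O[Bornology.cobounded ℂ] g := by
  have h : Filter.map (fun x => x⁻¹) (𝓝[≠] (0 : ℂ)) = Bornology.cobounded ℂ := inv_nhdsNE_zero
  rw [← h, isBigO_map]
  rfl

theorem HasTrunc.congr_mod {M : ℕ} {f : ℂ → ℂ} {P Q : Polynomial ℂ} (h : HasTrunc M f P)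
    (hPQ : Polynomial.X ^ M ∣ P - Q) : HasTrunc M f Q := by
  have h1 : HasTrunc M (fun x => (P - Q).eval x) 0 :=
    HasTrunc.of_isBigO ((HasTrunc.poly M (P - Q)).isBigO_of_dvd hPQ)
  have h2 := (h.sub (HasTrunc.poly M (P - Q))).add h1
  simpa using h2

/-- The polar part of `ratFn` at its `s`-th pole; the other poles and the polynomial part only
contribute beyond the truncation order. -/
theorem hasTrunc_ratFn {X : Fin n → ℂ} (hX : Function.Injective X) (s : Fin n) :
    HasTrunc (r s) (fun x => x ^ r s * ratFn N r X c b (X s + x)) (polarPoly (r s) (b s)) := by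
  have key : ContinuousAt (fun x => ∑ k ∈ Finset.range N, c k * (X s + x) ^ k
    + ∑ s' ∈ Finset.univ.erase s, ∑ k ∈ Finset.range (r s'),
        b s' k * ((X s + x - X s') ^ (k + 1))⁻¹) 0 := by
    refine ContinuousAt.add (by fun_prop) ?_
    refine tendsto_finsetSum _ fun s' hs' => tendsto_finsetSum _ fun k _ => ?_
    refine ContinuousAt.mul (by fun_prop) (ContinuousAt.inv₀ (by fun_prop) ?_)
    have : X s ≠ X s' := hX.ne (Finset.ne_of_mem_erase hs').symm
    simpa [sub_eq_zero] using this
  have hO := (key.tendsto.isBigO_one ℂ).mono (nhdsWithin_le_nhds (s := {0}ᶜ))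
  refine ((isBigO_refl (fun x : ℂ => x ^ r s) _).mul hO).congr' ?_ (by simp)
  filter_upwards [self_mem_nhdsWithin] with x hx
  have hx : x ≠ 0 := hx
  rw [ratFn, ← Finset.add_sum_erase _ _ (Finset.mem_univ s)]
  simp only [add_sub_cancel_left, polarPoly, Polynomial.eval_finsetSum, Polynomial.eval_mul,
    Polynomial.eval_C, Polynomial.eval_pow, Polynomial.eval_X]
  have : ∑ k ∈ Finset.range (r s), b s k * x ^ (r s - 1 - k) =
      x ^ r s * ∑ k ∈ Finset.range (r s), b s k * (x ^ (k + 1))⁻¹ := by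
    rw [Finset.mul_sum]
    refine Finset.sum_congr rfl fun k hk => ?_
    rw [Finset.mem_range] at hk
    obtain ⟨m, hm⟩ : ∃ m, r s = k + 1 + m := ⟨r s - (k + 1), by omega⟩
    rw [hm, show k + 1 + m - 1 - k = m by omega, pow_add]
    field_simp
  rw [this]; ring

/-- The coefficient of `z⁻¹` of the sum of the polar parts. -/
noncomputable def polarMoment₀ : ℂ := ∑ s, if 0 < r s then b s 0 else 0

/-- The coefficient of `z⁻²` of the sum of the polar parts. -/
noncomputable def polarMoment₁ : ℂ :=
  ∑ s, ((if 1 < r s then b s 1 else 0) + X s * if 0 < r s then b s 0 else 0)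

theorem hasTrunc_inv_sub_pow (a : ℂ) (k : ℕ) :
    HasTrunc 3 (fun x => ((x⁻¹ - a) ^ (k + 1))⁻¹)
      (if k = 0 then Polynomial.X + Polynomial.C a * Polynomial.X ^ 2
        else if k = 1 then Polynomial.X ^ 2 else 0) := by
  have h1 : HasTrunc 2 (fun x => (1 - a * x)⁻¹) (1 + Polynomial.C a * Polynomial.X) := by
    have hc : ContinuousAt (fun x : ℂ => a ^ 2 * (1 - a * x)⁻¹) 0 :=
      ContinuousAt.mul (by fun_prop) (ContinuousAt.inv₀ (by fun_prop) (by simp))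
    have hO := (hc.tendsto.isBigO_one ℂ).mono (nhdsWithin_le_nhds (s := {0}ᶜ))
    have hne : ∀ᶠ x : ℂ in 𝓝[≠] 0, 1 - a * x ≠ 0 := by
      have : ContinuousAt (fun x : ℂ => 1 - a * x) 0 := by fun_prop
      exact (this.eventually_ne (by simp)).filter_mono nhdsWithin_le_nhds
    refine ((isBigO_refl (fun x : ℂ => x ^ 2) _).mul hO).congr' ?_ (by simp)
    filter_upwards [hne] with x hx
    simp only [Polynomial.eval_add, Polynomial.eval_one, Polynomial.eval_mul, Polynomial.eval_C,
      Polynomial.eval_X]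
    linear_combination -(1 + a * x) * mul_inv_cancel₀ hx
  have h2 := h1.pow_mul 1
  have h3 : ∀ m : ℕ, HasTrunc 3 (fun x => (x ^ 1 * (1 - a * x)⁻¹) ^ (m + 1))
      ((Polynomial.X ^ 1 * (1 + Polynomial.C a * Polynomial.X)) ^ (m + 1)) := by
    intro m
    induction m with
    | zero => simpa using h2
    | succ m ih => simp only [pow_succ _ (m + 1)]; exact ih.mul h2
  have h4 := (h3 k).congr_of_ne (g := fun x => ((x⁻¹ - a) ^ (k + 1))⁻¹) (by
    intro x hx
    rw [← inv_pow]
    congr 1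
    rw [pow_one, ← mul_inv_cancel₀ hx]
    rw [show x * x⁻¹ - a * x = x * (x⁻¹ - a) by ring, mul_inv, ← mul_assoc, mul_inv_cancel₀ hx,
      one_mul])
  refine h4.congr_mod ?_
  match k with
  | 0 => simp; ring_nf; simp
  | 1 =>
    simp only [one_ne_zero, if_false, if_true]
    exact ⟨2 * Polynomial.C a + Polynomial.C a ^ 2 * Polynomial.X, by ring⟩
  | k + 2 =>
    simp only [Nat.add_eq_zero_iff, OfNat.ofNat_ne_zero, and_false, if_false, sub_zero,
      show k + 2 ≠ 1 by omega]
    exact ⟨Polynomial.X ^ k * (1 + Polynomial.C a * Polynomial.X) ^ (k + 3), by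
      rw [pow_one, mul_pow]; ring⟩

theorem hasTrunc_polar_inv :
    HasTrunc 3 (fun x => ∑ s, ∑ k ∈ Finset.range (r s), b s k * ((x⁻¹ - X s) ^ (k + 1))⁻¹)
      (Polynomial.C (polarMoment₀ r b) * Polynomial.X
        + Polynomial.C (polarMoment₁ r X b) * Polynomial.X ^ 2) := by
  have h := HasTrunc.sum Finset.univ (N := 3) (fun s _ =>
    HasTrunc.sum (Finset.range (r s)) (fun k _ => (hasTrunc_inv_sub_pow (X s) k).const_mul (b s k)))
  convert h using 1
  simp only [polarMoment₀, polarMoment₁, map_sum, Finset.sum_mul]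
  rw [← Finset.sum_add_distrib]
  refine Finset.sum_congr rfl fun s _ => ?_
  rcases Nat.lt_or_ge 1 (r s) with h | h
  · obtain ⟨m, hm⟩ : ∃ m, r s = m + 2 := ⟨r s - 2, by omega⟩
    rw [hm, Finset.sum_range_succ', Finset.sum_range_succ']
    simp
    ring
  · have : r s = 0 ∨ r s = 1 := by omega
    rcases this with h | h <;> simp [h]
    ring

/-- The expansion of `ratFn` at infinity, up to and including the coefficient of `z⁻²`. -/
theorem hasTrunc_ratFn_inv :
    HasTrunc (N + 3) (fun x => x ^ N * ratFn N r X c b x⁻¹)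
      (∑ k ∈ Finset.range N, Polynomial.C (c k) * Polynomial.X ^ (N - k)
        + Polynomial.X ^ N * (Polynomial.C (polarMoment₀ r b) * Polynomial.X
          + Polynomial.C (polarMoment₁ r X b) * Polynomial.X ^ 2)) := by
  have h1 := HasTrunc.poly (N + 3)
    (∑ k ∈ Finset.range N, Polynomial.C (c k) * Polynomial.X ^ (N - k))
  have h2 := (hasTrunc_polar_inv r X b).pow_mul N
  rw [add_comm 3 N] at h2
  refine (h1.add h2).congr_of_ne fun x hx => ?_
  simp only [ratFn, mul_add, Polynomial.eval_finsetSum, Polynomial.eval_mul, Polynomial.eval_C,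
    Polynomial.eval_pow, Polynomial.eval_X]
  congr 1
  rw [Finset.mul_sum]
  refine Finset.sum_congr rfl fun k hk => ?_
  rw [Finset.mem_range] at hk
  obtain ⟨m, rfl⟩ : ∃ m, N = k + m := ⟨N - k, by omega⟩
  rw [Nat.add_sub_cancel_left, pow_add, inv_pow]
  field_simp

end

section

/-! ### Trace and determinant of the polar parts -/

/-- A gauge transformation taking `L` to `diag D` up to terms that are negligible after scaling by
`φ` determines trace and determinant of the scaled truncation `f` of `L`. -/
theorem trace_det_dvd_of_gauge {R : ℕ} {φ : ℂ → ℂ} {L G K M : ℂ → Matrix (Fin 2) (Fin 2) ℂ}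
    {D : Fin 2 → ℂ → ℂ} {f : Fin 2 → Fin 2 → Polynomial ℂ} {d : Fin 2 → Polynomial ℂ}
    (hgauge : ∀ᶠ x in 𝓝[≠] (0 : ℂ), (G x).det ≠ 0 ∧
      G x * L x * (G x)⁻¹ + K x = Matrix.diagonal (fun a => D a x) + M x)
    (hL : ∀ i j, HasTrunc R (fun x => φ x * L x i j) (f i j))
    (hD : ∀ i, HasTrunc R (fun x => φ x * D i x) (d i))
    (hK : ∀ i j, HasTrunc R (fun x => φ x * K x i j) 0)
    (hM : ∀ i j, HasTrunc R (fun x => φ x * M x i j) 0) :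
    Polynomial.X ^ R ∣ f 0 0 + f 1 1 - (d 0 + d 1) ∧
      Polynomial.X ^ R ∣ f 0 0 * f 1 1 - f 0 1 * f 1 0 - d 0 * d 1 := by
  have hB : ∀ i j, HasTrunc R (fun x => φ x * M x i j - φ x * K x i j) 0 := fun i j => by
    simpa using (hM i j).sub (hK i j)
  have hE : ∀ i, HasTrunc R (fun x => φ x * D i x + (φ x * M x i i - φ x * K x i i)) (d i) :=
    fun i => by simpa using (hD i).add (hB i i)
  have hpt : ∀ᶠ x in 𝓝[≠] (0 : ℂ),
      L x 0 0 + L x 1 1 = (D 0 x + (M x 0 0 - K x 0 0)) + (D 1 x + (M x 1 1 - K x 1 1)) ∧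
      L x 0 0 * L x 1 1 - L x 0 1 * L x 1 0 =
        (D 0 x + (M x 0 0 - K x 0 0)) * (D 1 x + (M x 1 1 - K x 1 1))
          - (M x 0 1 - K x 0 1) * (M x 1 0 - K x 1 0) := by
    filter_upwards [hgauge] with x hx
    obtain ⟨hdet, hx⟩ := hx
    have hu : IsUnit (G x).det := isUnit_iff_ne_zero.2 hdet
    have hx' : G x * L x * (G x)⁻¹ = Matrix.diagonal (fun a => D a x) + M x - K x :=
      eq_sub_of_add_eq hx
    have ht : (G x * L x * (G x)⁻¹).trace = (L x).trace := by
      rw [Matrix.trace_mul_comm, ← mul_assoc, Matrix.nonsing_inv_mul _ hu, one_mul]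
    have hd : (G x * L x * (G x)⁻¹).det = (L x).det := by
      rw [Matrix.det_mul, Matrix.det_mul, mul_right_comm, ← Matrix.det_mul,
        Matrix.mul_nonsing_inv _ hu, Matrix.det_one, one_mul]
    rw [hx'] at ht hd
    rw [Matrix.trace_fin_two, Matrix.trace_fin_two] at ht
    rw [Matrix.det_fin_two, Matrix.det_fin_two] at hd
    simp only [Matrix.sub_apply, Matrix.add_apply, Matrix.diagonal_apply_eq] at ht hd
    rw [Matrix.diagonal_apply_ne _ (by decide), Matrix.diagonal_apply_ne _ (by decide)] at hd
    exact ⟨by rw [← ht]; ring, by rw [← hd]; ring⟩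
  constructor
  · refine ((hL 0 0).add (hL 1 1)).dvd_sub (((hE 0).add (hE 1)).congr' ?_)
    filter_upwards [hpt] with x hx
    rw [← mul_add, hx.1]; ring
  · have h1 := ((hE 0).mul (hE 1)).sub ((hB 0 1).mul (hB 1 0))
    simp only [mul_zero, sub_zero] at h1
    refine (((hL 0 0).mul (hL 1 1)).sub ((hL 0 1).mul (hL 1 0))).dvd_sub (h1.congr' ?_)
    filter_upwards [hpt] with x hx
    linear_combination -(φ x) ^ 2 * hx.2

theorem continuousAt_inv_apply {G : ℂ → Matrix (Fin 2) (Fin 2) ℂ} {x : ℂ}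
    (hG : ∀ i j, ContinuousAt (fun z => G z i j) x) (hdet : (G x).det ≠ 0) (i j : Fin 2) :
    ContinuousAt (fun z => (G z)⁻¹ i j) x := by
  have h1 : ContinuousAt G x := continuousAt_pi.2 fun i => continuousAt_pi.2 fun j => hG i j
  have h2 : ContinuousAt (fun z => (G z).adjugate i j) x := by
    have : Continuous fun A : Matrix (Fin 2) (Fin 2) ℂ => A.adjugate i j :=
      (continuous_id.matrix_adjugate).matrix_elem i j
    exact this.continuousAt.comp h1
  have h3 : ContinuousAt (fun z => (G z).det) x :=
    (continuous_id.matrix_det).continuousAt.comp (f := G) h1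
  simp only [Matrix.inv_def, Ring.inverse_eq_inv', Matrix.smul_apply, smul_eq_mul]
  exact (h3.inv₀ hdet).mul h2

theorem eventually_det_ne_zero {G : ℂ → Matrix (Fin 2) (Fin 2) ℂ} {x : ℂ}
    (hG : ∀ i j, ContinuousAt (fun z => G z i j) x) (hdet : (G x).det ≠ 0) :
    ∀ᶠ z in 𝓝 x, (G z).det ≠ 0 := by
  have h1 : ContinuousAt G x := continuousAt_pi.2 fun i => continuousAt_pi.2 fun j => hG i j
  exact ((continuous_id.matrix_det).continuousAt.comp (f := G) h1).eventually_ne hdet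

theorem hasTrunc_zero_of_continuousAt {h : ℂ → ℂ} (hh : ContinuousAt h 0) (N : ℕ) :
    HasTrunc N (fun x => x ^ N * h x) 0 := by
  refine HasTrunc.of_isBigO ?_
  have h1 := (hh.tendsto.isBigO_one ℂ).mono (nhdsWithin_le_nhds (s := {0}ᶜ))
  simpa using (isBigO_refl (fun x : ℂ => x ^ N) (𝓝[≠] 0)).mul h1

theorem eval_polarPoly_eq (R : ℕ) (β : ℕ → ℂ) {x : ℂ} (hx : x ≠ 0) :
    (polarPoly R β).eval x = x ^ R * ∑ k ∈ Finset.range R, β k * (x ^ (k + 1))⁻¹ := by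
  simp only [polarPoly, Polynomial.eval_finsetSum, Polynomial.eval_mul,
    Polynomial.eval_C, Polynomial.eval_pow, Polynomial.eval_X]
  rw [Finset.mul_sum]
  refine Finset.sum_congr rfl fun k hk => ?_
  rw [Finset.mem_range] at hk
  obtain ⟨m, hm⟩ : ∃ m, R = k + 1 + m := ⟨R - (k + 1), by omega⟩
  rw [hm, show k + 1 + m - 1 - k = m by omega, pow_add]
  field_simp

/-- The polar parts of the trace and of the determinant of `L`, up to the order seen by the times, are
those of the diagonal normal form: the term `ħ (∂G) G⁻¹` of the gauge transformation is holomorphic. -/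
theorem trace_det_dvd_of_hasTimesAt {hbar : ℂ} {L : ℂ → Matrix (Fin 2) (Fin 2) ℂ} {a : ℂ} {R : ℕ}
    {t : Fin 2 → ℕ → ℂ} {f : Fin 2 → Fin 2 → Polynomial ℂ}
    (hL : ∀ i j, HasTrunc R (fun x => x ^ R * L (a + x) i j) (f i j))
    (h : HasTimesAt hbar L a R t) :
    Polynomial.X ^ R ∣ f 0 0 + f 1 1 - (polarPoly R (t 0) + polarPoly R (t 1)) ∧
      Polynomial.X ^ R ∣ f 0 0 * f 1 1 - f 0 1 * f 1 0 - polarPoly R (t 0) * polarPoly R (t 1) := by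
  obtain ⟨G, hG, hdet, hO⟩ := h
  have hc : ContinuousAt (fun x : ℂ => a + x) 0 := by fun_prop
  have hGc : ∀ i j, ContinuousAt (fun z => G z i j) a := fun i j => (hG i j).continuousAt
  refine trace_det_dvd_of_gauge (φ := fun x => x ^ R) (L := fun x => L (a + x))
    (G := fun x => G (a + x))
    (K := fun x => hbar • (Matrix.of fun i j => deriv (fun w => G w i j) (a + x)) * (G (a + x))⁻¹)
    (M := fun x => gaugeTransform hbar G L (a + x) - Matrix.diagonal
        (fun b => ∑ k ∈ Finset.range R, t b k * ((a + x - a) ^ (k + 1))⁻¹))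
    (D := fun b x => ∑ k ∈ Finset.range R, t b k * ((a + x - a) ^ (k + 1))⁻¹)
    (d := fun i => polarPoly R (t i)) ?_ hL ?_ ?_ ?_
  · have := eventually_det_ne_zero hGc hdet
    have h2 : Tendsto (fun x : ℂ => a + x) (𝓝[≠] 0) (𝓝 a) := by
      simpa using hc.tendsto.mono_left nhdsWithin_le_nhds
    filter_upwards [h2.eventually this] with x hx
    refine ⟨hx, ?_⟩
    simp only [gaugeTransform, add_sub_cancel]
  · intro i
    refine (HasTrunc.poly R (polarPoly R (t i))).congr_of_ne fun x hx => ?_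
    rw [eval_polarPoly_eq _ _ hx]; simp
  · intro i j
    refine hasTrunc_zero_of_continuousAt ?_ R
    simp only [Matrix.mul_apply, Matrix.smul_apply, Matrix.of_apply, smul_eq_mul]
    refine tendsto_finsetSum _ fun k _ => ContinuousAt.mul (ContinuousAt.mul continuousAt_const ?_) ?_
    · exact ContinuousAt.comp (g := deriv (fun w => G w i k)) (f := fun x => a + x)
        (by simpa using (hG i k).deriv.continuousAt) hc
    · exact ContinuousAt.comp (g := fun z => (G z)⁻¹ k j) (f := fun x => a + x)
        (by simpa using continuousAt_inv_apply hGc hdet k j) hc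
  · intro i j
    refine HasTrunc.of_isBigO ?_
    have h1 := (isBigO_shift (f := fun z => (gaugeTransform hbar G L z - Matrix.diagonal
        (fun b => ∑ k ∈ Finset.range R, t b k * ((z - a) ^ (k + 1))⁻¹)) i j)
        (g := fun _ => 1)).2 (hO i j)
    simpa using (isBigO_refl (fun x : ℂ => x ^ R) (𝓝[≠] 0)).mul h1

/-- The analogue of `trace_det_dvd_of_hasTimesAt` at infinity, in the coordinate `x = 1 / z`.  The weight
is `x ^ (R - 1) * x⁻¹` rather than `x ^ (R - 2)`, to include the case `R = 1`. -/
theorem trace_det_dvd_of_hasTimesAtInfinity {hbar : ℂ} {L : ℂ → Matrix (Fin 2) (Fin 2) ℂ} {R : ℕ}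
    (hR : 1 ≤ R) {t : Fin 2 → ℕ → ℂ} {f : Fin 2 → Fin 2 → Polynomial ℂ}
    (hL : ∀ i j, HasTrunc R (fun x => x ^ (R - 1) * x⁻¹ * L x⁻¹ i j) (f i j))
    (h : HasTimesAtInfinity hbar L R t) :
    Polynomial.X ^ R ∣ f 0 0 + f 1 1 - (-polarPoly R (t 0) + -polarPoly R (t 1)) ∧
      Polynomial.X ^ R ∣ f 0 0 * f 1 1 - f 0 1 * f 1 0 -
        (-polarPoly R (t 0)) * (-polarPoly R (t 1)) := by
  obtain ⟨G, hG, hdet, hO⟩ := h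
  have hGc : ∀ i j, ContinuousAt (fun z => G z i j) 0 := fun i j => (hG i j).continuousAt
  have hpow : ∀ x : ℂ, x ≠ 0 → x ^ (R - 1) * x⁻¹ * x ^ 2 = x ^ R := by
    intro x hx
    obtain ⟨m, rfl⟩ : ∃ m, R = m + 1 := ⟨R - 1, by omega⟩
    rw [Nat.add_sub_cancel, pow_succ x m]; field_simp
  refine trace_det_dvd_of_gauge (φ := fun x => x ^ (R - 1) * x⁻¹) (L := fun x => L x⁻¹)
    (G := fun x => G x)
    (K := fun x => hbar • (Matrix.of fun i j => deriv (fun w => G w⁻¹ i j) x⁻¹) * (G x)⁻¹)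
    (M := fun x => gaugeTransform hbar (fun u => G u⁻¹) L x⁻¹ - Matrix.diagonal
        (fun b => -∑ k ∈ Finset.range R, t b k * x⁻¹ ^ ((k : ℤ) - 1)))
    (D := fun b x => -∑ k ∈ Finset.range R, t b k * x⁻¹ ^ ((k : ℤ) - 1))
    (d := fun i => -polarPoly R (t i)) ?_ hL ?_ ?_ ?_
  · filter_upwards [(eventually_det_ne_zero hGc hdet).filter_mono nhdsWithin_le_nhds] with x hx
    refine ⟨hx, ?_⟩
    simp only [gaugeTransform, inv_inv, add_sub_cancel]
  · intro i
    refine (HasTrunc.poly R (polarPoly R (t i))).neg.congr_of_ne fun x hx => ?_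
    rw [eval_polarPoly_eq _ _ hx, mul_neg, Finset.mul_sum, Finset.mul_sum]
    congr 1
    refine Finset.sum_congr rfl fun k _ => ?_
    rw [inv_zpow', neg_sub, zpow_sub₀ hx, zpow_natCast, zpow_one, ← hpow x hx]
    field_simp
    ring
  · intro i j
    have h1 : ContinuousAt (fun x => hbar * ∑ k, -(deriv (fun w => G w i k) x * (G x)⁻¹ k j)) 0 := by
      refine ContinuousAt.mul continuousAt_const (tendsto_finsetSum _ fun k _ => ?_)
      exact ((hG i k).deriv.continuousAt.mul (continuousAt_inv_apply hGc hdet k j)).neg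
    refine (hasTrunc_zero_of_continuousAt h1 R).congr' ?_
    have han : ∀ᶠ x in 𝓝 (0 : ℂ), ∀ i j, AnalyticAt ℂ (fun z => G z i j) x :=
      eventually_all.2 fun i => eventually_all.2 fun j => (hG i j).eventually_analyticAt
    filter_upwards [self_mem_nhdsWithin, han.filter_mono nhdsWithin_le_nhds] with x hx hGx
    have hx : x ≠ 0 := hx
    have hder : ∀ k, deriv (fun w => G w⁻¹ i k) x⁻¹ = -(x ^ 2 * deriv (fun w => G w i k) x) := by
      intro k
      have e1 : HasDerivAt (fun w => G w i k) (deriv (fun w => G w i k) x) (x⁻¹)⁻¹ := by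
        rw [inv_inv]; exact (hGx i k).differentiableAt.hasDerivAt
      have e2 := e1.comp x⁻¹ (hasDerivAt_inv (inv_ne_zero hx))
      have := e2.deriv
      simp only [Function.comp_def] at this
      rw [this]
      field_simp
    simp only [Matrix.mul_apply, Matrix.smul_apply, Matrix.of_apply, smul_eq_mul, hder]
    rw [← hpow x hx, Finset.mul_sum, Finset.mul_sum, Finset.mul_sum]
    refine Finset.sum_congr rfl fun k _ => ?_
    ring
  · intro i j
    refine HasTrunc.of_isBigO ?_
    have h1 := (isBigO_inv (f := fun z => (gaugeTransform hbar (fun u => G u⁻¹) L z -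
        Matrix.diagonal (fun b => -∑ k ∈ Finset.range R, t b k * z ^ ((k : ℤ) - 1))) i j)
        (g := fun z => z ^ (-2 : ℤ))).2 (hO i j)
    refine ((isBigO_refl (fun x : ℂ => x ^ (R - 1) * x⁻¹) (𝓝[≠] 0)).mul h1).congr' EventuallyEq.rfl ?_
    filter_upwards [self_mem_nhdsWithin] with x hx
    rw [← hpow x hx, inv_zpow', neg_neg]
    rfl

end

open Polynomial

section

/-! ### Local structure of a Lax pair at a pole -/

/-- The Euler derivation `x d/dx`. -/
noncomputable def euler (p : ℂ[X]) : ℂ[X] := X * derivative p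

theorem euler_add (p q : ℂ[X]) : euler (p + q) = euler p + euler q := by
  simp [euler, mul_add]

theorem euler_mul (p q : ℂ[X]) : euler (p * q) = euler p * q + p * euler q := by
  simp only [euler, derivative_mul]; ring

theorem coeff_euler (p : ℂ[X]) (m : ℕ) : (euler p).coeff m = m * p.coeff m := by
  cases m with
  | zero => simp [euler]
  | succ m => simp only [euler, coeff_X_mul, coeff_derivative]; push_cast; ring

theorem X_pow_dvd_euler {p : ℂ[X]} {r : ℕ} (h : X ^ r ∣ p) : X ^ r ∣ euler p := by
  rw [X_pow_dvd_iff] at h ⊢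
  intro d hd
  rw [coeff_euler, h d hd, mul_zero]

/-- The quotient map `ℂ[x] → ℂ[x] / (x^r)`. -/
noncomputable abbrev modX (r : ℕ) : ℂ[X] →+* ℂ[X] ⧸ Ideal.span {(X : ℂ[X]) ^ r} :=
  Ideal.Quotient.mk _

theorem modX_eq_iff {r : ℕ} {p q : ℂ[X]} : modX r p = modX r q ↔ X ^ r ∣ p - q := by
  rw [modX, Ideal.Quotient.mk_eq_mk_iff_sub_mem, Ideal.mem_span_singleton]

theorem modX_euler {r : ℕ} {p q : ℂ[X]} (h : modX r p = modX r q) :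
    modX r (euler p) = modX r (euler q) := by
  rw [modX_eq_iff] at h ⊢
  have := X_pow_dvd_euler h
  rwa [sub_eq_add_neg, euler_add, show euler (-q) = -euler q by simp [euler], ← sub_eq_add_neg]
    at this

theorem isCoprime_X_pow {p : ℂ[X]} (r : ℕ) (h : p.coeff 0 ≠ 0) : IsCoprime (X ^ r) p :=
  ((irreducible_X.coprime_iff_not_dvd).2 (by rwa [X_dvd_iff])).pow_left

theorem exists_modX_mul_eq {p : ℂ[X]} (r : ℕ) (h : p.coeff 0 ≠ 0) (a : ℂ[X]) :
    ∃ v, modX r a = modX r (v * p) := by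
  obtain ⟨s, q, hsq⟩ := isCoprime_X_pow r h
  refine ⟨a * q, modX_eq_iff.2 ⟨a * s, ?_⟩⟩
  linear_combination -a * hsq

theorem modX_cancel {p a b : ℂ[X]} {r : ℕ} (h : p.coeff 0 ≠ 0)
    (hab : modX r (p * a) = modX r (p * b)) : modX r a = modX r b := by
  rw [modX_eq_iff, ← mul_sub] at hab
  rw [modX_eq_iff]
  exact (isCoprime_X_pow r h).dvd_of_dvd_mul_left hab

/-- If `a ≡ u + v l` modulo `x^r` and `tr l`, `det l` are those of `diag d`, then the trace
identities `hE`, `hF` for the variation `δl` of `l` become equations for the eigenvalues `u + v d i`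
of `a`.  The factors `ξ` and `ρ` account for the scaling of `δl` and `a` by powers of `x`. -/
theorem eigenvalue_equation {r : ℕ} {l a δl : Fin 2 → Fin 2 → ℂ[X]} {d δd : Fin 2 → ℂ[X]}
    {u v ξ ρ : ℂ[X]}
    (hT : modX r (l 0 0 + l 1 1) = modX r (d 0 + d 1))
    (hΔ : modX r (l 0 0 * l 1 1 - l 0 1 * l 1 0) = modX r (d 0 * d 1))
    (hδT : modX r (δl 0 0 + δl 1 1) = modX r (δd 0 + δd 1))
    (hδΔ : modX r (l 1 1 * δl 0 0 + l 0 0 * δl 1 1 - l 0 1 * δl 1 0 - l 1 0 * δl 0 1) =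
      modX r (δd 0 * d 1 + d 0 * δd 1))
    (h00 : modX r (a 0 0) = modX r (u + v * l 0 0))
    (h01 : modX r (a 0 1) = modX r (v * l 0 1))
    (h10 : modX r (a 1 0) = modX r (v * l 1 0))
    (h11 : modX r (a 1 1) = modX r (u + v * l 1 1))
    (hE : modX r (∑ i, (ξ * δl i i + ρ * a i i - euler (a i i))) = 0)
    (hF : modX r (l 1 1 * (ξ * δl 0 0 + ρ * a 0 0 - euler (a 0 0))
      + l 0 0 * (ξ * δl 1 1 + ρ * a 1 1 - euler (a 1 1))
      - l 0 1 * (ξ * δl 1 0 + ρ * a 1 0 - euler (a 1 0))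
      - l 1 0 * (ξ * δl 0 1 + ρ * a 0 1 - euler (a 0 1))) = 0)
    (hd : (d 0 - d 1).coeff 0 ≠ 0) (i : Fin 2) :
    modX r (ξ * δd i + ρ * (u + v * d i) - euler (u + v * d i)) = 0 := by
  have e00 := modX_euler h00
  have e01 := modX_euler h01
  have e10 := modX_euler h10
  have e11 := modX_euler h11
  have eT := modX_euler hT
  have eΔ := modX_euler hΔ
  have hsub : ∀ p q : ℂ[X], euler (p - q) = euler p - euler q := fun p q => by
    simp [euler, mul_sub]
  simp only [Fin.sum_univ_two, map_add, map_mul, map_sub, euler_add, euler_mul, hsub] at *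
  set F : Fin 2 → ℂ[X] ⧸ Ideal.span {(X : ℂ[X]) ^ r} := fun i =>
    modX r ξ * modX r (δd i) + modX r ρ * (modX r u + modX r v * modX r (d i)) -
    (modX r (euler u) + (modX r (euler v) * modX r (d i) + modX r v * modX r (euler (d i)))) with hFi
  have s1 : F 0 + F 1 = 0 := by
    simp only [hFi]
    rw [h00, h11, e00, e11] at hE
    linear_combination hE - modX r ξ * hδT + (modX r (euler v) - modX r ρ * modX r v) * hT
      + modX r v * eT
  have s2 : F 0 * modX r (d 1) + F 1 * modX r (d 0) = 0 := by
    simp only [hFi]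
    rw [h00, h11, h10, h01, e00, e11, e10, e01] at hF
    linear_combination hF - modX r ξ * hδΔ
      - (modX r ρ * modX r u - modX r (euler u)) * hT
      - 2 * (modX r ρ * modX r v - modX r (euler v)) * hΔ + modX r v * eΔ
  have s3 : F 0 = 0 := by
    have : modX r ((d 0 - d 1) * (ξ * δd 0 + ρ * (u + v * d 0) - euler (u + v * d 0))) =
        modX r ((d 0 - d 1) * 0) := by
      simp only [euler_add, euler_mul, map_mul, map_sub, map_add, mul_zero, map_zero]
      simp only [hFi] at s1 s2
      linear_combination modX r (d 0) * s1 - s2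
    have := modX_cancel hd this
    simpa only [euler_add, euler_mul, map_mul, map_sub, map_add, map_zero] using this
  fin_cases i
  · exact s3
  · have : F 1 = 0 := by linear_combination s1 - s3
    exact this

theorem X_pow_dvd_of_mul {p q : ℂ[X]} {r : ℕ} (hp : p.coeff 0 ≠ 0) (h : X ^ r ∣ p * q) : X ^ r ∣ q :=
  (isCoprime_X_pow r hp).dvd_of_dvd_mul_left h

/-- At a finite pole a Lax matrix is, up to holomorphic terms, a combination of the identity and of
the connection matrix.  For a simple pole this is where the absence of resonance enters. -/
theorem exists_scalar_combination_finite {r : ℕ} (hr : 1 ≤ r) {hbar : ℂ} (hh : hbar ≠ 0)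
    {l a : Fin 2 → Fin 2 → ℂ[X]} {d : Fin 2 → ℂ[X]}
    (hT : modX r (l 0 0 + l 1 1) = modX r (d 0 + d 1))
    (hΔ : modX r (l 0 0 * l 1 1 - l 0 1 * l 1 0) = modX r (d 0 * d 1))
    (hd : (d 0 - d 1).coeff 0 ≠ 0) (hl : (l 0 1).coeff 0 ≠ 0)
    (hres : r = 1 → (d 0 - d 1).coeff 0 ≠ hbar ∧ (d 0 - d 1).coeff 0 ≠ -hbar)
    (hcomm : ∀ i j, X ^ r ∣ ∑ k, (a i k * l k j - l i k * a k j)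
      - X ^ (r - 1) * (C (hbar * r) * a i j)) :
    ∃ u v, modX r (a 0 0) = modX r (u + v * l 0 0) ∧ modX r (a 0 1) = modX r (v * l 0 1) ∧
      modX r (a 1 0) = modX r (v * l 1 0) ∧ modX r (a 1 1) = modX r (u + v * l 1 1) := by
  obtain ⟨v, hv⟩ := exists_modX_mul_eq r hl (a 0 1)
  have hv' := modX_eq_iff.1 hv
  obtain ⟨u, hu⟩ : ∃ u, u = a 0 0 - v * l 0 0 := ⟨_, rfl⟩
  have hm : X ^ (r - 1) ∣ a 0 1 - v * l 0 1 := (pow_dvd_pow _ (by omega)).trans hv'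
  have hcomm' : ∀ i j, X ^ (r - 1) ∣ ∑ k, (a i k * l k j - l i k * a k j) := by
    intro i j
    have h1 := (pow_dvd_pow X (by omega : r - 1 ≤ r)).trans (hcomm i j)
    exact (dvd_sub_left (Dvd.intro _ rfl)).1 h1
  simp only [Fin.sum_univ_two] at hcomm hcomm'
  -- lower row of the remainder `a - u - v l`
  obtain ⟨k0, hk0⟩ : X ^ (r - 1) ∣ a 1 0 - v * l 1 0 := by
    refine X_pow_dvd_of_mul hl ?_
    have := (hm.mul_left (l 1 0)).sub (hcomm' 0 0)
    convert this using 1; ring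
  obtain ⟨k1, hk1⟩ : X ^ (r - 1) ∣ a 1 1 - u - v * l 1 1 := by
    refine X_pow_dvd_of_mul hl ?_
    have := (hm.mul_left (l 1 1 - l 0 0)).sub (hcomm' 0 1)
    convert this using 1
    rw [hu]; ring
  obtain ⟨m, hm⟩ := hv'
  have hXr : (X : ℂ[X]) ^ r = X ^ (r - 1) * X := by rw [← pow_succ, Nat.sub_add_cancel hr]
  -- leading order of the zero-curvature equation
  have key : ∀ {p : ℂ[X]}, X ^ r ∣ X ^ (r - 1) * p → p.coeff 0 = 0 := by
    intro p hp
    rw [hXr] at hp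
    exact X_dvd_iff.1 ((mul_dvd_mul_iff_left (pow_ne_zero _ X_ne_zero)).1 hp)
  have c00 := key (p := -(l 0 1 * k0) - C (hbar * r) * a 0 0) (by
    have := (hcomm 0 0).sub (Dvd.intro (m * l 1 0) rfl)
    convert this using 1
    linear_combination l 0 1 * hk0 - l 1 0 * hm)
  have c01 := key (p := -(l 0 1 * k1) - C (hbar * r) * a 0 1) (by
    have := (hcomm 0 1).sub (Dvd.intro (m * (l 1 1 - l 0 0)) rfl)
    convert this using 1
    rw [hu] at hk1
    linear_combination l 0 1 * hk1 - (l 1 1 - l 0 0) * hm)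
  have c10 := key (p := k0 * (l 0 0 - l 1 1) + l 1 0 * k1 - C (hbar * r) * a 1 0) (by
    convert hcomm 1 0 using 1
    rw [hu] at hk1
    linear_combination -(l 0 0 - l 1 1) * hk0 - l 1 0 * hk1)
  have c11 := key (p := k0 * l 0 1 - C (hbar * r) * a 1 1) (by
    have := (hcomm 1 1).add (Dvd.intro (m * l 1 0) rfl)
    convert this using 1
    linear_combination l 1 0 * hm - l 0 1 * hk0)
  have z01 : (a 0 1).coeff 0 = v.coeff 0 * (l 0 1).coeff 0 := by
    have := congrArg (fun p => p.coeff 0) hm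
    rw [hXr] at this
    simp only [coeff_sub, mul_coeff_zero, coeff_X_zero, mul_zero, zero_mul] at this
    linear_combination this
  have z10 := congrArg (fun p => p.coeff 0) hk0
  have z11 := congrArg (fun p => p.coeff 0) hk1
  have z00 := congrArg (fun p => p.coeff 0) hu
  have zT : (l 0 0).coeff 0 + (l 1 1).coeff 0 = (d 0).coeff 0 + (d 1).coeff 0 := by
    have := X_pow_dvd_iff.1 (modX_eq_iff.1 hT) 0 (by omega)
    simp only [coeff_sub, coeff_add] at this
    linear_combination this
  have zΔ : (l 0 0).coeff 0 * (l 1 1).coeff 0 - (l 0 1).coeff 0 * (l 1 0).coeff 0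
      = (d 0).coeff 0 * (d 1).coeff 0 := by
    have := X_pow_dvd_iff.1 (modX_eq_iff.1 hΔ) 0 (by omega)
    simp only [coeff_sub, mul_coeff_zero] at this
    linear_combination this
  simp only [coeff_sub, coeff_add, coeff_neg, mul_coeff_zero, coeff_C_zero] at *
  generalize (l 0 0).coeff 0 = m00 at *
  generalize (l 0 1).coeff 0 = m01 at *
  generalize (l 1 0).coeff 0 = m10 at *
  generalize (l 1 1).coeff 0 = m11 at *
  generalize (d 0).coeff 0 = d0 at *
  generalize (d 1).coeff 0 = d1 at *
  have hr0 : (r : ℂ) ≠ 0 := by exact_mod_cast (by omega : r ≠ 0)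
  have hk : k0.coeff 0 = 0 ∧ k1.coeff 0 = 0 := by
    generalize k0.coeff 0 = κ0 at *
    generalize k1.coeff 0 = κ1 at *
    generalize (a 0 0).coeff 0 = α00 at *
    generalize (a 0 1).coeff 0 = α01 at *
    generalize (a 1 0).coeff 0 = α10 at *
    generalize (a 1 1).coeff 0 = α11 at *
    generalize u.coeff 0 = u0 at *
    generalize v.coeff 0 = v0 at *
    have hκ1 : κ1 = -(hbar * r) * v0 := by
      apply mul_left_cancel₀ hl
      linear_combination -c01 - hbar * r * z01
    have htr : α00 + α11 = 0 := by
      apply mul_left_cancel₀ (mul_ne_zero hh hr0)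
      linear_combination -c00 - c11
    have hκ0 : m01 * κ0 = -(hbar * r) * (u0 + v0 * m00) := by
      linear_combination -c00 + hbar * r * z00
    rcases Nat.lt_or_ge 1 r with h1 | h1
    · have hp : ((X : ℂ[X]) ^ (r - 1)).coeff 0 = 0 := by
        rw [coeff_X_pow, if_neg (by omega)]
      rw [hp, zero_mul] at z10 z11
      have hv0 : v0 = 0 := by
        have : hbar * r * (v0 * (d0 - d1) ^ 2) = 0 := by
          have e1 : u0 + v0 * m00 = v0 * (m00 - m11) / 2 := by
            linear_combination (1 / 2) * htr + (1 / 2) * z00 - (1 / 2) * z11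
          have e2 : m01 * κ0 * (m00 - m11) + m01 * m10 * κ1 = hbar * r * (v0 * m10) * m01 := by
            linear_combination m01 * c10 + m01 * (hbar * r) * z10
          rw [hκ0, e1, hκ1] at e2
          linear_combination -2 * e2 + 4 * hbar * r * v0 * zΔ
            - hbar * r * v0 * (m00 + m11 + d0 + d1) * zT
        simpa [hh, hr0, sub_ne_zero.1 hd, sub_eq_zero] using this
      have hu0 : u0 = 0 := by
        rw [hv0] at z00 z11
        linear_combination (1 / 2) * htr - (1 / 2) * (z11 - z00)
      refine ⟨?_, by rw [hκ1, hv0, mul_zero]⟩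
      apply mul_left_cancel₀ hl
      rw [hκ0, hv0, hu0]; ring
    · obtain rfl : r = 1 := by omega
      obtain ⟨hr1, hr2⟩ := hres rfl
      simp only [Nat.sub_self, pow_zero, coeff_one_zero, one_mul, Nat.cast_one, mul_one] at *
      have hv0 : v0 = 0 := by
        have e1 : 2 * (u0 + v0 * m00) = v0 * (hbar + m00 - m11) := by
          linear_combination htr + z00 - z11 - hκ1
        have e2 : m01 * κ0 * (m00 - m11 - hbar) = 2 * hbar * v0 * m10 * m01 := by
          linear_combination m01 * c10 + m01 * hbar * z10 - m01 * m10 * hκ1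
        rw [hκ0] at e2
        have : hbar * (v0 * ((d0 - d1 - hbar) * (d0 - d1 + hbar))) = 0 := by
          linear_combination -2 * e2 - hbar * (m00 - m11 - hbar) * e1 + 4 * hbar * v0 * zΔ
            - hbar * v0 * (m00 + m11 + d0 + d1) * zT
        have h1 : d0 - d1 - hbar ≠ 0 := sub_ne_zero.2 hr1
        have h2 : d0 - d1 + hbar ≠ 0 := by rwa [← sub_neg_eq_add, sub_ne_zero]
        simpa [hh, h1, h2] using this
      rw [hv0, mul_zero] at hκ1
      refine ⟨?_, hκ1⟩
      have hu0 : u0 = 0 := by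
        rw [hv0] at z00 z11
        linear_combination (1 / 2) * htr - (1 / 2) * (z11 - z00) - (1 / 2) * hκ1
      apply mul_left_cancel₀ hl
      rw [hκ0, hv0, hu0]; ring
  obtain ⟨w0, hw0⟩ := X_dvd_iff.2 hk.1
  obtain ⟨w1, hw1⟩ := X_dvd_iff.2 hk.2
  refine ⟨u, v, by rw [hu, sub_add_cancel], hv, modX_eq_iff.2 ⟨w0, ?_⟩, modX_eq_iff.2 ⟨w1, ?_⟩⟩
  · rw [hk0, hw0, hXr]; ring
  · rw [← sub_sub, hk1, hw1, hXr]; ring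

/-- At infinity, where the leading coefficient of the connection is diagonal, a Lax matrix is a
combination of the identity and of the connection matrix up to order `x^r`. -/
theorem exists_scalar_combination_infinity {r : ℕ} (hr : 1 ≤ r) {hbar : ℂ}
    {l a δl : Fin 2 → Fin 2 → ℂ[X]}
    (h01 : (l 0 1).coeff 0 = 0) (h10 : (l 1 0).coeff 0 = 0)
    (hd : (l 0 0 - l 1 1).coeff 0 ≠ 0)
    (hδ01 : (δl 0 1).coeff 0 = 0) (hδ10 : (δl 1 0).coeff 0 = 0)
    (hcomm : ∀ i j, X ^ r ∣ ∑ k, (a i k * l k j - l i k * a k j)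
      - X ^ (r - 1) * (C hbar * (δl i j + euler (a i j) - C (((r - 1 : ℕ) : ℂ)) * a i j))) :
    ∃ u v, modX r (a 0 0) = modX r (u + v * l 0 0) ∧ modX r (a 0 1) = modX r (v * l 0 1) ∧
      modX r (a 1 0) = modX r (v * l 1 0) ∧ modX r (a 1 1) = modX r (u + v * l 1 1) := by
  obtain ⟨v, hv⟩ := exists_modX_mul_eq r hd (a 0 0 - a 1 1)
  obtain ⟨u, hu⟩ : ∃ u, u = a 0 0 - v * l 0 0 := ⟨_, rfl⟩
  have hv' := modX_eq_iff.1 hv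
  have hm : X ^ (r - 1) ∣ a 0 0 - a 1 1 - v * (l 0 0 - l 1 1) :=
    (pow_dvd_pow _ (by omega)).trans hv'
  have hcomm' : ∀ i j, X ^ (r - 1) ∣ ∑ k, (a i k * l k j - l i k * a k j) := by
    intro i j
    have h1 := (pow_dvd_pow X (by omega : r - 1 ≤ r)).trans (hcomm i j)
    exact (dvd_sub_left (Dvd.intro _ rfl)).1 h1
  simp only [Fin.sum_univ_two] at hcomm hcomm'
  have n01 : X ^ (r - 1) ∣ a 0 1 - v * l 0 1 := by
    refine X_pow_dvd_of_mul hd ?_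
    have := (hm.mul_left (l 0 1)).sub (hcomm' 0 1)
    convert this using 1; ring
  have n10 : X ^ (r - 1) ∣ a 1 0 - v * l 1 0 := by
    refine X_pow_dvd_of_mul hd ?_
    have := (hm.mul_left (l 1 0)).add (hcomm' 1 0)
    convert this using 1; ring
  -- the off-diagonal part of the right-hand side vanishes at leading order
  have z : ∀ i j : Fin 2, (δl i j).coeff 0 = 0 → (l i j).coeff 0 = 0 →
      X ^ (r - 1) ∣ a i j - v * l i j → X ^ r ∣ X ^ (r - 1) * (C hbar *
        (δl i j + euler (a i j) - C (((r - 1 : ℕ) : ℂ)) * a i j)) := by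
    intro i j h1 h2 h3
    have hXr : (X : ℂ[X]) ^ r = X ^ (r - 1) * X := by rw [← pow_succ, Nat.sub_add_cancel hr]
    rw [hXr]
    refine mul_dvd_mul_left _ (X_dvd_iff.2 ?_)
    have h4 : ((r - 1 : ℕ) : ℂ) * (a i j).coeff 0 = 0 := by
      rcases Nat.eq_zero_or_pos (r - 1) with h | h
      · rw [h]; simp
      · have := X_pow_dvd_iff.1 h3 0 h
        rw [coeff_sub, mul_coeff_zero, h2, mul_zero, sub_zero] at this
        rw [this, mul_zero]
    rw [mul_coeff_zero, coeff_sub, coeff_add, h1, coeff_euler, coeff_C_mul, h4]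
    simp
  have n01' : X ^ r ∣ a 0 1 - v * l 0 1 := by
    refine X_pow_dvd_of_mul hd ?_
    have := ((hv'.mul_left (l 0 1)).sub (hcomm 0 1)).sub (z 0 1 hδ01 h01 n01)
    convert this using 1; ring
  have n10' : X ^ r ∣ a 1 0 - v * l 1 0 := by
    refine X_pow_dvd_of_mul hd ?_
    have := ((hv'.mul_left (l 1 0)).add (hcomm 1 0)).add (z 1 0 hδ10 h10 n10)
    convert this using 1; ring
  refine ⟨u, v, by rw [hu, sub_add_cancel], modX_eq_iff.2 n01', modX_eq_iff.2 n10',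
    modX_eq_iff.2 ?_⟩
  rw [← dvd_neg]
  convert hv' using 1
  rw [hu]; ring

end

section

/-! ### The Toeplitz systems -/

theorem det_toeplitzM_ne_zero {R : ℕ} {t : Fin 2 → ℕ → ℂ} (h : DistinctLeading R t) :
    (toeplitzM R t).det ≠ 0 := by
  rw [Matrix.det_of_isLowerTriangular]
  · simp only [toeplitzM, Matrix.of_apply, le_refl, if_true, Nat.sub_self, Nat.sub_zero]
    rw [Finset.prod_const]
    exact pow_ne_zero _ (sub_ne_zero.2 h)
  · intro i j hij
    have hij : i < j := hij
    simp only [toeplitzM, Matrix.of_apply]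
    rw [if_neg (by simpa using hij)]

/-- A solution of the Toeplitz system, written out as sums over lower indices, is the one given by the
inverse matrix. -/
theorem inv_toeplitzM_mulVec {R : ℕ} {t : Fin 2 → ℕ → ℂ} (h : DistinctLeading R t)
    {b : Fin (R - 1) → ℂ} {w : ℕ → ℂ}
    (hw : ∀ i : Fin (R - 1), ∑ j ∈ Finset.range ((i : ℕ) + 1),
      (t 0 (R - 1 - ((i : ℕ) - j)) - t 1 (R - 1 - ((i : ℕ) - j))) * w j = b i) :
    ((toeplitzM R t)⁻¹).mulVec b = fun i : Fin (R - 1) => w (i : ℕ) := by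
  have hM : (toeplitzM R t).mulVec (fun i : Fin (R - 1) => w (i : ℕ)) = b := by
    ext i
    rw [← hw i, Matrix.mulVec, dotProduct]
    simp only [toeplitzM, Matrix.of_apply, ite_mul, zero_mul]
    rw [Fin.sum_univ_eq_sum_range (fun j => if j ≤ (i : ℕ) then
      (t 0 (R - 1 - ((i : ℕ) - j)) - t 1 (R - 1 - ((i : ℕ) - j))) * w j else 0) (R - 1),
      ← Finset.sum_filter]
    refine Finset.sum_congr ?_ fun _ _ => rfl
    ext j
    simp only [Finset.mem_filter, Finset.mem_range]
    omega
  rw [← hM, Matrix.mulVec_mulVec,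
    Matrix.nonsing_inv_mul _ (isUnit_iff_ne_zero.2 (det_toeplitzM_ne_zero h)), Matrix.one_mulVec]

/-- If the eigenvalues `U + V d i` of a Lax matrix have the polar parts prescribed by the deformation
vector `a`, then `U` and `V` are given by the solutions of the two Toeplitz systems. -/
theorem toeplitz_of_eigenvalues {R : ℕ} (hR : 1 ≤ R) {t a : Fin 2 → ℕ → ℂ}
    (h : DistinctLeading R t) {U V : ℂ[X]}
    (h0 : ∀ i, (U + V * polarPoly R (t i)).coeff 0 = 0)
    (hF : ∀ i m, 1 ≤ m → m < R →
      (U + V * polarPoly R (t i)).coeff m = -a i (R - m) / ((R - m : ℕ) : ℂ)) :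
    V.coeff 0 = 0 ∧ U.coeff 0 = 0 ∧
      (∀ j : Fin (R - 1), nuVec R t a j = -V.coeff (j + 1)) ∧
      ∀ j : Fin (R - 1), cVec R t a j = U.coeff (j + 1) := by
  set d : Fin 2 → ℂ[X] := fun i => polarPoly R (t i) with hdef
  have hdc : ∀ i m, m < R → (d i).coeff m = t i (R - 1 - m) := fun i m hm => by
    rw [hdef]; simp only [coeff_polarPoly, if_pos hm]
  have hV0 : V.coeff 0 = 0 := by
    have h1 := h0 0
    have h2 := h0 1
    rw [coeff_add, mul_coeff_zero, coeff_polarPoly, if_pos (by omega)] at h1 h2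
    have : V.coeff 0 * (t 0 (R - 1) - t 1 (R - 1)) = 0 := by
      simp only [Nat.sub_zero] at h1 h2
      linear_combination h1 - h2
    exact (mul_eq_zero.1 this).resolve_right (sub_ne_zero.2 h)
  have hU0 : U.coeff 0 = 0 := by
    have h1 := h0 0
    rwa [coeff_add, mul_coeff_zero, hV0, zero_mul, add_zero] at h1
  -- the coefficient of index `i + 1` of `W (d 0 - d 1)` when `W` has no constant term
  have hconv : ∀ (W : ℂ[X]), W.coeff 0 = 0 → ∀ i < R - 1, (W * (d 0 - d 1)).coeff (i + 1) =
      ∑ j ∈ Finset.range (i + 1), (t 0 (R - 1 - (i - j)) - t 1 (R - 1 - (i - j))) *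
        W.coeff (j + 1) := by
    intro W hW i hi
    rw [coeff_mul, Finset.Nat.sum_antidiagonal_eq_sum_range_succ
      (fun x y => W.coeff x * (d 0 - d 1).coeff y), Finset.sum_range_succ', hW, zero_mul, add_zero]
    refine Finset.sum_congr rfl fun j hj => ?_
    rw [Finset.mem_range] at hj
    rw [coeff_sub, hdc _ _ (by omega), hdc _ _ (by omega), show i + 1 - (j + 1) = i - j by omega]
    ring
  refine ⟨hV0, hU0, fun j => ?_, fun j => ?_⟩
  · have := inv_toeplitzM_mulVec h (b := fun i => (a 0 (R - 1 - (i : ℕ)) - a 1 (R - 1 - (i : ℕ))) /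
      ((R - 1 - (i : ℕ) : ℕ) : ℂ)) (w := fun j => (-V).coeff (j + 1)) (fun i => by
        rw [← hconv (-V) (by simp [hV0]) i i.2]
        have e : -V * (d 0 - d 1) = (U + V * d 1) - (U + V * d 0) := by ring
        rw [e, coeff_sub, hF 1 (i + 1) (by omega) (by omega), hF 0 (i + 1) (by omega) (by omega),
          show R - ((i : ℕ) + 1) = R - 1 - i by omega]
        ring)
    rw [nuVec, this]
    exact coeff_neg _ _
  · have := inv_toeplitzM_mulVec h (b := fun i => ∑ k ∈ Finset.Icc (R - 1 - (i : ℕ)) (R - 1),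
      (t 1 (2 * R - 2 - (i : ℕ) - k) * a 0 k - t 0 (2 * R - 2 - (i : ℕ) - k) * a 1 k) / (k : ℂ))
      (w := fun j => U.coeff (j + 1)) (fun i => by
        rw [← hconv U hU0 i i.2]
        have e : U * (d 0 - d 1) = (U + V * d 1) * d 0 - (U + V * d 0) * d 1 := by ring
        rw [e, coeff_sub, coeff_mul, coeff_mul, Finset.Nat.sum_antidiagonal_eq_sum_range_succ
          (fun x y => (U + V * d 1).coeff x * (d 0).coeff y),
          Finset.Nat.sum_antidiagonal_eq_sum_range_succ
          (fun x y => (U + V * d 0).coeff x * (d 1).coeff y),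
          Finset.sum_range_succ' (fun x => (U + V * d 1).coeff x * (d 0).coeff (i + 1 - x)),
          Finset.sum_range_succ' (fun x => (U + V * d 0).coeff x * (d 1).coeff (i + 1 - x)), h0, h0, zero_mul, zero_mul, add_zero, add_zero,
          ← Finset.sum_sub_distrib]
        have hi := i.2
        refine Finset.sum_bij' (fun j _ => R - (j + 1)) (fun k _ => R - 1 - k) ?_ ?_ ?_ ?_ ?_
        · intro j hj; rw [Finset.mem_range] at hj; rw [Finset.mem_Icc]; omega
        · intro k hk; rw [Finset.mem_Icc] at hk; rw [Finset.mem_range]; omega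
        · intro j hj; rw [Finset.mem_range] at hj; omega
        · intro k hk; rw [Finset.mem_Icc] at hk; omega
        · intro j hj
          rw [Finset.mem_range] at hj
          rw [hF 1 (j + 1) (by omega) (by omega), hF 0 (j + 1) (by omega) (by omega),
            hdc _ _ (by omega), hdc _ _ (by omega),
            show 2 * R - 2 - (i : ℕ) - (R - (j + 1)) = R - 1 - (i + 1 - (j + 1)) by omega]
          ring)
    rw [cVec, this]

end

section

/-! ### First-order data of an isomonodromic family -/

variable {n : ℕ}

/-- Entries of the connection matrix, as rational functions. -/
noncomputable def laxEntry (D : DeformationData n) (K : PolarCoeffs n) (i j : Fin 2) : ℂ → ℂ :=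
  ratFn (D.rInf - 1) D.r D.X (fun k => K.inf (k + 1) i j) (fun s k => K.fin s k i j)

/-- Entries of the second matrix of a Lax pair. -/
noncomputable def auxEntry (D : DeformationData n) (K : PolarCoeffs n) (i j : Fin 2) : ℂ → ℂ :=
  ratFn D.rInf D.r D.X (fun k => K.inf k i j) (fun s k => K.fin s k i j)

/-- The derivative in `z` of `auxEntry`. -/
noncomputable def auxEntryDeriv (D : DeformationData n) (K : PolarCoeffs n) (i j : Fin 2) : ℂ → ℂ :=
  ratFnDeriv D.rInf D.r D.X (fun k => K.inf k i j) (fun s k => K.fin s k i j)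

/-- The derivative of `laxEntry` at fixed `z`, when the coefficients `K` move with velocity `K'` and
the poles with velocity `D.aPole`. -/
noncomputable def laxVelocity (D : DeformationData n) (K K' : PolarCoeffs n) (i j : Fin 2) : ℂ → ℂ :=
  ratFn (D.rInf - 1) (fun s => D.r s + 1) D.X (fun k => K'.inf (k + 1) i j)
    (fun s k => (if k < D.r s then K'.fin s k i j else 0) + k * D.aPole s * K.fin s (k - 1) i j)

/-- `(z - X_s)^{r_s} K(z)` modulo `(z - X_s)^{r_s}`. -/
noncomputable def finPoly (D : DeformationData n) (K : PolarCoeffs n) (s : Fin n) (i j : Fin 2) :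
    ℂ[X] :=
  polarPoly (D.r s) (fun k => K.fin s k i j)

/-- `z^{2 - rInf} K(z)`, in terms of `1/z`, modulo `z^{-rInf}`. -/
noncomputable def infPoly (D : DeformationData n) (K : PolarCoeffs n) (i j : Fin 2) : ℂ[X] :=
  ∑ k ∈ Finset.range (D.rInf - 1), C (K.inf (k + 1) i j) * X ^ (D.rInf - 1 - 1 - k)
    + C (∑ s, K.fin s 0 i j) * X ^ (D.rInf - 1)

/-- A connection matrix with coefficients `K`, its velocity `K'` under the deformation, and the
second matrix `B` of a Lax pair, subject to the normalization at infinity, to the invariants of the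
polar parts, to the first variation of these, and to the zero-curvature equation. -/
structure IsLaxJet (D : DeformationData n) (K K' B : PolarCoeffs n) : Prop where
  one_le_rInf : 1 ≤ D.rInf
  one_le_r : ∀ s, 1 ≤ D.r s
  hbar_ne : D.hbar ≠ 0
  X_injective : Function.Injective D.X
  distinct_inf : DistinctLeading D.rInf D.tInf
  distinct_fin : ∀ s, DistinctLeading (D.r s) (D.tX s)
  not_resonant : ∀ s, D.r s = 1 →
    D.tX s 0 0 - D.tX s 1 0 ≠ D.hbar ∧ D.tX s 0 0 - D.tX s 1 0 ≠ -D.hbar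
  lead : leadAtInfinity D.rInf K = Matrix.diagonal (fun a => -D.tInf a (D.rInf - 1))
  lead_velocity : ∀ i j, i ≠ j → leadAtInfinity D.rInf K' i j = 0
  sublead : subleadAtInfinity D.rInf D.r D.X K 0 1 = 1
  trace_fin : ∀ s, X ^ D.r s ∣ finPoly D K s 0 0 + finPoly D K s 1 1
    - (polarPoly (D.r s) (D.tX s 0) + polarPoly (D.r s) (D.tX s 1))
  det_fin : ∀ s, X ^ D.r s ∣ finPoly D K s 0 0 * finPoly D K s 1 1
    - finPoly D K s 0 1 * finPoly D K s 1 0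
    - polarPoly (D.r s) (D.tX s 0) * polarPoly (D.r s) (D.tX s 1)
  trace_inf : X ^ D.rInf ∣ infPoly D K 0 0 + infPoly D K 1 1
    - (-polarPoly D.rInf (D.tInf 0) + -polarPoly D.rInf (D.tInf 1))
  det_inf : X ^ D.rInf ∣ infPoly D K 0 0 * infPoly D K 1 1 - infPoly D K 0 1 * infPoly D K 1 0
    - (-polarPoly D.rInf (D.tInf 0)) * (-polarPoly D.rInf (D.tInf 1))
  trace_fin' : ∀ s, X ^ D.r s ∣ finPoly D K' s 0 0 + finPoly D K' s 1 1
    - (polarPoly (D.r s) (D.aX s 0) + polarPoly (D.r s) (D.aX s 1))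
  det_fin' : ∀ s, X ^ D.r s ∣ finPoly D K s 1 1 * finPoly D K' s 0 0
    + finPoly D K s 0 0 * finPoly D K' s 1 1
    - finPoly D K s 0 1 * finPoly D K' s 1 0 - finPoly D K s 1 0 * finPoly D K' s 0 1
    - (polarPoly (D.r s) (D.aX s 0) * polarPoly (D.r s) (D.tX s 1)
      + polarPoly (D.r s) (D.tX s 0) * polarPoly (D.r s) (D.aX s 1))
  trace_inf' : X ^ D.rInf ∣ infPoly D K' 0 0 + infPoly D K' 1 1
    - (-polarPoly D.rInf (D.aInf 0) + -polarPoly D.rInf (D.aInf 1))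
  det_inf' : X ^ D.rInf ∣ infPoly D K 1 1 * infPoly D K' 0 0 + infPoly D K 0 0 * infPoly D K' 1 1
    - infPoly D K 0 1 * infPoly D K' 1 0 - infPoly D K 1 0 * infPoly D K' 0 1
    - ((-polarPoly D.rInf (D.aInf 0)) * (-polarPoly D.rInf (D.tInf 1))
      + (-polarPoly D.rInf (D.tInf 0)) * (-polarPoly D.rInf (D.aInf 1)))
  zero_curvature : ∀ z, (∀ s, z ≠ D.X s) → ∀ i j, D.hbar * laxVelocity D K K' i j z =
    ∑ k, (auxEntry D B i k z * laxEntry D K k j z - laxEntry D K i k z * auxEntry D B k j z)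
      + D.hbar * auxEntryDeriv D B i j z

/-! ### Local expansions of the entries -/

theorem hasTrunc_laxEntry (D : DeformationData n) (hX : Function.Injective D.X) (K : PolarCoeffs n)
    (s : Fin n) (i j : Fin 2) :
    HasTrunc (D.r s) (fun x => x ^ D.r s * laxEntry D K i j (D.X s + x)) (finPoly D K s i j) :=
  hasTrunc_ratFn _ _ _ _ hX s

theorem hasTrunc_auxEntry (D : DeformationData n) (hX : Function.Injective D.X) (K : PolarCoeffs n)
    (s : Fin n) (i j : Fin 2) :
    HasTrunc (D.r s) (fun x => x ^ D.r s * auxEntry D K i j (D.X s + x)) (finPoly D K s i j) :=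
  hasTrunc_ratFn _ _ _ _ hX s

/-- The polar part of a variation in which the pole itself moves with speed `α`: the term
`∂_X (z - X)^{-k-1} = (k + 1) (z - X)^{-k-2}` becomes an Euler derivative. -/
theorem polarPoly_velocity (r : ℕ) (α : ℂ) (β β' : ℕ → ℂ) :
    polarPoly (r + 1) (fun k => (if k < r then β' k else 0) + k * α * β (k - 1)) =
      X * polarPoly r β' + C α * (C (r : ℂ) * polarPoly r β - euler (polarPoly r β)) := by
  ext m
  rw [coeff_add, coeff_C_mul, coeff_sub, coeff_C_mul, coeff_euler, coeff_polarPoly,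
    coeff_polarPoly]
  cases m with
  | zero =>
    rcases Nat.eq_zero_or_pos r with h | h
    · subst h; simp
    · simp [h]; ring
  | succ m =>
    rw [coeff_X_mul, coeff_polarPoly]
    by_cases h : m + 1 < r
    · rw [if_pos (by omega), if_pos (by omega), if_pos h, if_pos (by omega),
        show r + 1 - 1 - (m + 1) = r - 1 - m by omega, show r - 1 - m - 1 = r - 1 - (m + 1) by omega]
      have : ((r - 1 - m : ℕ) : ℂ) = r - (m + 1 : ℕ) := by
        rw [← Nat.cast_sub (by omega)]; congr 1; omega
      rw [this]; ring
    · rcases Nat.lt_or_ge m r with h' | h'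
      · obtain rfl : r = m + 1 := by omega
        simp
      · rw [if_neg (by omega), if_neg (by omega), if_neg (by omega)]; simp

theorem hasTrunc_laxVelocity (D : DeformationData n) (hX : Function.Injective D.X)
    (K K' : PolarCoeffs n) (s : Fin n) (i j : Fin 2) :
    HasTrunc (D.r s) (fun x => x ^ (D.r s + 1) * laxVelocity D K K' i j (D.X s + x))
      (X * finPoly D K' s i j + C (D.aPole s) *
        (C (D.r s : ℂ) * finPoly D K s i j - euler (finPoly D K s i j))) := by
  have := (hasTrunc_ratFn (D.rInf - 1) (fun s => D.r s + 1) (fun k => K'.inf (k + 1) i j)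
    (fun s k => (if k < D.r s then K'.fin s k i j else 0) + k * D.aPole s * K.fin s (k - 1) i j)
    hX s).mono (Nat.le_succ _)
  rwa [polarPoly_velocity (D.r s) (D.aPole s) (fun k => K.fin s k i j)] at this

theorem hasTrunc_ratFnDeriv (N : ℕ) (r : Fin n → ℕ) {Y : Fin n → ℂ} (hY : Function.Injective Y)
    (c : ℕ → ℂ) (b : Fin n → ℕ → ℂ) (s : Fin n) :
    HasTrunc (r s) (fun x => x ^ (r s + 1) * ratFnDeriv N r Y c b (Y s + x))
      (euler (polarPoly (r s) (b s)) - C (r s : ℂ) * polarPoly (r s) (b s)) := by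
  have := (hasTrunc_ratFn (N - 1) (fun s => r s + 1) (fun k => ((k : ℂ) + 1) * c (k + 1))
    (fun s k => -(k : ℂ) * b s (k - 1)) hY s).mono (Nat.le_succ _)
  have e := polarPoly_velocity (r s) (-1) (b s) 0
  have e0 : polarPoly (r s) 0 = 0 := by simp [polarPoly]
  simp only [Pi.zero_apply, ite_self, zero_add, mul_neg, mul_one, e0, mul_zero, map_neg, map_one,
    neg_mul, one_mul, neg_sub] at e
  simp only [neg_mul] at this
  rw [e] at this
  simp only [ratFnDeriv, neg_mul]
  exact this

theorem hasTrunc_auxEntryDeriv (D : DeformationData n) (hX : Function.Injective D.X)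
    (K : PolarCoeffs n) (s : Fin n) (i j : Fin 2) :
    HasTrunc (D.r s) (fun x => x ^ (D.r s + 1) * auxEntryDeriv D K i j (D.X s + x))
      (euler (finPoly D K s i j) - C (D.r s : ℂ) * finPoly D K s i j) :=
  hasTrunc_ratFnDeriv _ _ hX _ _ s

/-- The expansion of a Lax matrix entry at infinity, up to and including the coefficient of `z⁻²`.  The
weight `x ^ (R - 1) * x⁻¹` is `x ^ (R - 2)` and includes the case `R = 1`. -/
theorem hasTrunc_ratFn_inv_pred {R : ℕ} (hR : 1 ≤ R) {r : Fin n → ℕ} (hr : ∀ s, 1 ≤ r s)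
    (Y : Fin n → ℂ) (c : ℕ → ℂ) (b : Fin n → ℕ → ℂ) :
    HasTrunc (R + 1) (fun x => x ^ (R - 1) * x⁻¹ * ratFn (R - 1) r Y c b x⁻¹)
      (∑ k ∈ Finset.range (R - 1), C (c k) * X ^ (R - 1 - 1 - k) + C (∑ s, b s 0) * X ^ (R - 1)
        + C (polarMoment₁ r Y b) * X ^ R) := by
  have h := hasTrunc_ratFn_inv (R - 1) r Y c b
  have h0 : polarMoment₀ r b = ∑ s, b s 0 :=
    Finset.sum_congr rfl fun s _ => if_pos (hr s)
  rw [h0, show R - 1 + 3 = R + 1 + 1 by omega] at h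
  refine HasTrunc.of_pow_mul 1 ?_
  have e1 : ∑ k ∈ Finset.range (R - 1), C (c k) * X ^ (R - 1 - k) =
      X * ∑ k ∈ Finset.range (R - 1), C (c k) * X ^ (R - 1 - 1 - k) := by
    rw [Finset.mul_sum]
    refine Finset.sum_congr rfl fun k hk => ?_
    rw [Finset.mem_range] at hk
    rw [show R - 1 - k = R - 1 - 1 - k + 1 by omega, pow_succ]; ring
  rw [e1] at h
  convert h.congr_of_ne (g := fun x => x ^ 1 * (x ^ (R - 1) * x⁻¹ * ratFn (R - 1) r Y c b x⁻¹))
    (fun x hx => ?_) using 1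
  · obtain ⟨m, rfl⟩ : ∃ m, R = m + 1 := ⟨R - 1, by omega⟩
    rw [Nat.add_sub_cancel]
    ring
  · field_simp

theorem hasTrunc_ratFn_inv_pred' {R : ℕ} (hR : 1 ≤ R) {r : Fin n → ℕ} (hr : ∀ s, 1 ≤ r s)
    (Y : Fin n → ℂ) (c : ℕ → ℂ) (b : Fin n → ℕ → ℂ) :
    HasTrunc R (fun x => x ^ (R - 1) * x⁻¹ * ratFn (R - 1) r Y c b x⁻¹)
      (∑ k ∈ Finset.range (R - 1), C (c k) * X ^ (R - 1 - 1 - k)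
        + C (∑ s, b s 0) * X ^ (R - 1)) := by
  refine ((hasTrunc_ratFn_inv_pred hR hr Y c b).mono (Nat.le_succ _)).congr_mod ?_
  rw [add_sub_cancel_left]
  exact Dvd.intro_left _ rfl

theorem hasTrunc_laxEntry_inv (D : DeformationData n) (hR : 1 ≤ D.rInf) (hr : ∀ s, 1 ≤ D.r s)
    (K : PolarCoeffs n) (i j : Fin 2) :
    HasTrunc D.rInf (fun x => x ^ (D.rInf - 1) * x⁻¹ * laxEntry D K i j x⁻¹) (infPoly D K i j) :=
  hasTrunc_ratFn_inv_pred' hR hr _ _ _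

theorem hasTrunc_laxVelocity_inv (D : DeformationData n) (hR : 1 ≤ D.rInf) (hr : ∀ s, 1 ≤ D.r s)
    (K K' : PolarCoeffs n) (i j : Fin 2) :
    HasTrunc D.rInf (fun x => x ^ (D.rInf - 1) * x⁻¹ * laxVelocity D K K' i j x⁻¹)
      (infPoly D K' i j) := by
  have h := hasTrunc_ratFn_inv_pred' hR (r := fun s => D.r s + 1) (fun s => Nat.le_add_left _ _)
    D.X (fun k => K'.inf (k + 1) i j)
    (fun s k => (if k < D.r s then K'.fin s k i j else 0) + k * D.aPole s * K.fin s (k - 1) i j)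
  have e : ∑ s, ((if 0 < D.r s then K'.fin s 0 i j else 0)
      + ((0 : ℕ) : ℂ) * D.aPole s * K.fin s (0 - 1) i j) = ∑ s, K'.fin s 0 i j :=
    Finset.sum_congr rfl fun s _ => by rw [if_pos (show 0 < D.r s from hr s)]; simp
  rw [e] at h
  exact h

theorem hasTrunc_auxEntry_inv (D : DeformationData n) (K : PolarCoeffs n) (i j : Fin 2) (hR : 1 ≤ D.rInf) :
    HasTrunc D.rInf (fun x => x ^ (D.rInf - 1) * auxEntry D K i j x⁻¹)
      (polarPoly D.rInf (fun k => K.inf k i j)) := by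
  have h := hasTrunc_ratFn_inv D.rInf D.r D.X (fun k => K.inf k i j) (fun s k => K.fin s k i j)
  have h2 : HasTrunc (D.rInf + 1) (fun x => x ^ 1 * (x ^ (D.rInf - 1) * auxEntry D K i j x⁻¹))
      (X ^ 1 * polarPoly D.rInf (fun k => K.inf k i j)) := by
    refine ((h.mono (by omega)).congr_mod ?_).congr_of_ne fun x hx => ?_
    · refine ⟨C (polarMoment₀ D.r (fun s k => K.fin s k i j))
        + C (polarMoment₁ D.r D.X (fun s k => K.fin s k i j)) * X, ?_⟩
      have e1 : ∑ k ∈ Finset.range D.rInf, C (K.inf k i j) * X ^ (D.rInf - k) =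
          X ^ 1 * polarPoly D.rInf (fun k => K.inf k i j) := by
        rw [polarPoly, Finset.mul_sum]
        refine Finset.sum_congr rfl fun k hk => ?_
        rw [Finset.mem_range] at hk
        rw [show D.rInf - k = D.rInf - 1 - k + 1 by omega, pow_succ]; ring
      rw [e1]; ring
    · rw [auxEntry, ← mul_assoc, ← pow_add, show 1 + (D.rInf - 1) = D.rInf by omega]
  exact h2.of_pow_mul 1

theorem hasTrunc_auxEntryDeriv_inv (D : DeformationData n) (K : PolarCoeffs n) (i j : Fin 2)
    (hR : 1 ≤ D.rInf) :
    HasTrunc D.rInf (fun x => x ^ (D.rInf - 1) * x⁻¹ * auxEntryDeriv D K i j x⁻¹)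
      (C ((D.rInf - 1 : ℕ) : ℂ) * polarPoly D.rInf (fun k => K.inf k i j)
        - euler (polarPoly D.rInf (fun k => K.inf k i j))) := by
  have h := hasTrunc_ratFn_inv_pred' hR (r := fun s => D.r s + 1) (fun s => Nat.le_add_left _ _)
    D.X (fun k => ((k : ℂ) + 1) * K.inf (k + 1) i j) (fun s k => -(k : ℂ) * K.fin s (k - 1) i j)
  refine Eq.mp (congrArg (HasTrunc D.rInf _) ?_) h
  ext m
  simp only [coeff_sub, coeff_C_mul, coeff_euler, coeff_polarPoly, finsetSum_coeff,
    coeff_X_pow, Nat.cast_zero, neg_zero, zero_mul, Finset.sum_const_zero, map_zero,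
    add_zero, mul_ite, mul_one, mul_zero]
  symm
  split_ifs with hm
  · rw [← sub_mul, ← Nat.cast_sub (by omega)]
    rcases Nat.lt_or_ge m (D.rInf - 1) with h | h
    · rw [Finset.sum_eq_single (D.rInf - 1 - 1 - m)]
      · rw [if_pos (by omega), ← Nat.cast_succ, Nat.succ_eq_add_one,
          show D.rInf - 1 - 1 - m + 1 = D.rInf - 1 - m by omega]
      · intro k hk hne
        rw [Finset.mem_range] at hk
        rw [if_neg (by omega)]
      · intro hk; rw [Finset.mem_range] at hk; omega
    · rw [show D.rInf - 1 - m = 0 by omega]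
      simp only [Nat.cast_zero, zero_mul]
      refine (Finset.sum_eq_zero fun k hk => ?_).symm
      rw [Finset.mem_range] at hk
      rw [if_neg (by omega)]
  · rw [sub_self]
    refine (Finset.sum_eq_zero fun k hk => ?_).symm
    rw [Finset.mem_range] at hk
    rw [if_neg (by omega)]

theorem coeff_zero_infPoly (D : DeformationData n) (hR : 1 ≤ D.rInf) (K : PolarCoeffs n) (i j : Fin 2) :
    (infPoly D K i j).coeff 0 = leadAtInfinity D.rInf K i j := by
  rw [infPoly, coeff_add, finsetSum_coeff, coeff_C_mul, coeff_X_pow, leadAtInfinity]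
  simp only [coeff_C_mul, coeff_X_pow, mul_ite, mul_one, mul_zero]
  rcases Nat.lt_or_ge 1 D.rInf with h | h
  · rw [if_pos (show 2 ≤ D.rInf from h), if_neg (show ¬ 0 = D.rInf - 1 by omega), add_zero,
      Finset.sum_eq_single (D.rInf - 1 - 1)]
    · rw [if_pos (by omega), show D.rInf - 1 - 1 + 1 = D.rInf - 1 by omega]
    · intro k hk hne
      rw [Finset.mem_range] at hk
      rw [if_neg (by omega)]
    · intro hk; rw [Finset.mem_range] at hk; omega
  · rw [if_neg (show ¬ 2 ≤ D.rInf by omega), if_pos (show 0 = D.rInf - 1 by omega),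
      show D.rInf - 1 = 0 by omega, Finset.range_zero, Finset.sum_empty, zero_add, Matrix.sum_apply]

end

section

/-! ### The polar parts of the second matrix of a Lax pair -/

variable {n : ℕ} {D : DeformationData n} {K K' B : PolarCoeffs n}

/-- The expansion at `X_s` of the ratio of the `(1,2)` entries of a Lax pair. -/
noncomputable def nuPoly (D : DeformationData n) (s : Fin n) : ℂ[X] :=
  ∑ k ∈ Finset.range (D.r s), C (D.nuX s k) * X ^ k

/-- The expansion at infinity of `1/z` times the ratio of the `(1,2)` entries of a Lax pair. -/
noncomputable def nuInfPoly (D : DeformationData n) : ℂ[X] :=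
  ∑ m ∈ Finset.range (D.rInf - 1), C (D.nuInfShifted m) * X ^ m

theorem coeff_sum_range (N m : ℕ) (c : ℕ → ℂ) :
    (∑ k ∈ Finset.range N, C (c k) * X ^ k : ℂ[X]).coeff m = if m < N then c m else 0 := by
  simp only [finsetSum_coeff, coeff_C_mul, coeff_X_pow, mul_ite, mul_one, mul_zero]
  rw [Finset.sum_ite_eq]
  simp only [Finset.mem_range]

namespace IsLaxJet

/-- The commutator drops out of the trace of the zero curvature equation. -/
theorem trace_curvature (h : IsLaxJet D K K' B) {z : ℂ} (hz : ∀ s, z ≠ D.X s) :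
    ∑ i, (laxVelocity D K K' i i z - auxEntryDeriv D B i i z) = 0 := by
  have h0 := h.zero_curvature z hz 0 0
  have h1 := h.zero_curvature z hz 1 1
  simp only [Fin.sum_univ_two] at *
  apply mul_left_cancel₀ h.hbar_ne
  linear_combination h0 + h1

/-- The commutator `[A, L]` drops out of the trace of the zero curvature equation against the adjugate
of `L`: this is the variation of `det L`. -/
theorem adjugate_curvature (h : IsLaxJet D K K' B) {z : ℂ} (hz : ∀ s, z ≠ D.X s) :
    laxEntry D K 1 1 z * (laxVelocity D K K' 0 0 z - auxEntryDeriv D B 0 0 z)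
      + laxEntry D K 0 0 z * (laxVelocity D K K' 1 1 z - auxEntryDeriv D B 1 1 z)
      - laxEntry D K 0 1 z * (laxVelocity D K K' 1 0 z - auxEntryDeriv D B 1 0 z)
      - laxEntry D K 1 0 z * (laxVelocity D K K' 0 1 z - auxEntryDeriv D B 0 1 z) = 0 := by
  have h00 := h.zero_curvature z hz 0 0
  have h01 := h.zero_curvature z hz 0 1
  have h10 := h.zero_curvature z hz 1 0
  have h11 := h.zero_curvature z hz 1 1
  simp only [Fin.sum_univ_two] at *
  apply mul_left_cancel₀ h.hbar_ne
  linear_combination laxEntry D K 1 1 z * h00 + laxEntry D K 0 0 z * h11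
    - laxEntry D K 0 1 z * h10 - laxEntry D K 1 0 z * h01

theorem eventually_off_poles (h : IsLaxJet D K K' B) (s : Fin n) :
    ∀ᶠ x in 𝓝[≠] (0 : ℂ), ∀ s', D.X s + x ≠ D.X s' := by
  refine eventually_all.2 fun s' => ?_
  by_cases hs : s' = s
  · subst hs
    filter_upwards [self_mem_nhdsWithin] with x hx
    have hx : x ≠ 0 := hx
    simpa using hx
  · have hc : ContinuousAt (fun x : ℂ => D.X s + x) 0 := by fun_prop
    refine (hc.eventually_ne ?_).filter_mono nhdsWithin_le_nhds
    simpa using h.X_injective.ne (Ne.symm hs)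

theorem eventually_off_poles_inv (X : Fin n → ℂ) : ∀ᶠ x in 𝓝[≠] (0 : ℂ), ∀ s', x⁻¹ ≠ X s' := by
  refine eventually_all.2 fun s' => ?_
  have h1 : Tendsto (fun x : ℂ => x⁻¹) (𝓝[≠] 0) (Bornology.cobounded ℂ) := tendsto_inv₀_nhdsNE_zero
  have h2 : ({X s'} : Set ℂ)ᶜ ∈ Bornology.cobounded ℂ := by
    rw [← Bornology.isBounded_def]; exact Bornology.isBounded_singleton
  exact h1.eventually h2

set_option maxHeartbeats 400000 in
/-- Near `X_s` the first row of `A` is `ν L`, up to a holomorphic matrix and, in the diagonal entry, the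
polar part with coefficients `c_{X_s,k}`. -/
theorem aux_sub_nu_lax_fin (h : IsLaxJet D K K' B) (s : Fin n)
    (hl : (finPoly D K s 0 1).coeff 0 ≠ 0) :
    HasTrunc (D.r s) (fun x => x ^ D.r s * (auxEntry D B 0 1 (D.X s + x)
      - (nuPoly D s).eval x * laxEntry D K 0 1 (D.X s + x))) 0 ∧
    HasTrunc (D.r s) (fun x => x ^ D.r s * (auxEntry D B 0 0 (D.X s + x)
      - (nuPoly D s).eval x * laxEntry D K 0 0 (D.X s + x)
      - ∑ k ∈ Finset.Icc 1 (D.r s - 1), D.cX s k / x ^ k)) 0 := by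
  have hr := h.one_le_r s
  have hX := h.X_injective
  set r := D.r s with hrdef
  set l : Fin 2 → Fin 2 → ℂ[X] := finPoly D K s with hldef
  set b : Fin 2 → Fin 2 → ℂ[X] := finPoly D B s with hbdef
  set α := D.aPole s with hα
  -- adding `α L` to `A` absorbs the motion of the pole
  set a : Fin 2 → Fin 2 → ℂ[X] := fun i j => b i j + C α * l i j with hadef
  set δl : Fin 2 → Fin 2 → ℂ[X] := finPoly D K' s with hδdef
  set d : Fin 2 → ℂ[X] := fun i => polarPoly r (D.tX s i) with hddef
  set δd : Fin 2 → ℂ[X] := fun i => polarPoly r (D.aX s i) with hδddef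
  have hL : ∀ i j, HasTrunc r (fun x => x ^ r * laxEntry D K i j (D.X s + x)) (l i j) :=
    fun i j => hasTrunc_laxEntry D hX K s i j
  have hB : ∀ i j, HasTrunc r (fun x => x ^ r * auxEntry D B i j (D.X s + x)) (b i j) :=
    fun i j => hasTrunc_auxEntry D hX B s i j
  have hA : ∀ i j, HasTrunc r (fun x => x ^ r * auxEntry D B i j (D.X s + x)
      + α * (x ^ r * laxEntry D K i j (D.X s + x))) (a i j) :=
    fun i j => (hB i j).add ((hL i j).const_mul α)
  have hE : ∀ i j, HasTrunc r (fun x => x ^ (r + 1) *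
      (laxVelocity D K K' i j (D.X s + x) - auxEntryDeriv D B i j (D.X s + x)))
      (X * δl i j + C (r : ℂ) * a i j - euler (a i j)) := by
    intro i j
    have h1 := (hasTrunc_laxVelocity D hX K K' s i j).sub (hasTrunc_auxEntryDeriv D hX B s i j)
    have e1 : euler (a i j) = euler (b i j) + C α * euler (l i j) := by
      rw [hadef]; simp only [euler_add, euler_mul]; simp [euler]
    rw [e1, hadef]
    convert h1 using 1
    · ext x; ring
    · ring
  have hd0 : (d 0 - d 1).coeff 0 = D.tX s 0 (r - 1) - D.tX s 1 (r - 1) := by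
    rw [coeff_sub, coeff_polarPoly, coeff_polarPoly, if_pos (by omega), if_pos (by omega)]
    rfl
  have hT : modX r (l 0 0 + l 1 1) = modX r (d 0 + d 1) := modX_eq_iff.2 (h.trace_fin s)
  have hΔ : modX r (l 0 0 * l 1 1 - l 0 1 * l 1 0) = modX r (d 0 * d 1) :=
    modX_eq_iff.2 (h.det_fin s)
  have hdne : (d 0 - d 1).coeff 0 ≠ 0 := by
    rw [hd0]; exact sub_ne_zero.2 (h.distinct_fin s)
  -- the zero-curvature equation, scaled by `x^(2r)`
  have hcomm : ∀ i j, X ^ r ∣ ∑ k, (a i k * l k j - l i k * a k j)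
      - X ^ (r - 1) * (C (D.hbar * r) * a i j) := by
    intro i j
    have h1 : HasTrunc r (fun x => x ^ (r - 1) * (D.hbar * (x ^ (r + 1) *
      (laxVelocity D K K' i j (D.X s + x) - auxEntryDeriv D B i j (D.X s + x)))))
      (X ^ (r - 1) * (C D.hbar * (X * δl i j + C (r : ℂ) * a i j - euler (a i j)))) := by
      have := ((hE i j).const_mul D.hbar).pow_mul (r - 1)
      exact this.mono (by omega)
    have h2 := HasTrunc.sum Finset.univ (N := r)
      (fun k _ => ((hA i k).mul (hL k j)).sub ((hL i k).mul (hA k j)))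
    have h3 := h2.dvd_sub (h1.congr' ?_)
    · have e : X ^ (r - 1) * (C D.hbar * (X * δl i j + C (r : ℂ) * a i j - euler (a i j))) =
          X ^ (r - 1) * (C (D.hbar * r) * a i j) +
            X ^ r * (C D.hbar * (δl i j - derivative (a i j))) := by
        have : (X : ℂ[X]) ^ r = X ^ (r - 1) * X := by rw [← pow_succ, Nat.sub_add_cancel hr]
        rw [this, euler, map_mul]; ring
      rw [e] at h3
      have := h3.add (Dvd.intro (C D.hbar * (δl i j - derivative (a i j))) rfl)
      convert this using 1; ring
    · filter_upwards [h.eventually_off_poles s, self_mem_nhdsWithin] with x hx hx0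
      have hz := h.zero_curvature (D.X s + x) hx i j
      have e : x ^ (r - 1) * (D.hbar * (x ^ (r + 1) *
          (laxVelocity D K K' i j (D.X s + x) - auxEntryDeriv D B i j (D.X s + x)))) =
          x ^ r * x ^ r * (D.hbar * laxVelocity D K K' i j (D.X s + x)
            - D.hbar * auxEntryDeriv D B i j (D.X s + x)) := by
        obtain ⟨m, hm⟩ : ∃ m, r = m + 1 := ⟨r - 1, by omega⟩
        rw [hm, Nat.add_sub_cancel]; ring
      rw [e, hz]
      simp only [Fin.sum_univ_two]
      ring
  have hoff := h.eventually_off_poles s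
  have hEt : modX r (∑ i, (X * δl i i + C (r : ℂ) * a i i - euler (a i i))) = 0 := by
    rw [← map_zero (modX r), modX_eq_iff, sub_zero]
    refine HasTrunc.dvd ((HasTrunc.sum Finset.univ (fun i _ => hE i i)).congr' ?_)
    filter_upwards [hoff] with x hx
    rw [← Finset.mul_sum, h.trace_curvature hx, mul_zero]
  have hEd : modX r (l 1 1 * (X * δl 0 0 + C (r : ℂ) * a 0 0 - euler (a 0 0))
      + l 0 0 * (X * δl 1 1 + C (r : ℂ) * a 1 1 - euler (a 1 1))
      - l 0 1 * (X * δl 1 0 + C (r : ℂ) * a 1 0 - euler (a 1 0))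
      - l 1 0 * (X * δl 0 1 + C (r : ℂ) * a 0 1 - euler (a 0 1))) = 0 := by
    rw [← map_zero (modX r), modX_eq_iff, sub_zero]
    refine HasTrunc.dvd (((((hL 1 1).mul (hE 0 0)).add ((hL 0 0).mul (hE 1 1))).sub
      ((hL 0 1).mul (hE 1 0))).sub ((hL 1 0).mul (hE 0 1)) |>.congr' ?_)
    filter_upwards [hoff] with x hx
    linear_combination x ^ r * x ^ (r + 1) * h.adjugate_curvature hx
  have hres : r = 1 → (d 0 - d 1).coeff 0 ≠ D.hbar ∧ (d 0 - d 1).coeff 0 ≠ -D.hbar := by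
    intro h1
    have h2 := h.not_resonant s h1
    have h3 : r - 1 = 0 := by omega
    rw [hd0, h3]
    exact h2
  obtain ⟨u, v, h00, h01, h10, h11⟩ := exists_scalar_combination_finite
    (l := l) (a := a) (d := d) hr h.hbar_ne hT hΔ hdne hl
    hres hcomm
  have heig := eigenvalue_equation (l := l) (a := a) (δl := δl) (d := d) (δd := δd) (ξ := X)
    (ρ := C (r : ℂ)) hT hΔ (modX_eq_iff.2 (h.trace_fin' s))
    (modX_eq_iff.2 (h.det_fin' s)) h00 h01 h10 h11 hEt hEd hdne
  have hcoef : ∀ i m, m < r → (X * δd i).coeff m +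
      ((r : ℂ) - m) * (u + v * d i).coeff m = 0 := by
    intro i m hm
    have := heig i
    rw [← map_zero (modX r), modX_eq_iff, sub_zero] at this
    have := X_pow_dvd_iff.1 this m hm
    rw [coeff_sub, coeff_add, coeff_C_mul, coeff_euler] at this
    linear_combination this
  obtain ⟨hV0, hU0, hnu, hc⟩ := toeplitz_of_eigenvalues hr (h.distinct_fin s) (a := D.aX s)
    (U := u) (V := v)
    (fun i => by
      have := hcoef i 0 (by omega)
      rw [coeff_X_mul_zero, zero_add] at this
      have hr0 : ((r : ℂ) - (0 : ℕ)) ≠ 0 := by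
        rw [Nat.cast_zero, sub_zero]; exact_mod_cast (by omega : r ≠ 0)
      exact (mul_eq_zero.1 this).resolve_left hr0)
    (fun i m hm1 hm => by
      have := hcoef i m hm
      obtain ⟨m, rfl⟩ : ∃ m', m = m' + 1 := ⟨m - 1, by omega⟩
      rw [coeff_X_mul, coeff_polarPoly, if_pos (by omega), ← Nat.cast_sub (by omega),
        show r - 1 - m = r - (m + 1) by omega] at this
      have hr0 : ((r - (m + 1) : ℕ) : ℂ) ≠ 0 := by exact_mod_cast (by omega : r - (m + 1) ≠ 0)
      rw [eq_div_iff hr0]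
      linear_combination this)
  have hvnu : X ^ r ∣ v - C α - nuPoly D s := by
    rw [X_pow_dvd_iff]
    intro m hm
    rw [coeff_sub, coeff_sub, nuPoly, coeff_sum_range, if_pos hm, DeformationData.nuX]
    rcases Nat.eq_zero_or_pos m with h0 | h0
    · subst h0; simp [hV0, hα]
    · rw [coeff_C_of_ne_zero (by omega), if_neg (by omega), entryAt, dif_pos (by omega), hnu]
      simp only
      rw [Nat.sub_add_cancel h0]; ring
  have hucX : X ^ r ∣ u - ∑ k ∈ Finset.Icc 1 (r - 1), C (D.cX s k) * X ^ (r - k) := by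
    rw [X_pow_dvd_iff]
    intro m hm
    simp only [coeff_sub, finsetSum_coeff, coeff_C_mul, coeff_X_pow, mul_ite, mul_one, mul_zero]
    rcases Nat.eq_zero_or_pos m with h0 | h0
    · subst h0
      rw [hU0, Finset.sum_eq_zero, sub_zero]
      intro k hk
      rw [Finset.mem_Icc] at hk
      rw [if_neg (by omega)]
    · rw [Finset.sum_eq_single (r - m)]
      · rw [if_pos (by omega), DeformationData.cX, entryAt, dif_pos (by omega), hc]
        simp only
        rw [show r - 1 - (r - m) + 1 = m by omega, sub_self]
      · intro k hk hne
        rw [Finset.mem_Icc] at hk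
        rw [if_neg (by omega)]
      · intro hk; rw [Finset.mem_Icc] at hk; omega
  constructor
  · have h1 := (hB 0 1).sub ((HasTrunc.poly r (nuPoly D s)).mul (hL 0 1))
    refine (h1.congr_mod ?_).congr_of_ne fun x _ => ?_
    · have e1 := modX_eq_iff.1 h01
      have := e1.add (hvnu.mul_right (l 0 1))
      rw [sub_zero]
      convert this using 1
      simp only [hadef]; ring
    · ring
  · have h1 := ((hB 0 0).sub ((HasTrunc.poly r (nuPoly D s)).mul (hL 0 0))).sub
      (HasTrunc.poly r (∑ k ∈ Finset.Icc 1 (r - 1), C (D.cX s k) * X ^ (r - k)))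
    refine (h1.congr_mod ?_).congr_of_ne fun x hx => ?_
    · have e1 := modX_eq_iff.1 h00
      have := (e1.add (hvnu.mul_right (l 0 0))).add hucX
      rw [sub_zero]
      convert this using 1
      simp only [hadef]; ring
    · simp only [eval_finsetSum, eval_mul, eval_C, eval_pow, eval_X]
      have : ∑ k ∈ Finset.Icc 1 (r - 1), D.cX s k * x ^ (r - k) =
          x ^ r * ∑ k ∈ Finset.Icc 1 (r - 1), D.cX s k / x ^ k := by
        rw [Finset.mul_sum]
        refine Finset.sum_congr rfl fun k hk => ?_
        rw [Finset.mem_Icc] at hk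
        rw [pow_sub₀ x hx (by omega)]; ring
      rw [this]; ring

set_option maxHeartbeats 400000 in
/-- At infinity the first row of `A` is `ν L`, up to terms decaying like `1 / z` in the off-diagonal
entry, and up to a polynomial with coefficients `c_{∞,k}` and bounded terms in the diagonal one. -/
theorem aux_sub_nu_lax_inf (h : IsLaxJet D K K' B) :
    HasTrunc D.rInf (fun x => x ^ (D.rInf - 1) * (auxEntry D B 0 1 x⁻¹
      - x⁻¹ * (nuInfPoly D).eval x * laxEntry D K 0 1 x⁻¹)) 0 ∧
    HasTrunc (D.rInf - 1) (fun x => x ^ (D.rInf - 1) * (auxEntry D B 0 0 x⁻¹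
      - x⁻¹ * (nuInfPoly D).eval x * laxEntry D K 0 0 x⁻¹
      - ∑ k ∈ Finset.Icc 1 (D.rInf - 1), D.cInf k * x⁻¹ ^ k)) 0 := by
  have hr := h.one_le_rInf
  have hrf := h.one_le_r
  have hX := h.X_injective
  set r := D.rInf with hrdef
  set l : Fin 2 → Fin 2 → ℂ[X] := infPoly D K with hldef
  set a : Fin 2 → Fin 2 → ℂ[X] := fun i j => polarPoly r (fun k => B.inf k i j) with hadef
  set δl : Fin 2 → Fin 2 → ℂ[X] := infPoly D K' with hδdef
  set d : Fin 2 → ℂ[X] := fun i => -polarPoly r (D.tInf i) with hddef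
  set δd : Fin 2 → ℂ[X] := fun i => -polarPoly r (D.aInf i) with hδddef
  have hL : ∀ i j, HasTrunc r (fun x => x ^ (r - 1) * x⁻¹ * laxEntry D K i j x⁻¹) (l i j) :=
    fun i j => hasTrunc_laxEntry_inv D hr hrf K i j
  have hA : ∀ i j, HasTrunc r (fun x => x ^ (r - 1) * auxEntry D B i j x⁻¹) (a i j) :=
    fun i j => hasTrunc_auxEntry_inv D B i j hr
  have hE : ∀ i j, HasTrunc r (fun x => -(x ^ (r - 1) * x⁻¹ *
      (laxVelocity D K K' i j x⁻¹ - auxEntryDeriv D B i j x⁻¹)))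
      (-1 * δl i j + C ((r - 1 : ℕ) : ℂ) * a i j - euler (a i j)) := by
    intro i j
    have h1 := ((hasTrunc_laxVelocity_inv D hr hrf K K' i j).sub
      (hasTrunc_auxEntryDeriv_inv D B i j hr)).neg
    convert h1 using 1
    · ext x; ring
    · simp only [hadef, hδdef]; ring
  have hT : modX r (l 0 0 + l 1 1) = modX r (d 0 + d 1) := modX_eq_iff.2 h.trace_inf
  have hΔ : modX r (l 0 0 * l 1 1 - l 0 1 * l 1 0) = modX r (d 0 * d 1) :=
    modX_eq_iff.2 h.det_inf
  have hdne : (d 0 - d 1).coeff 0 ≠ 0 := by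
    simp only [hddef]
    rw [coeff_sub, coeff_neg, coeff_neg, coeff_polarPoly, coeff_polarPoly, if_pos (by omega),
      if_pos (by omega), Nat.sub_zero]
    have := h.distinct_inf
    intro h0
    apply this
    linear_combination -h0
  have hlc : ∀ i j, (l i j).coeff 0 = leadAtInfinity r K i j :=
    fun i j => coeff_zero_infPoly D hr K i j
  have hl01 : (l 0 1).coeff 0 = 0 := by
    rw [hlc, h.lead, Matrix.diagonal_apply_ne _ (by decide)]
  have hl10 : (l 1 0).coeff 0 = 0 := by
    rw [hlc, h.lead, Matrix.diagonal_apply_ne _ (by decide)]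
  have hldiff : (l 0 0 - l 1 1).coeff 0 ≠ 0 := by
    rw [coeff_sub, hlc, hlc, h.lead, Matrix.diagonal_apply_eq, Matrix.diagonal_apply_eq]
    have := h.distinct_inf
    intro h0
    apply this
    linear_combination -h0
  have hcomm : ∀ i j, X ^ r ∣ ∑ k, (a i k * l k j - l i k * a k j)
      - X ^ (r - 1) * (C D.hbar * (δl i j + euler (a i j) - C ((r - 1 : ℕ) : ℂ) * a i j)) := by
    intro i j
    have h1 := (((hE i j).neg).const_mul D.hbar).pow_mul (r - 1)
    have h1 := h1.mono (M := r) (by omega)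
    have h2 := HasTrunc.sum Finset.univ (N := r)
      (fun k _ => ((hA i k).mul (hL k j)).sub ((hL i k).mul (hA k j)))
    have h3 := h2.dvd_sub (h1.congr' ?_)
    · convert h3 using 3; ring
    · filter_upwards [eventually_off_poles_inv D.X] with x hx
      have hz := h.zero_curvature x⁻¹ hx i j
      simp only [Fin.sum_univ_two] at *
      linear_combination x ^ (r - 1) * (x ^ (r - 1) * x⁻¹) * hz
  have hoff := eventually_off_poles_inv D.X
  have hEt : modX r (∑ i, (-1 * δl i i + C ((r - 1 : ℕ) : ℂ) * a i i - euler (a i i))) = 0 := by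
    rw [← map_zero (modX r), modX_eq_iff, sub_zero]
    refine HasTrunc.dvd ((HasTrunc.sum Finset.univ (fun i _ => hE i i)).congr' ?_)
    filter_upwards [hoff] with x hx
    rw [Finset.sum_neg_distrib, ← Finset.mul_sum, h.trace_curvature hx, mul_zero, neg_zero]
  have hEd : modX r (l 1 1 * (-1 * δl 0 0 + C ((r - 1 : ℕ) : ℂ) * a 0 0 - euler (a 0 0))
      + l 0 0 * (-1 * δl 1 1 + C ((r - 1 : ℕ) : ℂ) * a 1 1 - euler (a 1 1))
      - l 0 1 * (-1 * δl 1 0 + C ((r - 1 : ℕ) : ℂ) * a 1 0 - euler (a 1 0))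
      - l 1 0 * (-1 * δl 0 1 + C ((r - 1 : ℕ) : ℂ) * a 0 1 - euler (a 0 1))) = 0 := by
    rw [← map_zero (modX r), modX_eq_iff, sub_zero]
    refine HasTrunc.dvd (((((hL 1 1).mul (hE 0 0)).add ((hL 0 0).mul (hE 1 1))).sub
      ((hL 0 1).mul (hE 1 0))).sub ((hL 1 0).mul (hE 0 1)) |>.congr' ?_)
    filter_upwards [hoff] with x hx
    linear_combination -(x ^ (r - 1) * x⁻¹) ^ 2 * h.adjugate_curvature hx
  obtain ⟨u, v, h00, h01, h10, h11⟩ := exists_scalar_combination_infinity hr (hbar := D.hbar)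
    (l := l) (a := a) (δl := δl) hl01 hl10 hldiff
    (by rw [hδdef, coeff_zero_infPoly D hr, h.lead_velocity _ _ (by decide)])
    (by rw [hδdef, coeff_zero_infPoly D hr, h.lead_velocity _ _ (by decide)]) hcomm
  have heig := eigenvalue_equation (l := l) (a := a) (δl := δl) (d := d) (δd := δd) (ξ := -1)
    (ρ := C ((r - 1 : ℕ) : ℂ)) hT hΔ (modX_eq_iff.2 h.trace_inf')
    (modX_eq_iff.2 h.det_inf') h00 h01 h10 h11 hEt hEd hdne
  have hcoef : ∀ i m, m < r - 1 → (u + v * d i).coeff m =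
      -D.aInf i (r - 1 - m) / ((r - 1 - m : ℕ) : ℂ) := by
    intro i m hm
    have := heig i
    rw [← map_zero (modX r), modX_eq_iff, sub_zero] at this
    have := X_pow_dvd_iff.1 this m (by omega)
    rw [coeff_sub, coeff_add, coeff_C_mul, coeff_euler, show δd i = -polarPoly r (D.aInf i) from rfl,
      neg_mul_neg, one_mul, coeff_polarPoly, if_pos (by omega)] at this
    have hr0 : ((r - 1 - m : ℕ) : ℂ) ≠ 0 := by exact_mod_cast (by omega : r - 1 - m ≠ 0)
    rw [eq_div_iff hr0, Nat.cast_sub (by omega)]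
    linear_combination this
  obtain ⟨-, -, hnu, hc⟩ := toeplitz_of_eigenvalues hr h.distinct_inf (a := D.aInf)
    (U := X * u) (V := -(X * v))
    (fun i => by
      rw [coeff_add, coeff_X_mul_zero, neg_mul, mul_assoc, coeff_neg, coeff_X_mul_zero]; simp)
    (fun i m hm1 hm => by
      obtain ⟨m, rfl⟩ : ∃ m', m = m' + 1 := ⟨m - 1, by omega⟩
      have e : X * u + -(X * v) * polarPoly D.rInf (D.tInf i) = X * (u + v * d i) := by
        simp only [hddef]; ring
      rw [e, coeff_X_mul, hcoef i m (by omega), show r - 1 - m = D.rInf - (m + 1) by omega])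
  have hvnu : X ^ (r - 1) ∣ v - nuInfPoly D := by
    rw [X_pow_dvd_iff]
    intro m hm
    rw [coeff_sub, nuInfPoly, coeff_sum_range, if_pos hm, DeformationData.nuInfShifted, entryAt,
      dif_pos hm, hnu, coeff_neg, coeff_X_mul]
    ring
  have hucX : X ^ (r - 1) ∣ u - ∑ k ∈ Finset.Icc 1 (r - 1), C (D.cInf k) * X ^ (r - 1 - k) := by
    rw [X_pow_dvd_iff]
    intro m hm
    simp only [coeff_sub, finsetSum_coeff, coeff_C_mul, coeff_X_pow, mul_ite, mul_one, mul_zero]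
    rw [Finset.sum_eq_single (r - 1 - m)]
    · rw [if_pos (by omega), DeformationData.cInf, entryAt, dif_pos (by omega), hc, coeff_X_mul]
      simp only
      rw [show D.rInf - 1 - (r - 1 - m) = m by omega, sub_self]
    · intro k hk hne
      rw [Finset.mem_Icc] at hk
      rw [if_neg (by omega)]
    · intro hk; rw [Finset.mem_Icc] at hk; omega
  constructor
  · have h1 := (hA 0 1).sub ((HasTrunc.poly r (nuInfPoly D)).mul (hL 0 1))
    refine (h1.congr_mod ?_).congr_of_ne fun x _ => ?_
    · have e1 := modX_eq_iff.1 h01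
      have hXr : (X : ℂ[X]) ^ r = X ^ (r - 1) * X := by rw [← pow_succ, Nat.sub_add_cancel hr]
      have e2 : X ^ r ∣ (v - nuInfPoly D) * l 0 1 := by
        rw [hXr]; exact mul_dvd_mul hvnu (X_dvd_iff.2 hl01)
      have := e1.add e2
      rw [sub_zero]
      convert this using 1
      ring
    · ring
  · have h1 := (((hA 0 0).sub ((HasTrunc.poly r (nuInfPoly D)).mul (hL 0 0))).sub
      (HasTrunc.poly r (∑ k ∈ Finset.Icc 1 (r - 1), C (D.cInf k) * X ^ (r - 1 - k)))).mono
      (Nat.sub_le r 1)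
    refine (h1.congr_mod ?_).congr_of_ne fun x hx => ?_
    · have e1 := (pow_dvd_pow X (Nat.sub_le r 1)).trans (modX_eq_iff.1 h00)
      have := (e1.add (hvnu.mul_right (l 0 0))).add hucX
      rw [sub_zero]
      convert this using 1
      ring
    · simp only [eval_finsetSum, eval_mul, eval_C, eval_pow, eval_X]
      have : ∑ k ∈ Finset.Icc 1 (r - 1), D.cInf k * x ^ (r - 1 - k) =
          x ^ (r - 1) * ∑ k ∈ Finset.Icc 1 (r - 1), D.cInf k * x⁻¹ ^ k := by
        rw [Finset.mul_sum]
        refine Finset.sum_congr rfl fun k hk => ?_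
        rw [Finset.mem_Icc] at hk
        rw [pow_sub₀ x hx (by omega), inv_pow]; ring
      rw [this]; ring

end IsLaxJet

end

section

/-! ### Interpolation at the apparent singularities -/

theorem prod_inv_sub_eq {ι : Type*} (s : Finset ι) (Y : ι → ℂ) (r : ι → ℕ) {x : ℂ} (hx : x ≠ 0) :
    x ^ (∑ i ∈ s, r i) * ∏ i ∈ s, (x⁻¹ - Y i) ^ r i = ∏ i ∈ s, (1 - x * Y i) ^ r i := by
  rw [← Finset.prod_pow_eq_pow_sum, ← Finset.prod_mul_distrib]
  refine Finset.prod_congr rfl fun i _ => ?_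
  rw [← mul_pow, mul_sub, mul_inv_cancel₀ hx]

theorem isBigO_one_of_continuousAt {f : ℂ → ℂ} {a : ℂ} (hf : ContinuousAt f a) :
    f =O[𝓝[≠] a] (fun _ => (1 : ℂ)) :=
  (hf.tendsto.isBigO_one ℂ).mono nhdsWithin_le_nhds

/-- A function with poles of order at most `r_s` at the `X_s` that is `O(z^{rInf-4})` at infinity and
vanishes at `g = rInf + ∑ r_s - 3` points is zero: divide by `∏ (z - q_j) / ∏ (z - X_s)^{r_s}`. -/
theorem eq_zero_of_interpolation {n g rInf : ℕ} {r : Fin n → ℕ} {X : Fin n → ℂ} {q : Fin g → ℂ}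
    (hgenus : rInf + ∑ s, r s = g + 3) (hq : Function.Injective q) (hqX : ∀ j s, q j ≠ X s)
    {h : ℂ → ℂ} (hd : ∀ z, (∀ s, z ≠ X s) → DifferentiableAt ℂ h z) (h0 : ∀ j, h (q j) = 0)
    (hX : ∀ s, (fun x => x ^ r s * h (X s + x)) =O[𝓝[≠] (0 : ℂ)] (fun _ => (1 : ℂ)))
    (hinf : (fun x => x ^ rInf * h x⁻¹) =O[𝓝[≠] (0 : ℂ)] (fun x => x ^ 4)) :
    ∀ z, (∀ s, z ≠ X s) → h z = 0 := by
  set S : Set ℂ := Set.range X ∪ Set.range q with hS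
  -- dividing out the zeros and clearing the poles leaves a bounded function that decays like `z⁻¹`,
  -- because `rInf + ∑ r s - g = 3`
  set f : ℂ → ℂ := fun z => h z * (∏ s, (z - X s) ^ r s) * (∏ j, (z - q j))⁻¹ with hf
  have hSfin : S.Finite := (Set.finite_range X).union (Set.finite_range q)
  have hnX : ∀ z ∉ S, ∀ s, z ≠ X s := fun z hz s e => hz (Or.inl ⟨s, e.symm⟩)
  have hnq : ∀ z ∉ S, ∀ j, z ≠ q j := fun z hz s e => hz (Or.inr ⟨s, e.symm⟩)
  have hprodq : ∀ z, (∀ j, z ≠ q j) → ∏ j, (z - q j) ≠ 0 := fun z hz =>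
    Finset.prod_ne_zero_iff.2 fun j _ => sub_ne_zero.2 (hz j)
  have hprodX : ∀ z, (∀ s, z ≠ X s) → ∏ s, (z - X s) ^ r s ≠ 0 := fun z hz =>
    Finset.prod_ne_zero_iff.2 fun s _ => pow_ne_zero _ (sub_ne_zero.2 (hz s))
  have hfd : ∀ z ∉ S, DifferentiableAt ℂ f z := by
    intro z hz
    refine DifferentiableAt.mul (DifferentiableAt.mul (hd z (hnX z hz)) (by fun_prop)) ?_
    exact DifferentiableAt.inv (by fun_prop) (hprodq z (hnq z hz))
  have hfb : ∀ s ∈ S, f =O[𝓝[≠] s] (fun _ => (1 : ℂ)) := by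
    rintro _ (⟨s, rfl⟩ | ⟨j, rfl⟩)
    · rw [← isBigO_shift]
      have hc : ContinuousAt (fun x => (∏ s' ∈ Finset.univ.erase s, (X s + x - X s') ^ r s')
          * (∏ j, (X s + x - q j))⁻¹) 0 := by
        refine ContinuousAt.mul (by fun_prop) (ContinuousAt.inv₀ (by fun_prop) ?_)
        rw [add_zero]
        exact hprodq _ fun j => (hqX j s).symm
      refine ((hX s).mul (isBigO_one_of_continuousAt hc)).congr (fun x => ?_) (fun x => one_mul _)
      rw [hf]
      simp only
      rw [← Finset.mul_prod_erase _ _ (Finset.mem_univ s), add_sub_cancel_left]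
      ring
    · have h1 : h =O[𝓝[≠] (q j)] (fun z => z - q j) := by
        have := (hd (q j) (hqX j)).isBigO_sub
        simpa [h0 j] using this.mono nhdsWithin_le_nhds
      have hc : ContinuousAt (fun z => (∏ s, (z - X s) ^ r s)
          * (∏ i ∈ Finset.univ.erase j, (z - q i))⁻¹) (q j) := by
        refine ContinuousAt.mul (by fun_prop) (ContinuousAt.inv₀ (by fun_prop) ?_)
        exact Finset.prod_ne_zero_iff.2 fun i hi =>
          sub_ne_zero.2 (hq.ne (Finset.ne_of_mem_erase hi).symm)
      have h2 := (h1.mul (isBigO_one_of_continuousAt hc)).mul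
        (isBigO_refl (fun z => (z - q j)⁻¹) (𝓝[≠] (q j)))
      refine h2.congr' ?_ ?_
      · filter_upwards with z
        rw [hf]
        simp only
        rw [← Finset.mul_prod_erase _ _ (Finset.mem_univ j), mul_inv]
        ring
      · filter_upwards [self_mem_nhdsWithin] with z hz
        rw [mul_one, mul_inv_cancel₀ (sub_ne_zero.2 hz)]
  have hfinf : f =O[Bornology.cobounded ℂ] (fun z => z⁻¹) := by
    rw [← isBigO_inv]
    have hc : ContinuousAt (fun x => (∏ s, (1 - x * X s) ^ r s) * (∏ j, (1 - x * q j) ^ 1)⁻¹) 0 := by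
      refine ContinuousAt.mul (by fun_prop) (ContinuousAt.inv₀ (by fun_prop) ?_)
      simp
    have h2 := (hinf.mul (isBigO_one_of_continuousAt hc)).mul
        (isBigO_refl (fun x : ℂ => (x ^ 3)⁻¹) (𝓝[≠] 0))
    refine h2.congr' ?_ ?_
    · filter_upwards [self_mem_nhdsWithin] with x hx
      have hx : x ≠ 0 := hx
      rw [← prod_inv_sub_eq _ _ _ hx, ← prod_inv_sub_eq _ _ _ hx, hf]
      simp only [pow_one, Finset.sum_const, Finset.card_univ, Fintype.card_fin, smul_eq_mul, mul_one]
      have e : x ^ rInf * x ^ (∑ s, r s) = x ^ g * x ^ 3 := by rw [← pow_add, ← pow_add, hgenus]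
      rw [mul_inv]
      have hxg : x ^ g ≠ 0 := pow_ne_zero _ hx
      generalize (∏ j, (x⁻¹ - q j))⁻¹ = Q
      generalize ∏ s, (x⁻¹ - X s) ^ r s = P
      generalize h x⁻¹ = H
      field_simp
      linear_combination H * P * Q * e
    · filter_upwards [self_mem_nhdsWithin] with x hx
      have hx : x ≠ 0 := hx
      rw [inv_inv]
      field_simp
  have hf0 := eq_zero_of_tendsto_zero hSfin hfd hfb (hfinf.trans_tendsto tendsto_inv₀_cobounded)
  intro z hz
  by_cases hzq : ∃ j, z = q j
  · obtain ⟨j, rfl⟩ := hzq; exact h0 j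
  · push Not at hzq
    have h1 := hf0 z (by rintro (⟨s, hs⟩ | ⟨j, hj⟩); exacts [hz s hs.symm, hzq j hj.symm])
    simp only [hf, mul_eq_zero, inv_eq_zero] at h1
    rcases h1 with (h1 | h1) | h1
    · exact h1
    · exact absurd h1 (hprodX z hz)
    · exact absurd h1 (hprodq z hzq)

/-- Uniqueness of partial fraction expansions. -/
theorem ratFn_eq_zero {n : ℕ} {N : ℕ} {r : Fin n → ℕ} {X : Fin n → ℂ}
    (hX : Function.Injective X) {c : ℕ → ℂ} {b : Fin n → ℕ → ℂ}
    (h : ∀ z, (∀ s, z ≠ X s) → ratFn N r X c b z = 0) :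
    (∀ k < N, c k = 0) ∧ ∀ s, ∀ k < r s, b s k = 0 := by
  constructor
  · intro k hk
    have h1 := (hasTrunc_ratFn_inv N r X c b).congr' (g := fun _ => 0) (by
      filter_upwards [IsLaxJet.eventually_off_poles_inv X] with x hx
      rw [h _ hx, mul_zero])
    have h2 := X_pow_dvd_iff.1 h1.dvd (N - k) (by omega)
    rw [show (Polynomial.X : ℂ[X]) ^ N * (C (polarMoment₀ r b) * Polynomial.X
      + C (polarMoment₁ r X b) * Polynomial.X ^ 2) = Polynomial.X ^ (N + 1) *
        (C (polarMoment₀ r b) + C (polarMoment₁ r X b) * Polynomial.X) by ring] at h2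
    simp only [coeff_add, finsetSum_coeff, coeff_C_mul, coeff_X_pow, coeff_X_pow_mul', mul_ite,
      mul_one, mul_zero] at h2
    rw [if_neg (show ¬ N + 1 ≤ N - k by omega), add_zero, Finset.sum_eq_single k] at h2
    · simpa using h2
    · intro k' hk' hne
      rw [Finset.mem_range] at hk'
      rw [if_neg (show ¬ N - k = N - k' by omega)]
    · intro hk'; rw [Finset.mem_range] at hk'; omega
  · intro s k hk
    have h1 := (hasTrunc_ratFn N r c b hX s).congr' (g := fun _ => 0) (by
      have : ∀ᶠ x in 𝓝[≠] (0 : ℂ), ∀ s', X s + x ≠ X s' := by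
        refine eventually_all.2 fun s' => ?_
        by_cases hs : s' = s
        · subst hs
          filter_upwards [self_mem_nhdsWithin] with x hx
          have hx : x ≠ 0 := hx
          simpa using hx
        · have hc : ContinuousAt (fun x : ℂ => X s + x) 0 := by fun_prop
          refine (hc.eventually_ne ?_).filter_mono nhdsWithin_le_nhds
          simpa using hX.ne (Ne.symm hs)
      filter_upwards [this] with x hx
      rw [h _ hx, mul_zero])
    have h2 := X_pow_dvd_iff.1 h1.dvd (r s - 1 - k) (by omega)
    rw [coeff_polarPoly, if_pos (by omega), show r s - 1 - (r s - 1 - k) = k by omega] at h2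
    exact h2

/-- A sum of polar parts and of a polynomial of degree at most `rInf - 4` is `O(z^{rInf-4})` at infinity,
provided that its moments vanish when `rInf ≤ 2`. -/
theorem isBigO_ratFn_inv {n rInf : ℕ} (hR : 1 ≤ rInf) (r : Fin n → ℕ) (Y : Fin n → ℂ) (c : ℕ → ℂ)
    (b : Fin n → ℕ → ℂ) (h0 : rInf ≤ 2 → polarMoment₀ r b = 0)
    (h1 : rInf = 1 → polarMoment₁ r Y b = 0) :
    (fun x => x ^ rInf * ratFn (rInf - 3) r Y c b x⁻¹) =O[𝓝[≠] (0 : ℂ)] (fun x => x ^ 4) := by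
  have h := hasTrunc_ratFn_inv (rInf - 3) r Y c b
  rcases Nat.lt_or_ge 2 rInf with h3 | h3
  · have h := (h.mono (M := 1) (by omega)).pow_mul 3
    refine (h.isBigO_of_dvd ?_).congr_left fun x => ?_
    · rw [show 1 + 3 = 3 + 1 by norm_num, pow_succ]
      refine mul_dvd_mul_left _ (dvd_add (Finset.dvd_sum fun k hk => ?_) ?_)
      · rw [Finset.mem_range] at hk
        exact (dvd_pow_self X (show rInf - 3 - k ≠ 0 by omega)).mul_left _
      · exact ⟨X ^ (rInf - 3) * (C (polarMoment₀ r b) + C (polarMoment₁ r Y b) * X), by ring⟩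
    · rw [← mul_assoc, ← pow_add, show 3 + (rInf - 3) = rInf by omega]
  · rw [show rInf - 3 = 0 by omega, h0 h3] at h
    simp only [Finset.range_zero, Finset.sum_empty, zero_add, pow_zero, one_mul, map_zero,
      zero_mul] at h
    rw [show rInf - 3 = 0 by omega]
    rcases Nat.lt_or_ge 1 rInf with h2 | h2
    · obtain rfl : rInf = 2 := by omega
      refine ((h.mono (M := 2) (by omega)).pow_mul 2).isBigO_of_dvd ?_
      exact ⟨C (polarMoment₁ r Y b), by ring⟩
    · obtain rfl : rInf = 1 := by omega
      rw [h1 rfl] at h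
      refine (h.pow_mul 1).isBigO_of_dvd ?_
      simp

end

section

/-! ### The linear systems for the `μ_j` and for the isospectral coefficients -/

variable {n g : ℕ}

theorem entryAt_add {m : ℕ} (v w : Fin m → ℂ) (k : ℕ) :
    entryAt (v + w) k = entryAt v k + entryAt w k := by
  unfold entryAt; split <;> simp

theorem entryAt_smul {m : ℕ} (a : ℂ) (v : Fin m → ℂ) (k : ℕ) :
    entryAt (a • v) k = a * entryAt v k := by
  unfold entryAt; split <;> simp

theorem entryAt_coe {m : ℕ} (v : Fin m → ℂ) (k : Fin m) : entryAt v k = v k := by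
  simp [entryAt]

theorem sum_range_entryAt {m : ℕ} (v : Fin m → ℂ) (f : ℕ → ℂ) :
    ∑ k ∈ Finset.range m, entryAt v k * f k = ∑ k : Fin m, v k * f k := by
  rw [← Fin.sum_univ_eq_sum_range (fun k => entryAt v k * f k)]
  simp only [entryAt_coe]

theorem sum_range_entryAt_le {m N : ℕ} (v : Fin m → ℂ) (f : ℕ → ℂ) (h : m ≤ N) :
    ∑ k ∈ Finset.range N, entryAt v k * f k = ∑ k : Fin m, v k * f k := by
  rw [← sum_range_entryAt]
  refine (Finset.sum_subset (Finset.range_mono h) fun k _ hk => ?_).symm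
  rw [Finset.mem_range] at hk
  simp [entryAt, hk]

/-- The rational function `∑ H_{∞,k} z^k + ∑ H_{X_s,k} (z - X_s)^{-k}` of given isospectral
coefficients. -/
noncomputable def evalH (D : DeformationData n) (h : D.HType) : ℂ → ℂ :=
  ratFn (D.rInf - 3) D.r D.X (entryAt h.1) (fun s => entryAt (h.2 s))

theorem evalH_apply (D : DeformationData n) (h : D.HType) (z : ℂ) :
    evalH D h z = ∑ k, h.1 k * z ^ (k : ℕ) + ∑ s, ∑ k, h.2 s k / (z - D.X s) ^ ((k : ℕ) + 1) := by
  simp only [evalH, ratFn, div_eq_mul_inv]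
  rw [sum_range_entryAt h.1 (fun k => z ^ k)]
  congr 1
  exact Finset.sum_congr rfl fun s _ =>
    sum_range_entryAt (h.2 s) (fun k => ((z - D.X s) ^ (k + 1))⁻¹)

theorem evalH_add (D : DeformationData n) (h h' : D.HType) (z : ℂ) :
    evalH D (h + h') z = evalH D h z + evalH D h' z := by
  simp only [evalH, ratFn, Prod.fst_add, Prod.snd_add, Pi.add_apply, entryAt_add, add_mul,
    Finset.sum_add_distrib]
  ring

theorem evalH_smul (D : DeformationData n) (a : ℂ) (h : D.HType) (z : ℂ) :
    evalH D (a • h) z = a * evalH D h z := by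
  simp only [evalH, ratFn, Prod.smul_fst, Prod.smul_snd, Pi.smul_apply, entryAt_smul, mul_assoc,
    mul_add, Finset.mul_sum]

/-- The coefficient of `1/z` of `evalH` at infinity, up to the polynomial part. -/
noncomputable def residueSum (D : DeformationData n) (h : D.HType) : ℂ :=
  polarMoment₀ D.r (fun s => entryAt (h.2 s))

/-- The coefficient of `1/z²` of `evalH` at infinity. -/
noncomputable def secondMoment (D : DeformationData n) (h : D.HType) : ℂ :=
  polarMoment₁ D.r D.X (fun s => entryAt (h.2 s))

theorem residueSum_eq (D : DeformationData n) (h : D.HType) :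
    residueSum D h = ∑ s, entryAt (h.2 s) 0 := by
  rw [residueSum, polarMoment₀]
  refine Finset.sum_congr rfl fun s _ => ?_
  simp only [ite_eq_left_iff, entryAt]
  intro h; rw [dif_neg h]

theorem secondMoment_eq (D : DeformationData n) (h : D.HType) :
    secondMoment D h = ∑ s, D.X s * entryAt (h.2 s) 0
      + ∑ s, if 2 ≤ D.r s then entryAt (h.2 s) 1 else 0 := by
  rw [secondMoment, polarMoment₁, ← Finset.sum_add_distrib]
  refine Finset.sum_congr rfl fun s _ => ?_
  have : (if 0 < D.r s then entryAt (h.2 s) 0 else 0) = entryAt (h.2 s) 0 := by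
    simp only [ite_eq_left_iff, entryAt]
    intro h; rw [dif_neg h]
  rcases Nat.lt_or_ge (D.r s) 2 with h2 | h2
  · rw [if_neg (show ¬ 2 ≤ D.r s by omega)]
    rcases Nat.lt_or_ge 0 (D.r s) with h1 | h1
    · simp [h1, show ¬ 1 < D.r s by omega]
    · simp [entryAt, show D.r s = 0 by omega]
  · simp [show 0 < D.r s by omega, show 1 < D.r s by omega, h2]
    ring


theorem residueSum_add (D : DeformationData n) (h h' : D.HType) :
    residueSum D (h + h') = residueSum D h + residueSum D h' := by
  simp only [residueSum_eq, Prod.snd_add, Pi.add_apply, entryAt_add, Finset.sum_add_distrib]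

theorem residueSum_smul (D : DeformationData n) (a : ℂ) (h : D.HType) :
    residueSum D (a • h) = a * residueSum D h := by
  simp only [residueSum_eq, Prod.smul_snd, Pi.smul_apply, entryAt_smul, Finset.mul_sum]

theorem secondMoment_add (D : DeformationData n) (h h' : D.HType) :
    secondMoment D (h + h') = secondMoment D h + secondMoment D h' := by
  simp only [secondMoment_eq, Prod.snd_add, Pi.add_apply, entryAt_add, mul_add,
    ite_add_zero, Finset.sum_add_distrib]
  ring

theorem secondMoment_smul (D : DeformationData n) (a : ℂ) (h : D.HType) :
    secondMoment D (a • h) = a * secondMoment D h := by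
  simp only [secondMoment_eq, Prod.smul_snd, Pi.smul_apply, entryAt_smul, mul_add, Finset.mul_sum,
    mul_ite, mul_zero]
  congr 1
  exact Finset.sum_congr rfl fun s _ => by ring

/-- The isospectral coefficients together with `min 2 (rInf - 1)` auxiliary unknowns, which make the
linear systems square and uniform in `rInf`. -/
abbrev AugmentedH (D : DeformationData n) : Type :=
  D.HType × (Fin (min 2 (D.rInf - 1)) → ℂ)

/-- Evaluation of isospectral coefficients at the points `q_j`, together with their conditions at
infinity; the auxiliary unknowns absorb those conditions that are void when `rInf ≥ 2`. -/
noncomputable def evalMap (D : DeformationData n) (q : Fin g → ℂ) :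
    AugmentedH D →ₗ[ℂ] ℂ × ℂ × (Fin g → ℂ) where
  toFun w := (entryAt w.2 0 - secondMoment D w.1, entryAt w.2 1 - residueSum D w.1,
    fun j => evalH D w.1 (q j))
  map_add' w w' := by
    ext j
    · simp only [Prod.fst_add, Prod.snd_add, entryAt_add, secondMoment_add]; ring
    · simp only [Prod.fst_add, Prod.snd_add, entryAt_add, residueSum_add]; ring
    · simp only [Prod.fst_add, Prod.snd_add, evalH_add, Pi.add_apply]
  map_smul' a w := by
    ext j
    · simp only [Prod.smul_fst, Prod.smul_snd, entryAt_smul, secondMoment_smul, RingHom.id_apply,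
        smul_eq_mul]; ring
    · simp only [Prod.smul_fst, Prod.smul_snd, entryAt_smul, residueSum_smul, RingHom.id_apply,
        smul_eq_mul]; ring
    · simp only [Prod.smul_fst, Prod.smul_snd, evalH_smul, RingHom.id_apply, Pi.smul_apply,
        smul_eq_mul]

/-- The matrix of the linear system for `(ν_{∞,-1}, ν_{∞,0}, μ)`; it is the transpose of `evalMap`. -/
noncomputable def momentMap (D : DeformationData n) (q : Fin g → ℂ) :
    ℂ × ℂ × (Fin g → ℂ) →ₗ[ℂ] AugmentedH D where
  toFun y := ((fun k => ∑ j, y.2.2 j * q j ^ (k : ℕ), fun s k =>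
      ∑ j, y.2.2 j * ((q j - D.X s) ^ ((k : ℕ) + 1))⁻¹
        - (if (k : ℕ) = 0 then y.2.1 + y.1 * D.X s else 0) - (if (k : ℕ) = 1 then y.1 else 0)),
    fun e => if (e : ℕ) = 0 then y.1 else y.2.1)
  map_add' y y' := by
    ext
    · simp only [Prod.fst_add, Prod.snd_add, Pi.add_apply, add_mul, Finset.sum_add_distrib]
    · simp only [Prod.fst_add, Prod.snd_add, Pi.add_apply, add_mul, Finset.sum_add_distrib]
      split_ifs <;> ring
    · simp only [Prod.fst_add, Prod.snd_add, Pi.add_apply]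
      split_ifs <;> rfl
  map_smul' a y := by
    ext
    · simp only [Prod.smul_fst, Prod.smul_snd, Pi.smul_apply, smul_eq_mul, RingHom.id_apply,
        Finset.mul_sum, mul_assoc]
    · simp only [Prod.smul_fst, Prod.smul_snd, Pi.smul_apply, smul_eq_mul, RingHom.id_apply,
        mul_sub, Finset.mul_sum, mul_assoc]
      split_ifs <;> ring
    · simp only [Prod.smul_fst, Prod.smul_snd, Pi.smul_apply, smul_eq_mul, RingHom.id_apply]
      split_ifs <;> rfl

theorem sum_mul_ratFn (N : ℕ) (r : Fin n → ℕ) (Y : Fin n → ℂ) (c : ℕ → ℂ) (b : Fin n → ℕ → ℂ)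
    (q μ : Fin g → ℂ) :
    ∑ j, μ j * ratFn N r Y c b (q j) = ∑ k ∈ Finset.range N, c k * ∑ j, μ j * q j ^ k
      + ∑ s, ∑ k ∈ Finset.range (r s), b s k * ∑ j, μ j * ((q j - Y s) ^ (k + 1))⁻¹ := by
  simp only [ratFn, mul_add, Finset.sum_add_distrib, Finset.mul_sum]
  congr 1
  · rw [Finset.sum_comm]
    exact Finset.sum_congr rfl fun _ _ => Finset.sum_congr rfl fun _ _ => by ring
  · rw [Finset.sum_comm]
    refine Finset.sum_congr rfl fun _ _ => ?_
    rw [Finset.sum_comm]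
    exact Finset.sum_congr rfl fun _ _ => Finset.sum_congr rfl fun _ _ => by ring

theorem sum_mul_moments (r : Fin n → ℕ) (Y : Fin n → ℂ) (b : Fin n → ℕ → ℂ) (y₁ y₂ : ℂ) :
    ∑ s, ∑ k ∈ Finset.range (r s), b s k *
      ((if k = 0 then y₂ + y₁ * Y s else 0) + (if k = 1 then y₁ else 0)) =
      y₂ * polarMoment₀ r b + y₁ * polarMoment₁ r Y b := by
  simp only [polarMoment₀, polarMoment₁, Finset.mul_sum, ← Finset.sum_add_distrib]
  refine Finset.sum_congr rfl fun s _ => ?_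
  simp only [mul_add, mul_ite, mul_zero, Finset.sum_add_distrib, Finset.sum_ite_eq',
    Finset.mem_range]
  split_ifs <;> ring

/-- `momentMap` is the transpose of `evalMap`. -/
theorem evalMap_momentMap_pairing (D : DeformationData n) (q : Fin g → ℂ) (w : AugmentedH D)
    (y : ℂ × ℂ × (Fin g → ℂ)) :
    (evalMap D q w).1 * y.1 + (evalMap D q w).2.1 * y.2.1 + ∑ j, y.2.2 j * (evalMap D q w).2.2 j =
      ∑ k, w.1.1 k * (momentMap D q y).1.1 k + ∑ s, ∑ k, w.1.2 s k * (momentMap D q y).1.2 s k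
        + ∑ e, w.2 e * (momentMap D q y).2 e := by
  have h1 : ∑ k, w.1.1 k * (momentMap D q y).1.1 k =
      ∑ k ∈ Finset.range (D.rInf - 3), entryAt w.1.1 k * ∑ j, y.2.2 j * q j ^ k :=
    (sum_range_entryAt w.1.1 (fun k => ∑ j, y.2.2 j * q j ^ k)).symm
  have h2 : ∀ s, ∑ k, w.1.2 s k * (momentMap D q y).1.2 s k =
      ∑ k ∈ Finset.range (D.r s), entryAt (w.1.2 s) k *
        (∑ j, y.2.2 j * ((q j - D.X s) ^ (k + 1))⁻¹
          - (if k = 0 then y.2.1 + y.1 * D.X s else 0) - (if k = 1 then y.1 else 0)) := fun s =>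
    (sum_range_entryAt (w.1.2 s) (fun k => ∑ j, y.2.2 j * ((q j - D.X s) ^ (k + 1))⁻¹
          - (if k = 0 then y.2.1 + y.1 * D.X s else 0) - (if k = 1 then y.1 else 0))).symm
  have h3 : ∑ e, w.2 e * (momentMap D q y).2 e = entryAt w.2 0 * y.1 + entryAt w.2 1 * y.2.1 := by
    have := sum_range_entryAt_le w.2 (fun e => if e = 0 then y.1 else y.2.1) (min_le_left _ _)
    rw [Finset.sum_range_succ, Finset.sum_range_one] at this
    rw [if_pos rfl, if_neg one_ne_zero] at this
    exact this.symm
  have h4 := sum_mul_moments D.r D.X (fun s => entryAt (w.1.2 s)) y.1 y.2.1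
  have h5 := sum_mul_ratFn (D.rInf - 3) D.r D.X (entryAt w.1.1) (fun s => entryAt (w.1.2 s)) q y.2.2
  rw [h1, h3, Finset.sum_congr rfl fun s _ => h2 s]
  simp only [evalMap, LinearMap.coe_mk, AddHom.coe_mk, evalH, h5, residueSum, secondMoment]
  simp only [sub_sub, mul_sub (_ : ℂ) (Finset.sum _ _), Finset.sum_sub_distrib, h4]
  ring

/-- The systems are square because the genus is `rInf + ∑ r_s - 3`. -/
theorem finrank_augmentedH (D : DeformationData n) (hR : 1 ≤ D.rInf)
    (hgenus : D.rInf + ∑ s, D.r s = g + 3) :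
    Module.finrank ℂ (AugmentedH D) = Module.finrank ℂ (ℂ × ℂ × (Fin g → ℂ)) := by
  simp only [Module.finrank_prod, Module.finrank_pi_fintype, Module.finrank_self, Finset.sum_const,
    Finset.card_univ, Fintype.card_fin, smul_eq_mul, mul_one]
  omega

/-- A solution of the homogeneous system is a rational function vanishing at the `g` points `q_j`, with
too few poles for that unless it is zero. -/
theorem evalMap_injective (D : DeformationData n) (hR : 1 ≤ D.rInf)
    (hX : Function.Injective D.X) (hgenus : D.rInf + ∑ s, D.r s = g + 3) {q : Fin g → ℂ}
    (hq : Function.Injective q) (hqX : ∀ j s, q j ≠ D.X s) :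
    Function.Injective (evalMap D q) := by
  rw [injective_iff_map_eq_zero]
  intro w hw
  have e1 : entryAt w.2 0 - secondMoment D w.1 = 0 := congrArg Prod.fst hw
  have e2 : entryAt w.2 1 - residueSum D w.1 = 0 := congrArg (fun x => x.2.1) hw
  have e3 : ∀ j, evalH D w.1 (q j) = 0 := fun j => congrFun (congrArg (fun x => x.2.2) hw) j
  have hz : ∀ z, (∀ s, z ≠ D.X s) → evalH D w.1 z = 0 := by
    refine eq_zero_of_interpolation (r := D.r) hgenus hq hqX
      (fun z hz => differentiableAt_ratFn _ _ _ _ _ hz) e3 (fun s => ?_) ?_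
    · exact (hasTrunc_ratFn (D.rInf - 3) D.r _ _ hX s).isBigO_one
    · refine isBigO_ratFn_inv hR _ _ _ _ (fun h => ?_) fun h => ?_
      · have : entryAt w.2 1 = 0 := by
          rw [entryAt, dif_neg]; simp only [lt_min_iff]; omega
        rw [this, zero_sub, neg_eq_zero] at e2
        exact e2
      · have : entryAt w.2 0 = 0 := by
          rw [entryAt, dif_neg]; simp only [lt_min_iff]; omega
        rw [this, zero_sub, neg_eq_zero] at e1
        exact e1
  obtain ⟨h1, h2⟩ := ratFn_eq_zero hX hz
  have hw1 : w.1 = 0 := by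
    refine Prod.ext (funext fun k => ?_) (funext fun s => funext fun k => ?_)
    · rw [← entryAt_coe w.1.1]; exact h1 k k.2
    · rw [← entryAt_coe (w.1.2 s)]; exact h2 s k k.2
  have m1 : secondMoment D w.1 = 0 := by
    rw [hw1]; simpa using secondMoment_smul D 0 (0 : D.HType)
  have m0 : residueSum D w.1 = 0 := by
    rw [hw1]; simpa using residueSum_smul D 0 (0 : D.HType)
  rw [m1, sub_zero] at e1
  rw [m0, sub_zero] at e2
  refine Prod.ext hw1 (funext fun e => ?_)
  rw [← entryAt_coe w.2]
  have : (e : ℕ) < 2 := lt_of_lt_of_le e.2 (min_le_left _ _)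
  interval_cases h : (e : ℕ)
  · exact e1
  · exact e2

theorem evalMap_bijective (D : DeformationData n) (hR : 1 ≤ D.rInf)
    (hX : Function.Injective D.X) (hgenus : D.rInf + ∑ s, D.r s = g + 3) {q : Fin g → ℂ}
    (hq : Function.Injective q) (hqX : ∀ j s, q j ≠ D.X s) :
    Function.Bijective (evalMap D q) := by
  have h := evalMap_injective D hR hX hgenus hq hqX
  exact ⟨h, (LinearMap.injective_iff_surjective_of_finrank_eq_finrank
    (finrank_augmentedH D hR hgenus)).1 h⟩

/-- The linear system for `μ` is solvable since it is the transpose of the one for the isospectral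
coefficients. -/
theorem momentMap_bijective (D : DeformationData n) (hR : 1 ≤ D.rInf)
    (hX : Function.Injective D.X) (hgenus : D.rInf + ∑ s, D.r s = g + 3) {q : Fin g → ℂ}
    (hq : Function.Injective q) (hqX : ∀ j s, q j ≠ D.X s) :
    Function.Bijective (momentMap D q) := by
  have h : Function.Injective (momentMap D q) := by
    rw [injective_iff_map_eq_zero]
    intro y hy
    -- everything in the range of `evalMap`, that is every vector, is orthogonal to `y`
    have key : ∀ v : ℂ × ℂ × (Fin g → ℂ), v.1 * y.1 + v.2.1 * y.2.1 + ∑ j, y.2.2 j * v.2.2 j = 0 := by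
      intro v
      obtain ⟨w, rfl⟩ := (evalMap_bijective D hR hX hgenus hq hqX).2 v
      rw [evalMap_momentMap_pairing, hy]
      simp
    ext j
    · simpa using key (1, 0, 0)
    · simpa using key (0, 1, 0)
    · simpa [Pi.single_apply] using key (0, 0, Pi.single j 1)
  exact ⟨h, (LinearMap.injective_iff_surjective_of_finrank_eq_finrank
    (finrank_augmentedH D hR hgenus).symm).1 h⟩

/-- The right-hand side of the linear system for `(ν_{∞,-1}, ν_{∞,0}, μ)`. -/
noncomputable def momentTarget (D : DeformationData n) : AugmentedH D :=
  ((fun k => D.nuInfShifted ((k : ℕ) + 2), fun s k => -D.nuX s k), fun e => D.nuInfShifted e)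

theorem isNuMu_iff (D : DeformationData n) (q : Fin g → ℂ) (y : ℂ × ℂ × (Fin g → ℂ)) :
    D.IsNuMu q y ↔ momentMap D q y = momentTarget D := by
  constructor
  · rintro ⟨h1, h2, h3, h4⟩
    refine Prod.ext (Prod.ext (funext fun k => ?_) (funext fun s => funext fun k => ?_))
      (funext fun k => ?_)
    · have := h3 (k + 1) (by rw [Finset.mem_Icc]; omega)
      simpa [momentMap, momentTarget] using this
    · have := h4 s k (Finset.mem_range.2 k.2)
      simp only [momentMap, momentTarget, LinearMap.coe_mk, AddHom.coe_mk]
      simp only [div_eq_mul_inv] at this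
      rw [this]; ring
    · have hk := k.2
      simp only [lt_min_iff] at hk
      simp only [momentMap, momentTarget, LinearMap.coe_mk, AddHom.coe_mk]
      split_ifs with h0
      · rw [h0]; exact h1 (by omega)
      · rw [show (k : ℕ) = 1 by omega]; exact h2 (by omega)
  · intro h
    have e1 : ∀ k, (momentMap D q y).1.1 k = (momentTarget D).1.1 k := fun k => by rw [h]
    have e2 : ∀ s k, (momentMap D q y).1.2 s k = (momentTarget D).1.2 s k := fun s k => by rw [h]
    have e3 : ∀ e, (momentMap D q y).2 e = (momentTarget D).2 e := fun e => by rw [h]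
    simp only [momentMap, momentTarget, LinearMap.coe_mk, AddHom.coe_mk] at e1 e2 e3
    refine ⟨fun hr => ?_, fun hr => ?_, fun k hk => ?_, fun s k hk => ?_⟩
    · simpa using e3 ⟨0, by rw [lt_min_iff]; omega⟩
    · simpa using e3 ⟨1, by rw [lt_min_iff]; omega⟩
    · rw [Finset.mem_Icc] at hk
      have := e1 ⟨k - 1, by omega⟩
      simp only [show k - 1 + 2 = k + 1 by omega] at this
      exact this
    · rw [Finset.mem_range] at hk
      have := e2 s ⟨k, hk⟩
      simp only [div_eq_mul_inv]
      simp only at this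
      rw [← this]; ring

theorem existsUnique_isNuMu (D : DeformationData n) (hR : 1 ≤ D.rInf)
    (hX : Function.Injective D.X) (hgenus : D.rInf + ∑ s, D.r s = g + 3) {q : Fin g → ℂ}
    (hq : Function.Injective q) (hqX : ∀ j s, q j ≠ D.X s) : ∃! y, D.IsNuMu q y := by
  simp only [isNuMu_iff]
  exact (momentMap_bijective D hR hX hgenus hq hqX).existsUnique _

theorem isNuMu_nuMu (D : DeformationData n) (hR : 1 ≤ D.rInf)
    (hX : Function.Injective D.X) (hgenus : D.rInf + ∑ s, D.r s = g + 3) {q : Fin g → ℂ}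
    (hq : Function.Injective q) (hqX : ∀ j s, q j ≠ D.X s) : D.IsNuMu q (D.nuMu q) :=
  Classical.epsilon_spec (existsUnique_isNuMu D hR hX hgenus hq hqX).exists

/-- The right-hand side of the equation for the isospectral coefficients at `q_j`. -/
noncomputable def hTarget (D : DeformationData n) (q p : Fin g → ℂ) (j : Fin g) : ℂ :=
  p j ^ 2 - D.P1 (q j) * p j + p j * ∑ s, D.hbar * D.r s / (q j - D.X s) + D.P2tilde (q j)
      + D.hbar * ∑ i ∈ Finset.univ.erase j, (p i - p j) / (q j - q i)
      + if 3 ≤ D.rInf then D.hbar * D.tInf 0 (D.rInf - 1) * q j ^ (D.rInf - 3) else 0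

/-- The constant in the condition on `∑_s H_{X_s,1}`, which is imposed for `rInf ≤ 2`. -/
noncomputable def residueShift (D : DeformationData n) : ℂ :=
  if D.rInf = 2 then
    -(D.tInf 0 1 * D.tInf 1 0 + D.tInf 1 1 * D.tInf 0 0 + D.hbar * D.tInf 0 1) else 0

/-- The constant in the condition on `∑_s (X_s H_{X_s,1} + H_{X_s,2})`, which is imposed for
`rInf = 1`. -/
noncomputable def secondMomentShift (D : DeformationData n) : ℂ :=
  if D.rInf = 1 then (∑ s, if D.r s = 1 then D.tX s 0 0 * D.tX s 1 0 else 0)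
        - D.tInf 0 0 * (D.tInf 1 0 + D.hbar) else 0

/-- Right-hand side of the condition on `∑_s H_{X_s,1}`. -/
noncomputable def residueTarget (D : DeformationData n) (p : Fin g → ℂ) : ℂ :=
  D.hbar * ∑ j, p j + residueShift D

/-- Right-hand side of the condition on `∑_s (X_s H_{X_s,1} + H_{X_s,2})`. -/
noncomputable def secondMomentTarget (D : DeformationData n) (q p : Fin g → ℂ) : ℂ :=
  D.hbar * ∑ j, q j * p j + secondMomentShift D

/-- The linear system for the isospectral coefficients, as an interpolation problem for the rational
function `evalH`. -/
theorem isH_iff (D : DeformationData n) (hR : 1 ≤ D.rInf) (q p : Fin g → ℂ) (h : D.HType) :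
    D.IsH q p h ↔ (∀ j, evalH D h (q j) = hTarget D q p j) ∧
      (D.rInf ≤ 2 → residueSum D h = residueTarget D p) ∧
      (D.rInf = 1 → secondMoment D h = secondMomentTarget D q p) := by
  simp only [DeformationData.IsH, evalH_apply, hTarget, residueTarget, secondMomentTarget,
    residueShift, secondMomentShift, ← residueSum_eq, ← secondMoment_eq]
  refine and_congr_right fun _ => ?_
  rcases Nat.lt_trichotomy D.rInf 2 with h2 | h2 | h2
  · have : D.rInf = 1 := by omega
    simp [this, add_sub_assoc]
  · simp [h2, sub_eq_add_neg]
  · simp [show D.rInf ≠ 2 by omega, show D.rInf ≠ 1 by omega, show ¬ D.rInf ≤ 2 by omega]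

/-- The isospectral coefficients are the first components of the solutions of the augmented system. -/
theorem isH_iff_exists (D : DeformationData n) (hR : 1 ≤ D.rInf) (q p : Fin g → ℂ) (h : D.HType) :
    D.IsH q p h ↔ ∃ e, evalMap D q (h, e) = (if D.rInf = 1 then -secondMomentTarget D q p else 0,
      if D.rInf ≤ 2 then -residueTarget D p else 0, hTarget D q p) := by
  rw [isH_iff D hR]
  constructor
  · rintro ⟨h1, h2, h3⟩
    refine ⟨fun e => if (e : ℕ) = 0 then secondMoment D h else residueSum D h, ?_⟩
    refine Prod.ext ?_ (Prod.ext ?_ (funext h1))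
    · simp only [evalMap, LinearMap.coe_mk, AddHom.coe_mk, entryAt, lt_min_iff]
      by_cases hb : D.rInf = 1
      · rw [dif_neg (by omega), if_pos hb, h3 hb, zero_sub]
      · rw [dif_pos (by omega), if_neg hb, if_pos trivial, sub_self]
    · simp only [evalMap, LinearMap.coe_mk, AddHom.coe_mk, entryAt, lt_min_iff]
      by_cases hb : D.rInf ≤ 2
      · rw [dif_neg (by omega), if_pos hb, h2 hb, zero_sub]
      · rw [dif_pos (by omega), if_neg hb, if_neg one_ne_zero, sub_self]
  · rintro ⟨e, he⟩
    have e1 : entryAt e 0 - secondMoment D h = if D.rInf = 1 then -secondMomentTarget D q p else 0 :=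
      congrArg Prod.fst he
    have e2 : entryAt e 1 - residueSum D h = if D.rInf ≤ 2 then -residueTarget D p else 0 :=
      congrArg (fun x => x.2.1) he
    refine ⟨fun j => congrFun (congrArg (fun x => x.2.2) he) j, fun hr => ?_, fun hr => ?_⟩
    · rw [if_pos hr, entryAt, dif_neg (by rw [lt_min_iff]; omega)] at e2
      linear_combination -e2
    · rw [if_pos hr, entryAt, dif_neg (by rw [lt_min_iff]; omega)] at e1
      linear_combination -e1

theorem existsUnique_isH (D : DeformationData n) (hR : 1 ≤ D.rInf)
    (hX : Function.Injective D.X) (hgenus : D.rInf + ∑ s, D.r s = g + 3) {q : Fin g → ℂ}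
    (hq : Function.Injective q) (hqX : ∀ j s, q j ≠ D.X s) (p : Fin g → ℂ) :
    ∃! h, D.IsH q p h := by
  simp only [isH_iff_exists D hR]
  have hb := evalMap_bijective D hR hX hgenus hq hqX
  obtain ⟨w, hw⟩ := hb.2 (if D.rInf = 1 then -secondMomentTarget D q p else 0,
      if D.rInf ≤ 2 then -residueTarget D p else 0, hTarget D q p)
  refine ⟨w.1, ⟨w.2, hw⟩, ?_⟩
  rintro h ⟨e, he⟩
  exact congrArg Prod.fst (hb.1 (he.trans hw.symm))

theorem isH_solH (D : DeformationData n) (hR : 1 ≤ D.rInf)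
    (hX : Function.Injective D.X) (hgenus : D.rInf + ∑ s, D.r s = g + 3) {q : Fin g → ℂ}
    (hq : Function.Injective q) (hqX : ∀ j s, q j ≠ D.X s) (p : Fin g → ℂ) :
    D.IsH q p (D.solH q p) :=
  Classical.epsilon_spec (existsUnique_isH D hR hX hgenus hq hqX p).exists

end

section

/-! ### The Hamiltonian and its partial derivatives -/

variable {n g : ℕ}

/-- Pairing the equations for the `μ_j` with isospectral coefficients. -/
theorem sum_mu_mul_evalH (D : DeformationData n) {q : Fin g → ℂ} {y : ℂ × ℂ × (Fin g → ℂ)}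
    (hy : D.IsNuMu q y) (h : D.HType) :
    ∑ j, y.2.2 j * evalH D h (q j) =
      ∑ k ∈ Finset.range (D.rInf - 3), D.nuInfShifted (k + 2) * entryAt h.1 k
        - ∑ s, ∑ k ∈ Finset.range (D.r s), D.nuX s k * entryAt (h.2 s) k
        + y.2.1 * residueSum D h + y.1 * secondMoment D h := by
  obtain ⟨-, -, h3, h4⟩ := hy
  have h5 := sum_mul_moments D.r D.X (fun s => entryAt (h.2 s)) y.1 y.2.1
  rw [evalH, sum_mul_ratFn, residueSum, secondMoment, add_assoc, ← h5, sub_add,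
    ← Finset.sum_sub_distrib, sub_eq_add_neg, ← Finset.sum_neg_distrib]
  congr 1
  · refine Finset.sum_congr rfl fun k hk => ?_
    rw [Finset.mem_range] at hk
    have := h3 (k + 1) (by rw [Finset.mem_Icc]; omega)
    rw [Nat.add_sub_cancel] at this
    rw [this, mul_comm]
  · refine Finset.sum_congr rfl fun s _ => ?_
    rw [← Finset.sum_sub_distrib, ← Finset.sum_neg_distrib]
    refine Finset.sum_congr rfl fun k hk => ?_
    have := h4 s k hk
    simp only [div_eq_mul_inv] at this
    rw [this]; ring

theorem eventually_admissible (Y : Fin n → ℂ) {q : Fin g → ℂ} (hq : Function.Injective q)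
    (hqX : ∀ j s, q j ≠ Y s) :
    ∀ᶠ q' in 𝓝 q, Function.Injective q' ∧ ∀ j s, q' j ≠ Y s := by
  have h1 : ∀ᶠ q' : Fin g → ℂ in 𝓝 q, ∀ i j, i ≠ j → q' i ≠ q' j := by
    refine eventually_all.2 fun i => eventually_all.2 fun j => ?_
    by_cases hij : i = j
    · exact Eventually.of_forall fun _ h => absurd hij h
    · have hc : ContinuousAt (fun q' : Fin g → ℂ => q' i - q' j) q := by fun_prop
      filter_upwards [hc.eventually_ne (sub_ne_zero.2 (hq.ne hij))] with q' h _
      exact sub_ne_zero.1 h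
  have h2 : ∀ᶠ q' : Fin g → ℂ in 𝓝 q, ∀ j s, q' j ≠ Y s := by
    refine eventually_all.2 fun j => eventually_all.2 fun s => ?_
    exact (continuous_apply j).continuousAt.eventually_ne (hqX j s)
  filter_upwards [h1, h2] with q' h h'
  exact ⟨fun i j hij => by_contra fun hne => h i j hne hij, h'⟩

/-- The solution of the linear system for the `μ_j` depends continuously on the `q_j`. -/
theorem continuousAt_nuMu (D : DeformationData n) (hR : 1 ≤ D.rInf)
    (hX : Function.Injective D.X) (hgenus : D.rInf + ∑ s, D.r s = g + 3) {q : Fin g → ℂ}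
    (hq : Function.Injective q) (hqX : ∀ j s, q j ≠ D.X s) :
    ContinuousAt (D.nuMu (g := g)) q := by
  let e := LinearEquiv.ofBijective (momentMap D q) (momentMap_bijective D hR hX hgenus hq hqX)
  -- the system, normalized to be the identity at the given point
  let F : (Fin g → ℂ) → (ℂ × ℂ × (Fin g → ℂ)) →L[ℂ] (ℂ × ℂ × (Fin g → ℂ)) := fun q' =>
    LinearMap.toContinuousLinearMap (e.symm.toLinearMap ∘ₗ momentMap D q')
  have hF : ContinuousAt F q := by
    rw [continuousAt_clm_apply]
    intro y
    have h1 : ContinuousAt (fun q' => momentMap D q' y) q := by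
      refine ContinuousAt.prodMk (ContinuousAt.prodMk ?_ ?_) continuousAt_const
      · refine continuousAt_pi.2 fun k => tendsto_finsetSum _ fun j _ => ?_
        exact continuousAt_const.mul ((continuous_apply j).continuousAt.pow _)
      · refine continuousAt_pi.2 fun s => continuousAt_pi.2 fun k => ?_
        refine ContinuousAt.sub (ContinuousAt.sub ?_ continuousAt_const) continuousAt_const
        refine tendsto_finsetSum _ fun j _ => ?_
        refine ContinuousAt.mul continuousAt_const (ContinuousAt.inv₀
          (((continuous_apply j).continuousAt.sub continuousAt_const).pow _) ?_)
        exact pow_ne_zero _ (sub_ne_zero.2 (hqX j s))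
    exact (LinearMap.continuous_of_finiteDimensional e.symm.toLinearMap).continuousAt.comp h1
  have hF0 : F q = 1 := by
    refine ContinuousLinearMap.ext fun y => ?_
    exact e.symm_apply_apply y
  have hinv : ContinuousAt (fun q' => Ring.inverse (F q') (D.nuMu q)) q := by
    have h1 : ContinuousAt (fun q' => Ring.inverse (F q')) q := by
      have h2 := NormedRing.inverse_continuousAt
        (1 : ((ℂ × ℂ × (Fin g → ℂ)) →L[ℂ] (ℂ × ℂ × (Fin g → ℂ)))ˣ)
      rw [Units.val_one, ← hF0] at h2
      exact h2.comp hF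
    exact h1.clm_apply continuousAt_const
  refine hinv.congr ?_
  have hunit : ∀ᶠ q' in 𝓝 q, IsUnit (F q') := by
    refine hF.eventually (Units.isOpen.mem_nhds ?_)
    rw [hF0]; exact isUnit_one
  filter_upwards [hunit, eventually_admissible D.X hq hqX] with q' hu ha
  have h1 := (isNuMu_iff D q' _).1 (isNuMu_nuMu D hR hX hgenus ha.1 ha.2)
  have h2 := (isNuMu_iff D q _).1 (isNuMu_nuMu D hR hX hgenus hq hqX)
  have h3 : F q' (D.nuMu q') = D.nuMu q := by
    change e.symm (momentMap D q' (D.nuMu q')) = _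
    rw [h1, ← h2]
    exact e.symm_apply_apply _
  rw [← h3, ← mul_apply_eq_comp, Ring.inverse_mul_cancel _ hu,
    one_apply_eq_self]

/-- The rational function `∑_k c_{∞,k} z^k + ∑_{s,k} c_{X_s,k} (z - X_s)^{-k}`. -/
noncomputable def cFun (D : DeformationData n) (c0 : ℂ) : ℂ → ℂ :=
  ratFn D.rInf (fun s => D.r s - 1) D.X (fun k => if k = 0 then c0 else D.cInf k)
    (fun s k => D.cX s (k + 1))

theorem sum_Icc_one_eq (f : ℕ → ℂ) (m : ℕ) :
    ∑ k ∈ Finset.Icc 1 m, f k = ∑ k ∈ Finset.range m, f (k + 1) := by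
  rw [Finset.range_eq_Ico, Finset.sum_Ico_add' f 0 m 1]
  rfl

theorem sum_range_eq_add_sum_Icc (f : ℕ → ℂ) {m : ℕ} (hm : 1 ≤ m) :
    ∑ k ∈ Finset.range m, f k = f 0 + ∑ k ∈ Finset.Icc 2 m, f (k - 1) := by
  obtain ⟨m, rfl⟩ : ∃ l, m = l + 1 := ⟨m - 1, by omega⟩
  rw [Finset.sum_range_succ', add_comm, Finset.range_eq_Ico,
    show Finset.Icc 2 (m + 1) = Finset.Ico (0 + 2) (m + 2) by rw [zero_add]; rfl,
    ← Finset.sum_Ico_add' (fun k => f (k - 1)) 0 m 2]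
  rfl

theorem cFun_eq (D : DeformationData n) (hR : 1 ≤ D.rInf) (c0 z : ℂ) :
    cFun D c0 z = c0 + ∑ k ∈ Finset.Icc 1 (D.rInf - 1), D.cInf k * z ^ k
      + ∑ s, ∑ k ∈ Finset.Icc 1 (D.r s - 1), D.cX s k / (z - D.X s) ^ k := by
  simp only [cFun, ratFn, sum_Icc_one_eq, div_eq_mul_inv]
  congr 1
  obtain ⟨m, hm⟩ : ∃ m, D.rInf = m + 1 := ⟨D.rInf - 1, by omega⟩
  rw [hm, Finset.sum_range_succ', Nat.add_sub_cancel]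
  simp [add_comm]

theorem ratFnDeriv_eq (N : ℕ) (r : Fin n → ℕ) (Y : Fin n → ℂ) (c : ℕ → ℂ) (b : Fin n → ℕ → ℂ)
    (z : ℂ) : ratFnDeriv N r Y c b z =
      ∑ k ∈ Finset.Icc 1 (N - 1), (k : ℂ) * c k * z ^ (k - 1)
        - ∑ s, ∑ k ∈ Finset.Icc 1 (r s), (k : ℂ) * b s (k - 1) / (z - Y s) ^ (k + 1) := by
  simp only [ratFnDeriv, ratFn, sum_Icc_one_eq, div_eq_mul_inv]
  rw [sub_eq_add_neg, ← Finset.sum_neg_distrib]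
  congr 1
  · refine Finset.sum_congr rfl fun k _ => ?_
    rw [Nat.add_sub_cancel]; push_cast; ring
  · refine Finset.sum_congr rfl fun s _ => ?_
    rw [Finset.sum_range_succ', ← Finset.sum_neg_distrib]
    simp only [Nat.cast_zero, neg_zero, zero_mul, add_zero, Nat.add_sub_cancel]
    exact Finset.sum_congr rfl fun k _ => by ring

theorem hasDerivAt_cFun (D : DeformationData n) (c0 : ℂ) {z : ℂ} (hz : ∀ s, z ≠ D.X s) :
    HasDerivAt (cFun D c0) (∑ k ∈ Finset.Icc 1 (D.rInf - 1), (k : ℂ) * D.cInf k * z ^ (k - 1)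
      - ∑ s, ∑ k ∈ Finset.Icc 1 (D.r s - 1), (k : ℂ) * D.cX s k / (z - D.X s) ^ (k + 1)) z := by
  have h := hasDerivAt_ratFn D.rInf (fun s => D.r s - 1) D.X
    (fun k => if k = 0 then c0 else D.cInf k) (fun s k => D.cX s (k + 1)) hz
  rw [ratFnDeriv_eq] at h
  refine h.congr_deriv (congrArg₂ _ (Finset.sum_congr rfl fun k hk => ?_)
    (Finset.sum_congr rfl fun s _ => Finset.sum_congr rfl fun k hk => ?_))
  · rw [Finset.mem_Icc] at hk
    rw [if_neg (by omega)]
  · rw [Finset.mem_Icc] at hk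
    rw [Nat.sub_add_cancel hk.1]

theorem hasDerivAt_evalH (D : DeformationData n) (h : D.HType) {z : ℂ} (hz : ∀ s, z ≠ D.X s) :
    HasDerivAt (evalH D h) (∑ k ∈ Finset.Icc 1 (D.rInf - 4), (k : ℂ) * entryAt h.1 k * z ^ (k - 1)
      - ∑ s, ∑ k ∈ Finset.Icc 1 (D.r s),
        (k : ℂ) * entryAt (h.2 s) (k - 1) / (z - D.X s) ^ (k + 1)) z := by
  have h := hasDerivAt_ratFn (D.rInf - 3) D.r D.X (entryAt h.1) (fun s => entryAt (h.2 s)) hz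
  rwa [ratFnDeriv_eq, show D.rInf - 3 - 1 = D.rInf - 4 by omega] at h

/-- The Hamiltonian in terms of the right-hand sides of the equations for the isospectral
coefficients, which are explicit in `p`. -/
theorem ham_eq (D : DeformationData n) (hR : 1 ≤ D.rInf) (hr : ∀ s, 1 ≤ D.r s)
    (hX : Function.Injective D.X) (hgenus : D.rInf + ∑ s, D.r s = g + 3) {q : Fin g → ℂ}
    (hq : Function.Injective q) (hqX : ∀ j s, q j ≠ D.X s) (p : Fin g → ℂ) (c0 : ℂ) :
    D.Ham c0 q p = ∑ j, D.mu q j * hTarget D q p j - D.hbar * ∑ j, cFun D c0 (q j)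
      - residueShift D * D.nuInfZero q - secondMomentShift D * D.nuInfNegOne q
      - D.hbar * D.nuInfZero q * ∑ j, p j - D.hbar * D.nuInfNegOne q * ∑ j, q j * p j := by
  obtain ⟨h1, h2, h3⟩ := (isH_iff D hR q p _).1 (isH_solH D hR hX hgenus hq hqX p)
  have hs := sum_mu_mul_evalH D (isNuMu_nuMu D hR hX hgenus hq hqX) (D.solH q p)
  simp only [h1] at hs
  have e1 : ∑ j, D.mu q j * hTarget D q p j = _ := hs
  have e2 : ∑ s, ∑ k ∈ Finset.range (D.r s), D.nuX s k * entryAt ((D.solH q p).2 s) k =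
      ∑ s, ∑ k ∈ Finset.Icc 2 (D.r s), D.nuX s (k - 1) * D.HX q p s k
        - ∑ s, D.aPole s * D.HX q p s 1 := by
    rw [← Finset.sum_sub_distrib]
    refine Finset.sum_congr rfl fun s _ => ?_
    rw [sum_range_eq_add_sum_Icc (fun k => D.nuX s k * entryAt ((D.solH q p).2 s) k) (hr s)]
    have e3 : D.nuX s 0 = -D.aPole s := if_pos rfl
    simp only [e3, DeformationData.HX]
    ring
  have e4 : ∑ s, D.HX q p s 1 = residueSum D (D.solH q p) := (residueSum_eq D _).symm
  have e5 : ∑ s, D.X s * D.HX q p s 1 + (∑ s, if 2 ≤ D.r s then D.HX q p s 2 else 0) =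
    secondMoment D (D.solH q p) := (secondMoment_eq D _).symm
  rw [Finset.sum_add_distrib.symm] at e5
  rw [e1, e2]
  simp only [cFun_eq D hR]
  rw [DeformationData.Ham, ← Finset.sum_add_distrib, e4, e5]
  have e6 : (if D.rInf = 1 ∨ D.rInf = 2 then
      (residueSum D (D.solH q p) - D.hbar * ∑ j, p j) * D.nuInfZero q else 0) =
      residueShift D * D.nuInfZero q := by
    split_ifs with h
    · rw [h2 (by omega), residueTarget, add_sub_cancel_left]
    · rw [residueShift, if_neg (by omega), zero_mul]
  have e7 : (if D.rInf = 1 then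
      (secondMoment D (D.solH q p) - D.hbar * ∑ j, q j * p j) * D.nuInfNegOne q else 0) =
      secondMomentShift D * D.nuInfNegOne q := by
    split_ifs with h
    · rw [h3 h, secondMomentTarget, add_sub_cancel_left]
    · rw [secondMomentShift, if_neg h, zero_mul]
  rw [e6, e7]
  simp only [DeformationData.HInf, DeformationData.nuInfZero, DeformationData.nuInfNegOne]
  ring

end

section

/-! ### The Hamiltonian equations -/

variable {n g : ℕ}

theorem P1_eq_ratFn (D : DeformationData n) : D.P1 = ratFn (D.rInf - 1) D.r D.X
    (fun k => -(D.tInf 0 (k + 1) + D.tInf 1 (k + 1))) (fun s k => D.tX s 0 k + D.tX s 1 k) := by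
  funext z
  simp only [DeformationData.P1, ratFn, div_eq_mul_inv]

theorem differentiableAt_P1 (D : DeformationData n) {z : ℂ} (hz : ∀ s, z ≠ D.X s) :
    DifferentiableAt ℂ D.P1 z := by
  rw [P1_eq_ratFn]; exact differentiableAt_ratFn _ _ _ _ _ hz

theorem differentiableAt_P2tilde (D : DeformationData n) {z : ℂ} (hz : ∀ s, z ≠ D.X s) :
    DifferentiableAt ℂ D.P2tilde z := by
  unfold DeformationData.P2tilde
  refine DifferentiableAt.fun_add (DifferentiableAt.fun_sum fun k _ => ?_)
    (DifferentiableAt.fun_sum fun s _ => DifferentiableAt.fun_sum fun k _ => ?_)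
  · split_ifs <;> fun_prop
  · exact DifferentiableAt.fun_div (by fun_prop) (by fun_prop)
      (pow_ne_zero _ (sub_ne_zero.2 (hz s)))

theorem hasDerivAt_sum_div_sub (c : Fin n → ℂ) (Y : Fin n → ℂ) {z : ℂ} (hz : ∀ s, z ≠ Y s) :
    HasDerivAt (fun z => ∑ s, c s / (z - Y s)) (-∑ s, c s / (z - Y s) ^ 2) z := by
  rw [← Finset.sum_neg_distrib]
  refine HasDerivAt.fun_sum fun s _ => ?_
  have := ((hasDerivAt_const z (c s)).fun_div ((hasDerivAt_id z).sub_const (Y s))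
    (sub_ne_zero.2 (hz s)))
  refine this.congr_deriv ?_
  simp [neg_div]

theorem hasDerivAt_hTarget (D : DeformationData n) {Q P : ℂ → Fin g → ℂ} {Q' P' : Fin g → ℂ} {t : ℂ}
    (hQ : ∀ i, HasDerivAt (fun x => Q x i) (Q' i) t) (hP : ∀ i, HasDerivAt (fun x => P x i) (P' i) t)
    (hinj : Function.Injective (Q t)) (hX : ∀ j s, Q t j ≠ D.X s) (i : Fin g) :
    HasDerivAt (fun x => hTarget D (Q x) (P x) i)
      (2 * P t i * P' i - (deriv D.P1 (Q t i) * Q' i * P t i + D.P1 (Q t i) * P' i)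
        + (P' i * ∑ s, D.hbar * D.r s / (Q t i - D.X s)
          - P t i * ((∑ s, D.hbar * D.r s / (Q t i - D.X s) ^ 2) * Q' i))
        + deriv D.P2tilde (Q t i) * Q' i
        + D.hbar * ∑ k ∈ Finset.univ.erase i, ((P' k - P' i) * (Q t i - Q t k)
            - (P t k - P t i) * (Q' i - Q' k)) / (Q t i - Q t k) ^ 2
        + if 3 ≤ D.rInf then D.hbar * D.tInf 0 (D.rInf - 1) *
            (((D.rInf - 3 : ℕ) : ℂ) * Q t i ^ (D.rInf - 4) * Q' i) else 0) t := by
  unfold hTarget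
  refine HasDerivAt.fun_add (HasDerivAt.fun_add (HasDerivAt.fun_add (HasDerivAt.fun_add
    (HasDerivAt.fun_sub ?_ ?_) ?_) ?_) ?_) ?_
  · simpa using (hP i).fun_pow 2
  · exact ((differentiableAt_P1 D (hX i)).hasDerivAt.comp t (hQ i)).fun_mul (hP i)
  · refine ((hP i).fun_mul ((hasDerivAt_sum_div_sub (fun s => D.hbar * D.r s) D.X (hX i)).comp t
      (hQ i))).congr_deriv ?_
    simp only [Function.comp]; ring
  · exact (differentiableAt_P2tilde D (hX i)).hasDerivAt.comp t (hQ i)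
  · refine HasDerivAt.const_mul _ (HasDerivAt.fun_sum fun k hk => ?_)
    exact ((hP k).fun_sub (hP i)).fun_div ((hQ i).fun_sub (hQ k))
      (sub_ne_zero.2 (hinj.ne (Finset.ne_of_mem_erase hk).symm))
  · split_ifs
    · exact ((hQ i).fun_pow _).const_mul _
    · exact hasDerivAt_const _ _

theorem hasDerivAt_update_apply (v : Fin g → ℂ) (j i : Fin g) (x : ℂ) :
    HasDerivAt (fun x => Function.update v j x i) (if i = j then 1 else 0) x := by
  have := hasDerivAt_pi.1 (hasDerivAt_update v j x) i
  rwa [Pi.single_apply] at this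

/-- The derivative of `∑_i f_i ∑_{k ≠ i} (y_k - y_i) G_{ik}` with respect to `y_j`, regrouped as a sum
over `i ≠ j`. -/
theorem sum_mul_sum_erase_single (f : Fin g → ℂ) (G : Fin g → Fin g → ℂ) (j : Fin g) :
    ∑ i, f i * ∑ k ∈ Finset.univ.erase i, ((if k = j then 1 else 0) - (if i = j then 1 else 0)) * G i k
      = ∑ i ∈ Finset.univ.erase j, (f i * G i j - f j * G j i) := by
  rw [← Finset.add_sum_erase _ _ (Finset.mem_univ j), Finset.sum_sub_distrib, sub_eq_add_neg,
    add_comm, Finset.mul_sum, ← Finset.sum_neg_distrib]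
  congr 1
  · refine Finset.sum_congr rfl fun i hi => ?_
    have hij := Finset.ne_of_mem_erase hi
    rw [Finset.sum_eq_single j]
    · simp [hij]
    · intro k _ hk; simp [hk, hij]
    · intro h; simp [Ne.symm hij] at h
  · refine Finset.sum_congr rfl fun i hi => ?_
    have hij := Finset.ne_of_mem_erase hi
    simp [hij]

/-- The evolution of `q` is the partial derivative of the Hamiltonian in `p`. -/
theorem hasDerivAt_ham_p (D : DeformationData n) (hR : 1 ≤ D.rInf) (hr : ∀ s, 1 ≤ D.r s)
    (hX : Function.Injective D.X) (hgenus : D.rInf + ∑ s, D.r s = g + 3) {q : Fin g → ℂ}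
    (hq : Function.Injective q) (hqX : ∀ j s, q j ≠ D.X s) (p : Fin g → ℂ) (c0 : ℂ) (j : Fin g) :
    HasDerivAt (fun x => D.Ham c0 q (Function.update p j x)) (D.qEvolution q p j) (p j) := by
  have hp : ∀ i, HasDerivAt (fun x => Function.update p j x i) (if i = j then 1 else 0) (p j) :=
    fun i => hasDerivAt_update_apply p j i (p j)
  have hup : Function.update p j (p j) = p := Function.update_eq_self j p
  have hsum : HasDerivAt (fun x => ∑ i, Function.update p j x i) 1 (p j) :=
    (HasDerivAt.fun_sum fun i _ => hp i).congr_deriv (by simp)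
  have hsumq : HasDerivAt (fun x => ∑ i, q i * Function.update p j x i) (q j) (p j) :=
    (HasDerivAt.fun_sum fun i _ => (hp i).const_mul (q i)).congr_deriv (by simp)
  have hT := fun i => hasDerivAt_hTarget D (Q := fun _ => q) (Q' := fun _ => 0)
    (fun i => hasDerivAt_const (p j) (q i)) hp hq hqX i
  simp only [hup] at hT
  have h1 := (((HasDerivAt.fun_sum (u := Finset.univ) fun i _ =>
    (hT i).const_mul (D.mu q i)).sub_const (D.hbar * ∑ j, cFun D c0 (q j)
      + residueShift D * D.nuInfZero q + secondMomentShift D * D.nuInfNegOne q)).fun_sub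
      (hsum.const_mul (D.hbar * D.nuInfZero q))).fun_sub
      (hsumq.const_mul (D.hbar * D.nuInfNegOne q))
  refine (h1.congr_of_eventuallyEq (Eventually.of_forall fun x => ?_)).congr_deriv ?_
  · simp only
    rw [ham_eq D hR hr hX hgenus hq hqX]
    ring
  · have e1 := sum_mul_sum_erase_single (D.mu q) (fun i k => (q i - q k)⁻¹) j
    have e2 : ∀ i, D.mu q i * (2 * p i * (if i = j then 1 else 0)
        - (deriv D.P1 (q i) * 0 * p i + D.P1 (q i) * (if i = j then 1 else 0))
        + ((if i = j then 1 else 0) * ∑ s, D.hbar * D.r s / (q i - D.X s)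
          - p i * ((∑ s, D.hbar * D.r s / (q i - D.X s) ^ 2) * 0))
        + deriv D.P2tilde (q i) * 0
        + D.hbar * ∑ k ∈ Finset.univ.erase i, (((if k = j then 1 else 0) - (if i = j then 1 else 0))
          * (q i - q k) - (p k - p i) * (0 - 0)) / (q i - q k) ^ 2
        + if 3 ≤ D.rInf then D.hbar * D.tInf 0 (D.rInf - 1) *
            (((D.rInf - 3 : ℕ) : ℂ) * q i ^ (D.rInf - 4) * 0) else 0) =
        (if i = j then D.mu q i * (2 * p i - D.P1 (q i) + ∑ s, D.hbar * D.r s / (q i - D.X s)) else 0)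
        + D.hbar * (D.mu q i * ∑ k ∈ Finset.univ.erase i,
          ((if k = j then 1 else 0) - (if i = j then 1 else 0)) * (q i - q k)⁻¹) := by
      intro i
      have e3 : ∑ k ∈ Finset.univ.erase i, (((if k = j then (1 : ℂ) else 0) - (if i = j then 1 else 0))
          * (q i - q k) - (p k - p i) * (0 - 0)) / (q i - q k) ^ 2 = ∑ k ∈ Finset.univ.erase i,
          ((if k = j then 1 else 0) - (if i = j then 1 else 0)) * (q i - q k)⁻¹ := by
        refine Finset.sum_congr rfl fun k hk => ?_
        have := sub_ne_zero.2 (hq.ne (Finset.ne_of_mem_erase hk).symm)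
        field_simp
        ring
      rw [e3]
      simp only [mul_zero, ite_self]
      split_ifs <;> ring
    rw [Finset.sum_congr rfl fun i _ => e2 i, Finset.sum_add_distrib, ← Finset.mul_sum, e1,
      Finset.sum_ite_eq' Finset.univ j, if_pos (Finset.mem_univ j), DeformationData.qEvolution]
    have e4 : ∑ i ∈ Finset.univ.erase j, (D.mu q j + D.mu q i) / (q j - q i) =
        -∑ i ∈ Finset.univ.erase j, (D.mu q i * (q i - q j)⁻¹ - D.mu q j * (q j - q i)⁻¹) := by
      rw [← Finset.sum_neg_distrib]
      refine Finset.sum_congr rfl fun i _ => ?_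
      rw [← neg_sub (q j) (q i), inv_neg]
      ring
    rw [e4]
    ring

/-- A product whose second factor vanishes at the point is differentiable as soon as the first factor
is continuous there. -/
theorem hasDerivAt_mul_of_eq_zero {u v : ℂ → ℂ} {v' a : ℂ} (hu : ContinuousAt u a)
    (hv : HasDerivAt v v' a) (h0 : v a = 0) : HasDerivAt (fun x => u x * v x) (u a * v') a := by
  rw [hasDerivAt_iff_tendsto_slope] at hv ⊢
  refine ((hu.tendsto.mono_left nhdsWithin_le_nhds).mul hv).congr fun x => ?_
  simp only [slope_def_field, h0, mul_zero]
  ring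

/-- The evolution of `p` is minus the partial derivative of the Hamiltonian in `q`.  Freezing the
isospectral coefficients at their value at the given point, the Hamiltonian is a sum of products
whose second factors vanish there, so that only the continuity of the `μ_i` matters. -/
theorem hasDerivAt_ham_q (D : DeformationData n) (hR : 1 ≤ D.rInf) (hr : ∀ s, 1 ≤ D.r s)
    (hX : Function.Injective D.X) (hgenus : D.rInf + ∑ s, D.r s = g + 3) {q : Fin g → ℂ}
    (hq : Function.Injective q) (hqX : ∀ j s, q j ≠ D.X s) (p : Fin g → ℂ) (c0 : ℂ) (j : Fin g) :
    HasDerivAt (fun x => D.Ham c0 (Function.update q j x) p) (-D.pEvolution q p j) (q j) := by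
  have hqd : ∀ i, HasDerivAt (fun x => Function.update q j x i) (if i = j then 1 else 0) (q j) :=
    fun i => hasDerivAt_update_apply q j i (q j)
  have hup : Function.update q j (q j) = q := Function.update_eq_self j q
  have hcu : ContinuousAt (fun x => Function.update q j x) (q j) :=
    continuousAt_pi.2 fun i => (hqd i).continuousAt
  have hc : ContinuousAt (fun x => D.nuMu (Function.update q j x)) (q j) := by
    have h := continuousAt_nuMu D hR hX hgenus hq hqX
    rw [← hup] at h
    exact ContinuousAt.comp (f := fun x => Function.update q j x) h hcu
  have hadm : ∀ᶠ x in 𝓝 (q j), Function.Injective (Function.update q j x) ∧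
      ∀ i s, Function.update q j x i ≠ D.X s := by
    have h := eventually_admissible D.X hq hqX
    rw [← hup] at h
    exact hcu.eventually h
  -- the isospectral coefficients, frozen at the given point
  set h := D.solH q p with hh
  obtain ⟨H1, H2, H3⟩ := (isH_iff D hR q p _).1 (isH_solH D hR hX hgenus hq hqX p)
  have hT := fun i => hasDerivAt_hTarget D (P := fun _ => p) (P' := fun _ => 0) hqd
    (fun i => hasDerivAt_const (q j) (p i)) (by rw [hup]; exact hq) (by rw [hup]; exact hqX) i
  have hE : ∀ i, HasDerivAt (fun x => evalH D h (Function.update q j x i)) _ (q j) := fun i =>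
    (hasDerivAt_evalH D h (z := Function.update q j (q j) i)
      (by rw [hup]; exact hqX i)).comp (q j) (hqd i)
  have hC : ∀ i, HasDerivAt (fun x => cFun D c0 (Function.update q j x i)) _ (q j) := fun i =>
    (hasDerivAt_cFun D c0 (z := Function.update q j (q j) i)
      (by rw [hup]; exact hqX i)).comp (q j) (hqd i)
  simp only [hup] at hT hE hC
  have hmu : ∀ i, ContinuousAt (fun x => D.mu (Function.update q j x) i) (q j) := fun i =>
    (continuous_apply i).continuousAt.comp (continuous_snd.continuousAt.comp
      (continuous_snd.continuousAt.comp hc))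
  have hnu : ContinuousAt (fun x => D.nuInfNegOne (Function.update q j x)) (q j) :=
    continuous_fst.continuousAt.comp hc
  have hsum := HasDerivAt.fun_sum (u := Finset.univ) fun i _ => hasDerivAt_mul_of_eq_zero (hmu i)
    ((hT i).fun_sub (hE i)) (by simp only [hup]; rw [← H1, sub_self])
  have e1 := sum_mul_sum_erase_single (D.mu q) (fun i k => (p k - p i) / (q i - q k) ^ 2) j
  have e4 : ∑ i ∈ Finset.univ.erase j, (D.mu q i * ((p j - p i) / (q i - q j) ^ 2)
      - D.mu q j * ((p i - p j) / (q j - q i) ^ 2)) =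
      -∑ i ∈ Finset.univ.erase j, (D.mu q i + D.mu q j) * (p i - p j) / (q j - q i) ^ 2 := by
    rw [← Finset.sum_neg_distrib]
    refine Finset.sum_congr rfl fun i _ => ?_
    rw [← neg_sub (q j) (q i), neg_sq]
    ring
  have e3 : ∀ i, ∑ k ∈ Finset.univ.erase i, ((0 - 0) * (q i - q k)
      - (p k - p i) * ((if i = j then 1 else 0) - if k = j then 1 else 0)) / (q i - q k) ^ 2 =
      ∑ k ∈ Finset.univ.erase i, ((if k = j then 1 else 0) - (if i = j then 1 else 0))
        * ((p k - p i) / (q i - q k) ^ 2) := fun i =>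
    Finset.sum_congr rfl fun k _ => by ring
  simp only [hup, e3] at hsum
  replace hsum := hsum.congr_deriv (g' := D.mu q j * (-(deriv D.P1 (q j) * p j)
      - p j * (∑ s, D.hbar * D.r s / (q j - D.X s) ^ 2) + deriv D.P2tilde (q j)
      + (if 3 ≤ D.rInf then
          D.hbar * D.tInf 0 (D.rInf - 1) * (((D.rInf - 3 : ℕ) : ℂ) * q j ^ (D.rInf - 4)) else 0)
      - (∑ k ∈ Finset.Icc 1 (D.rInf - 4), (k : ℂ) * entryAt h.1 k * q j ^ (k - 1)
        - ∑ s, ∑ k ∈ Finset.Icc 1 (D.r s),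
          (k : ℂ) * entryAt (h.2 s) (k - 1) / (q j - D.X s) ^ (k + 1)))
      - D.hbar * ∑ i ∈ Finset.univ.erase j, (D.mu q i + D.mu q j) * (p i - p j) / (q j - q i) ^ 2) (by
    rw [sub_eq_add_neg _ (D.hbar * _), ← mul_neg D.hbar, ← e4, ← e1, Finset.mul_sum _ _ D.hbar,
      ← Fintype.sum_ite_eq' j (fun i => D.mu q i * (-(deriv D.P1 (q i) * p i)
      - p i * (∑ s, D.hbar * D.r s / (q i - D.X s) ^ 2) + deriv D.P2tilde (q i)
      + (if 3 ≤ D.rInf then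
          D.hbar * D.tInf 0 (D.rInf - 1) * (((D.rInf - 3 : ℕ) : ℂ) * q i ^ (D.rInf - 4)) else 0)
      - (∑ k ∈ Finset.Icc 1 (D.rInf - 4), (k : ℂ) * entryAt h.1 k * q i ^ (k - 1)
        - ∑ s, ∑ k ∈ Finset.Icc 1 (D.r s),
          (k : ℂ) * entryAt (h.2 s) (k - 1) / (q i - D.X s) ^ (k + 1)))),
      ← Finset.sum_add_distrib]
    refine Finset.sum_congr rfl fun i _ => ?_
    split_ifs <;> ring)
  have hlin : HasDerivAt (fun x => D.nuInfNegOne (Function.update q j x) * (D.hbar * p j * (x - q j)))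
      (D.nuInfNegOne (Function.update q j (q j)) * (D.hbar * p j)) (q j) := by
    refine hasDerivAt_mul_of_eq_zero hnu ?_ (by simp)
    simpa using ((hasDerivAt_id (q j)).sub_const (q j)).const_mul (D.hbar * p j)
  -- The terms that do not depend on `x`.  A moment of the frozen coefficients enters only when its
  -- factor `ν` is fixed by the times; otherwise the conditions on the coefficients make it cancel.
  have hall := ((hsum.fun_sub hlin).fun_sub ((HasDerivAt.fun_sum (u := Finset.univ)
    fun i _ => hC i).const_mul D.hbar)).add_const
      (∑ k ∈ Finset.range (D.rInf - 3), D.nuInfShifted (k + 2) * entryAt h.1 k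
        - ∑ s, ∑ k ∈ Finset.range (D.r s), D.nuX s k * entryAt (h.2 s) k
        + (if D.rInf ≤ 2 then 0 else D.nuInfShifted 1 *
            (residueSum D h - D.hbar * ∑ i, p i - residueShift D))
        + (if D.rInf = 1 then 0 else D.nuInfShifted 0 *
            (secondMoment D h - D.hbar * ∑ i, q i * p i - secondMomentShift D)))
  refine (hall.congr_of_eventuallyEq ?_).congr_deriv ?_
  · filter_upwards [hadm] with x hx
    have hN := isNuMu_nuMu D hR hX hgenus hx.1 hx.2
    have hp1 : ∑ i, D.mu (Function.update q j x) i * evalH D h (Function.update q j x i) = _ :=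
      sum_mu_mul_evalH D hN h
    rw [ham_eq D hR hr hX hgenus hx.1 hx.2]
    have hqp : ∑ i, Function.update q j x i * p i = ∑ i, q i * p i + p j * (x - q j) := by
      rw [← sub_eq_iff_eq_add', ← Finset.sum_sub_distrib, Finset.sum_eq_single j]
      · simp; ring
      · intro i _ hi; simp [hi]
      · simp
    have e0 : D.nuInfZero (Function.update q j x) *
        (residueSum D h - D.hbar * ∑ i, p i - residueShift D) =
        (if D.rInf ≤ 2 then 0 else D.nuInfShifted 1 *
            (residueSum D h - D.hbar * ∑ i, p i - residueShift D)) := by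
      split_ifs with h2
      · rw [H2 h2, residueTarget]; ring
      · rw [DeformationData.nuInfZero, hN.2.1 (by omega)]
    have e1 : D.nuInfNegOne (Function.update q j x) *
        (secondMoment D h - D.hbar * ∑ i, q i * p i - secondMomentShift D) =
        (if D.rInf = 1 then 0 else D.nuInfShifted 0 *
            (secondMoment D h - D.hbar * ∑ i, q i * p i - secondMomentShift D)) := by
      split_ifs with h2
      · rw [H3 h2, secondMomentTarget]; ring
      · rw [DeformationData.nuInfNegOne, hN.1 (by omega)]
    have e2 : ∑ i, D.mu (Function.update q j x) i * (hTarget D (Function.update q j x) p i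
        - evalH D h (Function.update q j x i)) =
        ∑ i, D.mu (Function.update q j x) i * hTarget D (Function.update q j x) p i
          - ∑ i, D.mu (Function.update q j x) i * evalH D h (Function.update q j x i) := by
      simp only [mul_sub, Finset.sum_sub_distrib]
    rw [e2, hp1, hqp, ← e0, ← e1]
    simp only [DeformationData.nuInfZero, DeformationData.nuInfNegOne]
    ring
  · simp only [hup, mul_ite, mul_one, mul_zero, Finset.sum_ite_eq', Finset.mem_univ, if_true]
    rw [DeformationData.pEvolution]
    simp only [DeformationData.HInf, DeformationData.HX, ← hh, mul_div_assoc]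
    ring_nf

end

section

/-! ### The second matrix of the Lax pair in terms of the Darboux coordinates -/

variable {n g : ℕ}

/-- `q` lists the zeros of the `(1,2)` entry of the connection matrix, which are as many as the genus
allows, and `p` the values of its `(1,1)` entry there. -/
structure IsDarboux (D : DeformationData n) (K : PolarCoeffs n) (q p : Fin g → ℂ) : Prop where
  genus : D.rInf + ∑ s, D.r s = g + 3
  injective : Function.Injective q
  off_poles : ∀ j s, q j ≠ D.X s
  zero : ∀ j, laxEntry D K 0 1 (q j) = 0
  value : ∀ j, laxEntry D K 0 0 (q j) = p j

variable {D : DeformationData n} {K K' B : PolarCoeffs n} {q p : Fin g → ℂ}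

theorem differentiableAt_laxEntry (D : DeformationData n) (K : PolarCoeffs n) (i j : Fin 2) {z : ℂ}
    (hz : ∀ s, z ≠ D.X s) : DifferentiableAt ℂ (laxEntry D K i j) z :=
  differentiableAt_ratFn _ _ _ _ _ hz

theorem differentiableAt_auxEntry (D : DeformationData n) (K : PolarCoeffs n) (i j : Fin 2) {z : ℂ}
    (hz : ∀ s, z ≠ D.X s) : DifferentiableAt ℂ (auxEntry D K i j) z :=
  differentiableAt_ratFn _ _ _ _ _ hz

/-- By the normalization, the `(1,2)` entry is `z^{rInf-3} + O(z^{rInf-4})` at infinity. -/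
theorem IsLaxJet.hasTrunc_lax01_inv (h : IsLaxJet D K K' B) :
    HasTrunc 2 (fun x => x ^ (D.rInf - 1) * x⁻¹ * laxEntry D K 0 1 x⁻¹) X := by
  have hR := h.one_le_rInf
  have h1 := hasTrunc_ratFn_inv_pred hR h.one_le_r D.X (fun k => K.inf (k + 1) 0 1)
    (fun s k => K.fin s k 0 1)
  refine (h1.mono (show 2 ≤ D.rInf + 1 by omega)).congr_mod (X_pow_dvd_iff.2 fun d hd => ?_)
  change ((infPoly D K 0 1 + _) - X).coeff d = 0
  interval_cases d
  · rw [coeff_sub, coeff_add, coeff_zero_infPoly D hR, h.lead, coeff_C_mul, coeff_X_pow,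
      if_neg (by omega)]
    simp
  · have e2 := h.sublead
    have hr := h.one_le_r
    simp only [infPoly, coeff_sub, coeff_add, finsetSum_coeff, coeff_C_mul, coeff_X_pow, mul_ite,
      mul_one, mul_zero, coeff_X_one]
    rw [subleadAtInfinity] at e2
    rw [sub_eq_zero, ← e2]
    rcases Nat.lt_or_ge 2 D.rInf with h3 | h3
    · rw [if_pos (show 3 ≤ D.rInf from h3), if_neg (by omega), if_neg (by omega), add_zero, add_zero,
        Finset.sum_eq_single (D.rInf - 3)]
      · rw [if_pos (by omega), show D.rInf - 3 + 1 = D.rInf - 2 by omega]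
      · intro k hk hne
        rw [Finset.mem_range] at hk
        rw [if_neg (by omega)]
      · intro hk; rw [Finset.mem_range] at hk; omega
    · rcases Nat.lt_or_ge 1 D.rInf with h2 | h2
      · have h2 : D.rInf = 2 := by omega
        simp [h2, Matrix.sum_apply]
      · have h2 : D.rInf = 1 := by omega
        simp only [h2]
        simp only [Nat.sub_self, Finset.range_zero, Finset.sum_empty, zero_add, polarMoment₁]
        norm_num
        rw [Matrix.sum_apply]
        refine Finset.sum_congr rfl fun s _ => ?_
        rw [if_pos (show 0 < D.r s from hr s), Matrix.add_apply, Matrix.smul_apply, smul_eq_mul]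
        congr 1
        by_cases h2 : 1 < D.r s
        · rw [if_pos h2, if_pos (show 2 ≤ D.r s from h2)]
        · rw [if_neg h2, if_neg (show ¬ 2 ≤ D.r s from h2)]; rfl

theorem hasTrunc_zero_of_continuousAt' {f : ℂ → ℂ} (hf : ContinuousAt f 0) (k : ℕ) :
    HasTrunc k (fun x => x ^ k * f x) 0 := by
  have := (isBigO_refl (fun x : ℂ => x ^ k) (𝓝[≠] 0)).mul (isBigO_one_of_continuousAt hf)
  exact HasTrunc.of_isBigO (this.congr_right fun x => mul_one _)

/-- The `(1,2)` entry is determined by its zeros, its poles and its normalization. -/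
theorem IsLaxJet.lax01_eq (h : IsLaxJet D K K' B) (a : IsDarboux D K q p) {z : ℂ}
    (hz : ∀ s, z ≠ D.X s) :
    laxEntry D K 0 1 z = (∏ j, (z - q j)) * (∏ s, (z - D.X s) ^ D.r s)⁻¹ := by
  have hne : ∀ z, (∀ s, z ≠ D.X s) → ∏ s, (z - D.X s) ^ D.r s ≠ 0 := fun z hz =>
    Finset.prod_ne_zero_iff.2 fun s _ => pow_ne_zero _ (sub_ne_zero.2 (hz s))
  rw [← sub_eq_zero]
  refine eq_zero_of_interpolation a.genus a.injective a.off_poles (h := fun z => laxEntry D K 0 1 z -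
    (∏ j, (z - q j)) * (∏ s, (z - D.X s) ^ D.r s)⁻¹) (fun z hz => ?_) (fun j => ?_) (fun s => ?_) ?_
    z hz
  · exact (differentiableAt_laxEntry D K 0 1 hz).fun_sub (DifferentiableAt.mul (by fun_prop)
      (DifferentiableAt.inv (by fun_prop) (hne z hz)))
  · rw [a.zero, Finset.prod_eq_zero (Finset.mem_univ j) (sub_self _), zero_mul, sub_zero]
  · have hc : ContinuousAt (fun x => (∏ j, (D.X s + x - q j)) *
        (∏ s' ∈ Finset.univ.erase s, (D.X s + x - D.X s') ^ D.r s')⁻¹) 0 := by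
      refine ContinuousAt.mul (by fun_prop) (ContinuousAt.inv₀ (by fun_prop) ?_)
      rw [add_zero]
      exact Finset.prod_ne_zero_iff.2 fun s' hs' => pow_ne_zero _
        (sub_ne_zero.2 (h.X_injective.ne (Finset.ne_of_mem_erase hs').symm))
    refine ((hasTrunc_laxEntry D h.X_injective K s 0 1).isBigO_one.sub
      (isBigO_one_of_continuousAt hc)).congr' ?_ EventuallyEq.rfl
    filter_upwards [self_mem_nhdsWithin] with x hx
    have hx : x ≠ 0 := hx
    rw [← Finset.mul_prod_erase _ _ (Finset.mem_univ s), add_sub_cancel_left, mul_inv]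
    field_simp
  · have hR := h.one_le_rInf
    have hc1 : DifferentiableAt ℂ (fun x => (∏ j, (1 - x * q j) ^ 1) *
        (∏ s, (1 - x * D.X s) ^ D.r s)⁻¹) 0 := by
      refine DifferentiableAt.mul (by fun_prop) (DifferentiableAt.inv (by fun_prop) ?_)
      simp
    have h2 : HasTrunc 1 (fun x => (∏ j, (1 - x * q j) ^ 1) *
        (∏ s, (1 - x * D.X s) ^ D.r s)⁻¹) 1 := by
      have := hc1.isBigO_sub.mono (nhdsWithin_le_nhds (s := {0}ᶜ))
      simpa [HasTrunc] using this
    have h3 := (h.hasTrunc_lax01_inv.pow_mul 2).sub ((h2.pow_mul 3))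
    rw [show (X : ℂ[X]) ^ 2 * X - X ^ 3 * 1 = 0 by ring] at h3
    refine h3.isBigO.congr' ?_ EventuallyEq.rfl
    filter_upwards [self_mem_nhdsWithin] with x hx
    have hx : x ≠ 0 := hx
    rw [← prod_inv_sub_eq _ _ _ hx, ← prod_inv_sub_eq _ _ _ hx]
    simp only [pow_one, Finset.sum_const, Finset.card_univ, Fintype.card_fin, smul_eq_mul, mul_one]
    obtain ⟨m, hm⟩ : ∃ m, D.rInf = m + 1 := ⟨D.rInf - 1, by omega⟩
    have e : x ^ D.rInf * x ^ (∑ s, D.r s) = x ^ g * x ^ 3 := by rw [← pow_add, ← pow_add, a.genus]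
    have hxr : x ^ (∑ s, D.r s) ≠ 0 := pow_ne_zero _ hx
    have e2 : x ^ 3 * x ^ g * (x ^ (∑ s, D.r s))⁻¹ = x ^ D.rInf := by
      field_simp
      rw [mul_comm (x ^ 3), ← e, mul_comm]
    have e3 : x ^ 2 * (x ^ (D.rInf - 1) * x⁻¹) = x ^ D.rInf := by
      rw [hm, Nat.add_sub_cancel, pow_succ x m]; field_simp
    rw [mul_inv]
    linear_combination laxEntry D K 0 1 x⁻¹ * e3
      - (∏ j, (x⁻¹ - q j)) * (∏ s, (x⁻¹ - D.X s) ^ D.r s)⁻¹ * e2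

theorem HasTrunc.tendsto {N : ℕ} {f : ℂ → ℂ} {P : ℂ[X]} (hf : HasTrunc N f P) (hN : N ≠ 0) :
    Tendsto f (𝓝[≠] 0) (𝓝 (P.coeff 0)) := by
  have h1 : Tendsto (fun x : ℂ => x ^ N) (𝓝[≠] 0) (𝓝 0) := by
    have : Tendsto (fun x : ℂ => x ^ N) (𝓝 0) (𝓝 (0 ^ N)) := (continuous_pow N).tendsto 0
    rw [zero_pow hN] at this
    exact this.mono_left nhdsWithin_le_nhds
  have h2 := IsBigO.trans_tendsto hf h1
  have h3 : Tendsto (fun x => P.eval x) (𝓝[≠] (0 : ℂ)) (𝓝 (P.eval 0)) :=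
    (P.continuous.tendsto 0).mono_left nhdsWithin_le_nhds
  rw [← coeff_zero_eq_eval_zero] at h3
  simpa using h2.add h3

/-- The leading polar coefficient of the `(1,2)` entry does not vanish at `X_s`, since none of the
apparent singularities is there. -/
theorem IsLaxJet.coeff_zero_finPoly_ne_zero (h : IsLaxJet D K K' B) (a : IsDarboux D K q p)
    (s : Fin n) : (finPoly D K s 0 1).coeff 0 ≠ 0 := by
  have hr := h.one_le_r s
  have h1 := (hasTrunc_laxEntry D h.X_injective K s 0 1).tendsto (by omega)
  have hne : ∏ s' ∈ Finset.univ.erase s, (D.X s + 0 - D.X s') ^ D.r s' ≠ 0 := by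
    rw [add_zero]
    exact Finset.prod_ne_zero_iff.2 fun s' hs' => pow_ne_zero _
        (sub_ne_zero.2 (h.X_injective.ne (Finset.ne_of_mem_erase hs').symm))
  have hc : ContinuousAt (fun x => (∏ j, (D.X s + x - q j)) *
      (∏ s' ∈ Finset.univ.erase s, (D.X s + x - D.X s') ^ D.r s')⁻¹) 0 :=
    ContinuousAt.mul (by fun_prop) (ContinuousAt.inv₀ (by fun_prop) hne)
  have h2 := hc.tendsto.mono_left (nhdsWithin_le_nhds (s := {0}ᶜ))
  have h3 := tendsto_nhds_unique (h1.congr' ?_) h2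
  · rw [h3]
    refine mul_ne_zero (Finset.prod_ne_zero_iff.2 fun j _ => ?_) (inv_ne_zero hne)
    rw [add_zero, sub_ne_zero]
    exact (a.off_poles j s).symm
  · filter_upwards [h.eventually_off_poles s, self_mem_nhdsWithin] with x hx hx0
    have hx0 : x ≠ 0 := hx0
    rw [h.lax01_eq a hx, ← Finset.mul_prod_erase _ _ (Finset.mem_univ s), add_sub_cancel_left,
      mul_inv]
    field_simp

theorem coeff_infPoly (D : DeformationData n) (K : PolarCoeffs n) (i j : Fin 2) {k : ℕ}
    (hk : k < D.rInf - 1) : (infPoly D K i j).coeff (D.rInf - 1 - 1 - k) = K.inf (k + 1) i j := by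
  simp only [infPoly, coeff_add, finsetSum_coeff, coeff_C_mul, coeff_X_pow, mul_ite, mul_one,
    mul_zero]
  rw [if_neg (by omega), add_zero, Finset.sum_eq_single k]
  · rw [if_pos rfl]
  · intro k' hk' hne
    rw [Finset.mem_range] at hk'
    rw [if_neg (by omega)]
  · intro hk'; rw [Finset.mem_range] at hk'; omega

theorem IsLaxJet.trace_eq (h : IsLaxJet D K K' B) (z : ℂ) :
    laxEntry D K 0 0 z + laxEntry D K 1 1 z = D.P1 z := by
  rw [laxEntry, laxEntry, ← ratFn_add, P1_eq_ratFn]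
  have h1 : ∀ k < D.rInf - 1, K.inf (k + 1) 0 0 + K.inf (k + 1) 1 1 =
      -(D.tInf 0 (k + 1) + D.tInf 1 (k + 1)) := by
    intro k hk
    have := X_pow_dvd_iff.1 h.trace_inf (D.rInf - 1 - 1 - k) (by omega)
    rw [coeff_sub, coeff_add, coeff_infPoly D K _ _ hk, coeff_infPoly D K _ _ hk, coeff_add,
      coeff_neg, coeff_neg, coeff_polarPoly, coeff_polarPoly, if_pos (by omega),
      show D.rInf - 1 - (D.rInf - 1 - 1 - k) = k + 1 by omega] at this
    rw [if_pos (by omega)] at this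
    linear_combination this
  have h2 : ∀ s, ∀ k < D.r s, K.fin s k 0 0 + K.fin s k 1 1 = D.tX s 0 k + D.tX s 1 k := by
    intro s k hk
    have := X_pow_dvd_iff.1 (h.trace_fin s) (D.r s - 1 - k) (by omega)
    simp only [finPoly, coeff_sub, coeff_add, coeff_polarPoly] at this
    rw [if_pos (by omega), if_pos (by omega), if_pos (by omega), if_pos (by omega),
      show D.r s - 1 - (D.r s - 1 - k) = k by omega] at this
    linear_combination this
  rw [ratFn, ratFn]
  congr 1
  · exact Finset.sum_congr rfl fun k hk => by rw [h1 k (Finset.mem_range.1 hk)]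
  · exact Finset.sum_congr rfl fun s _ => Finset.sum_congr rfl fun k hk => by
      rw [h2 s k (Finset.mem_range.1 hk)]

end

section

/-! ### The resolvent of the Darboux coordinates -/

variable {n g : ℕ}

theorem hasTrunc_geom (N : ℕ) (b : ℂ) :
    HasTrunc N (fun x => (1 - x * b)⁻¹) (∑ k ∈ Finset.range N, C (b ^ k) * X ^ k) := by
  have hc : ContinuousAt (fun x : ℂ => b ^ N * (1 - x * b)⁻¹) 0 :=
    ContinuousAt.mul continuousAt_const (ContinuousAt.inv₀ (by fun_prop) (by simp))
  have h1 := ((isBigO_refl (fun x : ℂ => x ^ N) (𝓝[≠] 0)).mul (isBigO_one_of_continuousAt hc))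
  have hne : ∀ᶠ x : ℂ in 𝓝[≠] 0, 1 - x * b ≠ 0 := by
    have : ContinuousAt (fun x : ℂ => 1 - x * b) 0 := by fun_prop
    exact (this.eventually_ne (by simp)).filter_mono nhdsWithin_le_nhds
  refine h1.congr' ?_ (Eventually.of_forall fun x => mul_one _)
  filter_upwards [hne] with x hx
  have h2 := mul_neg_geom_sum (x * b) N
  simp only [eval_finsetSum, eval_mul, eval_C, eval_pow, eval_X]
  have h3 : ∑ k ∈ Finset.range N, b ^ k * x ^ k = ∑ k ∈ Finset.range N, (x * b) ^ k :=
    Finset.sum_congr rfl fun k _ => by rw [mul_pow, mul_comm]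
  rw [h3]
  field_simp
  rw [h2, mul_pow]
  ring

theorem hasTrunc_inv_sub (N : ℕ) {c : ℂ} (hc : c ≠ 0) :
    HasTrunc N (fun x => (x - c)⁻¹) (-∑ k ∈ Finset.range N, C ((c ^ (k + 1))⁻¹) * X ^ k) := by
  have h := (hasTrunc_geom N c⁻¹).const_mul (-c⁻¹)
  have e : C (-c⁻¹) * ∑ k ∈ Finset.range N, C (c⁻¹ ^ k) * X ^ k =
      -∑ k ∈ Finset.range N, C ((c ^ (k + 1))⁻¹) * X ^ k := by
    rw [Finset.mul_sum, ← Finset.sum_neg_distrib]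
    refine Finset.sum_congr rfl fun k _ => ?_
    rw [← mul_assoc, ← C_mul, ← neg_mul, ← C_neg]
    congr 2
    rw [pow_succ, mul_inv, inv_pow]; ring
  rw [e] at h
  refine h.congr_of_ne fun x _ => ?_
  rw [neg_mul, ← mul_inv, neg_inv]
  congr 1
  field_simp
  ring

/-- The rational function `ν_{∞,-1} z + ν_{∞,0} + ∑ μ_i / (z - q_i)`. -/
noncomputable def resolvent (q : Fin g → ℂ) (y : ℂ × ℂ × (Fin g → ℂ)) (z : ℂ) : ℂ :=
  y.1 * z + y.2.1 + ∑ i, y.2.2 i * (z - q i)⁻¹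

/-- The product of `resolvent q y` and `f`, with its poles at the `q_i` removed. -/
noncomputable def resolventMul (q : Fin g → ℂ) (y : ℂ × ℂ × (Fin g → ℂ)) (f : ℂ → ℂ) (z : ℂ) : ℂ :=
  (y.1 * z + y.2.1) * f z + ∑ i, y.2.2 i * dslope f (q i) z

theorem dslope_eq_of_ne (f : ℂ → ℂ) {a z : ℂ} (hz : z ≠ a) :
    dslope f a z = (z - a)⁻¹ * (f z - f a) := by
  rw [dslope_of_ne f hz, slope_def_field, div_eq_inv_mul]

theorem resolventMul_eq (q : Fin g → ℂ) (y : ℂ × ℂ × (Fin g → ℂ)) (f : ℂ → ℂ) {z : ℂ}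
    (hz : ∀ i, z ≠ q i) :
    resolventMul q y f z = resolvent q y z * f z - ∑ i, y.2.2 i * f (q i) * (z - q i)⁻¹ := by
  rw [resolventMul, resolvent, add_mul (y.1 * z + y.2.1) _ (f z), add_sub_assoc, Finset.sum_mul,
    ← Finset.sum_sub_distrib]
  congr 1
  refine Finset.sum_congr rfl fun i _ => ?_
  rw [dslope_eq_of_ne f (hz i)]
  ring

theorem differentiableAt_dslope {Y : Fin n → ℂ} {f : ℂ → ℂ}
    (hf : ∀ z, (∀ s, z ≠ Y s) → DifferentiableAt ℂ f z) {a : ℂ} (ha : ∀ s, a ≠ Y s) {z : ℂ}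
    (hz : ∀ s, z ≠ Y s) : DifferentiableAt ℂ (dslope f a) z := by
  have hU := isOpen_off_poles Y
  have h1 : DifferentiableOn ℂ f {z | ∀ s, z ≠ Y s} := fun z hz =>
    (hf z hz).differentiableWithinAt
  exact ((Complex.differentiableOn_dslope (hU.mem_nhds ha)).2 h1).differentiableAt (hU.mem_nhds hz)

theorem differentiableAt_resolventMul {Y : Fin n → ℂ} {f : ℂ → ℂ}
    (hf : ∀ z, (∀ s, z ≠ Y s) → DifferentiableAt ℂ f z) {q : Fin g → ℂ} (hq : ∀ i s, q i ≠ Y s)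
    (y : ℂ × ℂ × (Fin g → ℂ)) {z : ℂ} (hz : ∀ s, z ≠ Y s) :
    DifferentiableAt ℂ (resolventMul q y f) z := by
  unfold resolventMul
  refine DifferentiableAt.fun_add (DifferentiableAt.fun_mul (by fun_prop) (hf z hz))
    (DifferentiableAt.fun_sum fun i _ => DifferentiableAt.const_mul ?_ _)
  exact differentiableAt_dslope hf (hq i) hz

variable {D : DeformationData n} {K K' B : PolarCoeffs n} {q p : Fin g → ℂ}
  {y : ℂ × ℂ × (Fin g → ℂ)}

/-- The linear system for `μ` says that the resolvent has the expansion `nuPoly` at each finite pole. -/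
theorem hasTrunc_resolvent (hy : D.IsNuMu q y) (hq : ∀ i s, q i ≠ D.X s) (s : Fin n) :
    HasTrunc (D.r s) (fun x => resolvent q y (D.X s + x)) (nuPoly D s) := by
  have h1 := HasTrunc.poly (D.r s) (C y.1 * X + C (y.2.1 + y.1 * D.X s))
  have h2 := HasTrunc.sum (Finset.univ) fun i (_ : i ∈ Finset.univ) =>
    (hasTrunc_inv_sub (D.r s) (sub_ne_zero.2 (hq i s))).const_mul (y.2.2 i)
  refine ((h1.add h2).congr_of_ne fun x _ => ?_).congr_mod (X_pow_dvd_iff.2 fun d hd => ?_)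
  · simp only [resolvent, eval_add, eval_mul, eval_C, eval_X]
    have e : ∀ i, D.X s + x - q i = x - (q i - D.X s) := fun i => by ring
    simp only [e]
    ring
  · have h4 := hy.2.2.2 s d (Finset.mem_range.2 hd)
    simp only [div_eq_mul_inv] at h4
    simp only [nuPoly, coeff_sub, coeff_add, finsetSum_coeff, coeff_C_mul, coeff_neg, coeff_X_pow,
      mul_ite, mul_one, mul_zero, Finset.sum_ite_eq, Finset.mem_range, hd, if_true, mul_neg,
      Finset.sum_neg_distrib, h4, coeff_X, coeff_C]
    rcases Nat.lt_trichotomy d 1 with h | h | h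
    · have : d = 0 := by omega
      subst this; simp; ring
    · subst h; simp
    · simp [show ¬ 1 = d by omega, show ¬ d = 0 by omega, show ¬ d = 1 by omega]

/-- The linear system for `μ` says that the resolvent has the expansion `z * nuInfPoly` at infinity. -/
theorem hasTrunc_resolvent_inv (hy : D.IsNuMu q y) :
    HasTrunc (D.rInf - 1) (fun x => x * resolvent q y x⁻¹) (nuInfPoly D) := by
  have h1 := HasTrunc.poly (D.rInf - 1) (C y.1 + C y.2.1 * X)
  have h2 := HasTrunc.sum (Finset.univ) fun i (_ : i ∈ Finset.univ) =>
    ((((hasTrunc_geom (D.rInf - 1) (q i)).const_mul (y.2.2 i)).pow_mul 2).mono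
      (Nat.le_add_right (D.rInf - 1) 2))
  refine ((h1.add h2).congr_of_ne fun x hx => ?_).congr_mod (X_pow_dvd_iff.2 fun d hd => ?_)
  · simp only [resolvent, eval_add, eval_mul, eval_C, eval_X, mul_add, Finset.mul_sum]
    congr 1
    · field_simp
    · refine Finset.sum_congr rfl fun i _ => ?_
      rw [show x⁻¹ - q i = x⁻¹ * (1 - x * q i) by field_simp, mul_inv, inv_inv]
      ring
  · obtain ⟨h3, h4, h5, -⟩ := hy
    simp only [nuInfPoly, coeff_sub, coeff_add, finsetSum_coeff, coeff_C_mul, coeff_X_pow, mul_ite,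
      mul_one, mul_zero, Finset.sum_ite_eq, Finset.mem_range, hd, if_true, coeff_X, coeff_C,
      coeff_X_pow_mul']
    rcases Nat.lt_trichotomy d 1 with h | h | h
    · have : d = 0 := by omega
      subst this; simp [h3 (by omega)]
    · subst h; simp [h4 (by omega)]
    · have := h5 (d - 1) (Finset.mem_Icc.2 ⟨by omega, by omega⟩)
      rw [show d - 1 + 1 = d by omega, show d - 1 - 1 = d - 2 by omega] at this
      simp [show ¬ 1 = d by omega, show ¬ d = 0 by omega, show 2 ≤ d from h,
        show d - 2 < D.rInf - 1 by omega, this]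

/-- Near a finite pole, subtracting `resolventMul q y f` amounts to subtracting `nuPoly * f`. -/
theorem isBigO_sub_resolventMul (hy : D.IsNuMu q y) (hq : ∀ i s, q i ≠ D.X s) (s : Fin n)
    {a f c : ℂ → ℂ} {P : ℂ[X]} (hf : HasTrunc (D.r s) (fun x => x ^ D.r s * f (D.X s + x)) P)
    (ha : HasTrunc (D.r s) (fun x => x ^ D.r s * (a (D.X s + x)
      - (nuPoly D s).eval x * f (D.X s + x) - c x)) 0) :
    (fun x => a (D.X s + x) - resolventMul q y f (D.X s + x) - c x) =O[𝓝[≠] (0 : ℂ)]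
      (fun _ => (1 : ℂ)) := by
  have h1 := ((hasTrunc_resolvent hy hq s).sub (HasTrunc.poly _ (nuPoly D s))).mul hf
  rw [sub_self, zero_mul] at h1
  have h2 := (ha.sub h1).isBigO_of_dvd (by simp)
  have hc : ContinuousAt (fun x => ∑ i, y.2.2 i * f (q i) * (D.X s + x - q i)⁻¹) 0 := by
    refine tendsto_finsetSum _ fun i _ => ContinuousAt.mul continuousAt_const
      (ContinuousAt.inv₀ (by fun_prop) ?_)
    rw [add_zero, sub_ne_zero]
    exact (hq i s).symm
  have h3 := (isBigO_refl (fun x : ℂ => (x ^ D.r s)⁻¹) (𝓝[≠] 0)).mul h2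
  have h4 : ∀ᶠ x in 𝓝[≠] (0 : ℂ), ∀ i, D.X s + x ≠ q i := by
    refine eventually_all.2 fun i => ?_
    have : ContinuousAt (fun x : ℂ => D.X s + x) 0 := by fun_prop
    exact (this.eventually_ne (by rw [add_zero]; exact (hq i s).symm)).filter_mono
      nhdsWithin_le_nhds
  have h5 : (fun x => a (D.X s + x) - resolvent q y (D.X s + x) * f (D.X s + x) - c x)
      =O[𝓝[≠] (0 : ℂ)] (fun _ => (1 : ℂ)) := by
    refine h3.congr' ?_ ?_
    · filter_upwards [self_mem_nhdsWithin] with x hx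
      have hx : x ≠ 0 := hx
      field_simp
      ring
    · filter_upwards [self_mem_nhdsWithin] with x hx
      have hx : x ≠ 0 := hx
      field_simp
  refine (h5.add (isBigO_one_of_continuousAt hc)).congr' ?_ EventuallyEq.rfl
  filter_upwards [h4] with x hx
  rw [resolventMul_eq q y f hx]
  ring

/-- At infinity, subtracting `resolventMul q y f` amounts to subtracting `z * nuInfPoly * f`. -/
theorem isBigO_sub_resolventMul_inv (hy : D.IsNuMu q y)
    {a f c : ℂ → ℂ} {P : ℂ[X]} {k : ℕ} (hk : k ≤ 1)
    (hf : HasTrunc 1 (fun x => x ^ (D.rInf - 1) * x⁻¹ * f x⁻¹) P) (hP : X ^ k ∣ P)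
    (ha : HasTrunc (D.rInf - 1 + k) (fun x => x ^ (D.rInf - 1) * (a x⁻¹
      - x⁻¹ * (nuInfPoly D).eval x * f x⁻¹ - c x⁻¹)) 0) :
    (fun x => a x⁻¹ - resolventMul q y f x⁻¹ - c x⁻¹) =O[𝓝[≠] (0 : ℂ)] (fun x => x ^ k) := by
  have h0 := ((hasTrunc_resolvent_inv hy).sub (HasTrunc.poly _ (nuInfPoly D)))
  rw [sub_self] at h0
  have h1 := h0.isBigO.mul ((hf.mono hk).isBigO_of_dvd hP)
  have h2 := ha.isBigO.sub (h1.congr_right fun x => (pow_add x _ _).symm)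
  have h3 := (isBigO_refl (fun x : ℂ => (x ^ (D.rInf - 1))⁻¹) (𝓝[≠] 0)).mul h2
  have h4 : ∀ᶠ x in 𝓝[≠] (0 : ℂ), ∀ i, x⁻¹ ≠ q i := IsLaxJet.eventually_off_poles_inv q
  have h5 : (fun x => a x⁻¹ - resolvent q y x⁻¹ * f x⁻¹ - c x⁻¹)
      =O[𝓝[≠] (0 : ℂ)] (fun x => x ^ k) := by
    refine h3.congr' ?_ ?_
    · filter_upwards [self_mem_nhdsWithin] with x hx
      have hx : x ≠ 0 := hx
      field_simp
      ring
    · filter_upwards [self_mem_nhdsWithin] with x hx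
      have hx : x ≠ 0 := hx
      rw [pow_add]
      field_simp
  have h6 : (fun x : ℂ => ∑ i, y.2.2 i * f (q i) * (x⁻¹ - q i)⁻¹) =O[𝓝[≠] (0 : ℂ)]
      (fun x => x ^ k) := by
    refine IsBigO.fun_sum fun i _ => ?_
    have hc : ContinuousAt (fun x : ℂ => y.2.2 i * f (q i) * (1 - x * q i)⁻¹) 0 :=
      ContinuousAt.mul continuousAt_const (ContinuousAt.inv₀ (by fun_prop) (by simp))
    have h7 := (isBigO_pow_of_le hk).mul (isBigO_one_of_continuousAt hc)
    refine h7.congr' ?_ (Eventually.of_forall fun x => mul_one _)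
    filter_upwards [self_mem_nhdsWithin] with x hx
    have hx : x ≠ 0 := hx
    rw [show x⁻¹ - q i = x⁻¹ * (1 - x * q i) by field_simp, mul_inv, inv_inv]
    ring
  refine (h5.add h6).congr' ?_ EventuallyEq.rfl
  filter_upwards [h4] with x hx
  rw [resolventMul_eq q y f hx]
  ring

/-- The `(1,2)` entry of `A` is the `(1,2)` entry of `L` times the resolvent: the difference is entire,
because `L₁₂` vanishes at the poles `q_i` of the resolvent, and it tends to zero at infinity. -/
theorem IsLaxJet.aux01_eq (h : IsLaxJet D K K' B) (a : IsDarboux D K q p) (hy : D.IsNuMu q y)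
    {z : ℂ} (hz : ∀ s, z ≠ D.X s) :
    auxEntry D B 0 1 z = resolventMul q y (laxEntry D K 0 1) z := by
  have hR := h.one_le_rInf
  rw [← sub_eq_zero]
  refine eq_zero_of_tendsto_zero (f := fun z => auxEntry D B 0 1 z
    - resolventMul q y (laxEntry D K 0 1) z) (Set.finite_range D.X) (fun z hz => ?_) ?_ ?_ z ?_
  · have hz : ∀ s, z ≠ D.X s := fun s e => hz ⟨s, e.symm⟩
    exact (differentiableAt_auxEntry D B 0 1 hz).fun_sub (differentiableAt_resolventMul
      (fun z hz => differentiableAt_laxEntry D K 0 1 hz) a.off_poles y hz)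
  · rintro _ ⟨s, rfl⟩
    rw [← isBigO_shift]
    have h1 := (h.aux_sub_nu_lax_fin s (h.coeff_zero_finPoly_ne_zero a s)).1
    have h2 := isBigO_sub_resolventMul hy a.off_poles s (a := auxEntry D B 0 1) (c := fun _ => 0)
      (hasTrunc_laxEntry D h.X_injective K s 0 1) (by simpa using h1)
    simpa using h2
  · have h1 := h.aux_sub_nu_lax_inf.1
    have h2 := isBigO_sub_resolventMul_inv hy (a := auxEntry D B 0 1) (c := fun _ => 0)
      (k := 1) le_rfl (h.hasTrunc_lax01_inv.mono one_le_two) (by simp)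
      (by rw [Nat.sub_add_cancel hR]; simpa using h1)
    have h3 : (fun z => auxEntry D B 0 1 z - resolventMul q y (laxEntry D K 0 1) z)
        =O[Bornology.cobounded ℂ] (fun z => z⁻¹) := by
      rw [← isBigO_inv]; simpa using h2
    exact h3.trans_tendsto tendsto_inv₀_cobounded
  · rintro ⟨s, e⟩; exact hz s e.symm

/-- The `(1,1)` entry of `A` in terms of that of `L`.  The values of `L₁₁` at the poles `q_i` of the
resolvent have to be subtracted, and an additive constant remains undetermined. -/
theorem IsLaxJet.aux00_eq (h : IsLaxJet D K K' B) (a : IsDarboux D K q p) (hy : D.IsNuMu q y) :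
    ∃ κ, ∀ z, (∀ s, z ≠ D.X s) →
      auxEntry D B 0 0 z = resolventMul q y (laxEntry D K 0 0) z + cFun D κ z := by
  have hR := h.one_le_rInf
  obtain ⟨κ, hκ⟩ := exists_const_of_isBigO_one (f := fun z => auxEntry D B 0 0 z
    - resolventMul q y (laxEntry D K 0 0) z - cFun D 0 z) (Set.finite_range D.X) (fun z hz => by
      have hz : ∀ s, z ≠ D.X s := fun s e => hz ⟨s, e.symm⟩
      exact ((differentiableAt_auxEntry D B 0 0 hz).fun_sub (differentiableAt_resolventMul
        (fun z hz => differentiableAt_laxEntry D K 0 0 hz) a.off_poles y hz)).fun_sub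
        (hasDerivAt_cFun D 0 hz).differentiableAt) (by
      rintro _ ⟨s, rfl⟩
      rw [← isBigO_shift]
      have h1 := (h.aux_sub_nu_lax_fin s (h.coeff_zero_finPoly_ne_zero a s)).2
      have h2 := isBigO_sub_resolventMul hy a.off_poles s (a := auxEntry D B 0 0)
        (hasTrunc_laxEntry D h.X_injective K s 0 0) h1
      have hc : ContinuousAt (fun x => ∑ k ∈ Finset.Icc 1 (D.rInf - 1), D.cInf k * (D.X s + x) ^ k
          + ∑ s' ∈ Finset.univ.erase s, ∑ k ∈ Finset.Icc 1 (D.r s' - 1),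
            D.cX s' k / (D.X s + x - D.X s') ^ k) 0 := by
        refine ContinuousAt.add (tendsto_finsetSum _ fun k _ => by
            exact ContinuousAt.tendsto (by fun_prop)) ?_
        refine tendsto_finsetSum _ fun s' hs' => tendsto_finsetSum _ fun k _ => ?_
        refine ContinuousAt.div continuousAt_const (by fun_prop) (pow_ne_zero _ ?_)
        rw [add_zero, sub_ne_zero]
        exact h.X_injective.ne (Finset.ne_of_mem_erase hs').symm
      refine (h2.sub (isBigO_one_of_continuousAt hc)).congr_left fun x => ?_
      rw [cFun_eq D hR, ← Finset.add_sum_erase _ _ (Finset.mem_univ s), add_sub_cancel_left]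
      ring) (by
      rw [← isBigO_inv]
      have h1 := h.aux_sub_nu_lax_inf.2
      have h2 := isBigO_sub_resolventMul_inv hy (a := auxEntry D B 0 0)
        (c := fun z => ∑ k ∈ Finset.Icc 1 (D.rInf - 1), D.cInf k * z ^ k) (k := 0) zero_le_one
        ((hasTrunc_laxEntry_inv D hR h.one_le_r K 0 0).mono hR) (by simp) h1
      have hc : (fun x : ℂ => ∑ s, ∑ k ∈ Finset.Icc 1 (D.r s - 1), D.cX s k / (x⁻¹ - D.X s) ^ k)
          =O[𝓝[≠] (0 : ℂ)] (fun _ => (1 : ℂ)) := by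
        refine IsBigO.fun_sum fun s _ => IsBigO.fun_sum fun k _ => ?_
        have hc : ContinuousAt (fun x : ℂ => x ^ k * (D.cX s k * ((1 - x * D.X s) ^ k)⁻¹)) 0 :=
          ContinuousAt.mul (by fun_prop) (ContinuousAt.mul continuousAt_const
            (ContinuousAt.inv₀ (by fun_prop) (by simp)))
        refine (isBigO_one_of_continuousAt hc).congr' ?_ EventuallyEq.rfl
        filter_upwards [self_mem_nhdsWithin] with x hx
        have hx : x ≠ 0 := hx
        rw [show x⁻¹ - D.X s = x⁻¹ * (1 - x * D.X s) by field_simp, mul_pow, div_eq_mul_inv,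
          mul_inv, inv_pow, inv_inv]
        ring
      refine ((h2.congr_right fun x => pow_zero x).sub hc).congr_left fun x => ?_
      rw [cFun_eq D hR]
      ring)
  refine ⟨κ, fun z hz => ?_⟩
  have h1 := hκ z (by rintro ⟨s, e⟩; exact hz s e.symm)
  simp only [cFun_eq D hR] at h1 ⊢
  linear_combination h1

end

section

/-! ### The spectral function and the isospectral coefficients -/

variable {n g : ℕ}

/-- The rational function whose partial fraction coefficients are the isospectral coefficients. -/
noncomputable def spectralFun (D : DeformationData n) (K : PolarCoeffs n) (q : Fin g → ℂ) (z : ℂ) :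
    ℂ :=
  D.P2tilde z - (laxEntry D K 0 0 z * laxEntry D K 1 1 z - laxEntry D K 0 1 z * laxEntry D K 1 0 z)
    + D.hbar * (deriv (laxEntry D K 0 0) z + laxEntry D K 0 0 z * ∑ s, D.r s / (z - D.X s)
      - ∑ i, dslope (laxEntry D K 0 0) (q i) z)
    + if 3 ≤ D.rInf then D.hbar * D.tInf 0 (D.rInf - 1) * z ^ (D.rInf - 3) else 0

theorem coeff_polarPoly_mul {R : ℕ} (t₀ t₁ : ℕ → ℂ) {d : ℕ} (hd : d < R) :
    (polarPoly R t₀ * polarPoly R t₁).coeff d =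
      ∑ j ∈ Finset.range (d + 1), t₀ (R - 1 - j) * t₁ (R - 1 - (d - j)) := by
  rw [coeff_mul, Finset.Nat.sum_antidiagonal_eq_sum_range_succ_mk]
  refine Finset.sum_congr rfl fun j hj => ?_
  rw [Finset.mem_range] at hj
  rw [coeff_polarPoly, coeff_polarPoly, if_pos (by omega), if_pos (by omega)]

theorem deriv_laxEntry (D : DeformationData n) (K : PolarCoeffs n) (i j : Fin 2) {z : ℂ}
    (hz : ∀ s, z ≠ D.X s) : deriv (laxEntry D K i j) z =
      ratFnDeriv (D.rInf - 1) D.r D.X (fun k => K.inf (k + 1) i j) (fun s k => K.fin s k i j) z :=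
  (hasDerivAt_ratFn _ _ _ _ _ hz).deriv

variable {D : DeformationData n} {K K' B : PolarCoeffs n} {q p : Fin g → ℂ}

theorem differentiableAt_spectralFun (D : DeformationData n) (K : PolarCoeffs n) {q : Fin g → ℂ}
    (hq : ∀ i s, q i ≠ D.X s) {z : ℂ} (hz : ∀ s, z ≠ D.X s) :
    DifferentiableAt ℂ (spectralFun D K q) z := by
  have hL := fun i j => differentiableAt_laxEntry D K i j hz
  have hd : DifferentiableAt ℂ (deriv (laxEntry D K 0 0)) z := by
    have hU := isOpen_off_poles D.X
    have h1 : DifferentiableOn ℂ (laxEntry D K 0 0) {z | ∀ s, z ≠ D.X s} := fun z hz =>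
      (differentiableAt_laxEntry D K 0 0 hz).differentiableWithinAt
    exact (h1.deriv hU).differentiableAt (hU.mem_nhds hz)
  unfold spectralFun
  refine DifferentiableAt.fun_add (DifferentiableAt.fun_add (DifferentiableAt.fun_sub
    (differentiableAt_P2tilde D hz) (DifferentiableAt.fun_sub ((hL 0 0).fun_mul (hL 1 1))
      ((hL 0 1).fun_mul (hL 1 0)))) (DifferentiableAt.const_mul (DifferentiableAt.fun_sub
      (hd.fun_add ((hL 0 0).fun_mul (hasDerivAt_sum_div_sub _ D.X hz).differentiableAt))
      (DifferentiableAt.fun_sum fun i _ => ?_)) _)) ?_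
  · exact differentiableAt_dslope (fun z hz => differentiableAt_laxEntry D K 0 0 hz) (hq i) hz
  · split_ifs <;> fun_prop

/-- At `q_j` the spectral function takes the value prescribed by the system for the isospectral
coefficients.  The sum over `i ≠ j` comes from the difference quotients of `L₁₁`, whose diagonal
term cancels the derivative of `L₁₁`. -/
theorem IsLaxJet.spectralFun_apply (h : IsLaxJet D K K' B) (a : IsDarboux D K q p) (j : Fin g) :
    spectralFun D K q (q j) = hTarget D q p j := by
  have htr := h.trace_eq (q j)
  rw [a.value] at htr
  have e : ∑ i, dslope (laxEntry D K 0 0) (q i) (q j) = deriv (laxEntry D K 0 0) (q j)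
      - ∑ i ∈ Finset.univ.erase j, (p i - p j) / (q j - q i) := by
    rw [← Finset.add_sum_erase _ _ (Finset.mem_univ j), dslope_same, sub_eq_add_neg,
      ← Finset.sum_neg_distrib]
    congr 1
    refine Finset.sum_congr rfl fun i hi => ?_
    rw [dslope_eq_of_ne _ (a.injective.ne (Finset.ne_of_mem_erase hi).symm), a.value, a.value]
    ring
  have e2 : ∑ s, D.hbar * D.r s / (q j - D.X s) = D.hbar * ∑ s, D.r s / (q j - D.X s) := by
    rw [Finset.mul_sum]; exact Finset.sum_congr rfl fun s _ => by ring
  rw [spectralFun, hTarget, e, e2, a.zero, a.value]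
  linear_combination -p j * htr

/-- The determinant and `P̃_2` have the same leading polar coefficients at a finite pole. -/
theorem IsLaxJet.isBigO_det_fin (h : IsLaxJet D K K' B) (s : Fin n) :
    (fun x => x ^ D.r s * (D.P2tilde (D.X s + x) -
      (laxEntry D K 0 0 (D.X s + x) * laxEntry D K 1 1 (D.X s + x)
        - laxEntry D K 0 1 (D.X s + x) * laxEntry D K 1 0 (D.X s + x)))) =O[𝓝[≠] (0 : ℂ)]
      (fun _ => (1 : ℂ)) := by
  have hl := hasTrunc_laxEntry D h.X_injective K s
  have h1 := (((hl 0 0).mul (hl 1 1)).sub ((hl 0 1).mul (hl 1 0))).congr_mod (h.det_fin s)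
  have hc : ContinuousAt (fun x => (∑ k ∈ Finset.range D.rInf, if k + 4 ≤ 2 * D.rInf then
      D.P2InfCoeff k * (D.X s + x) ^ (2 * D.rInf - 4 - k) else 0)
      + ∑ s' ∈ Finset.univ.erase s, ∑ k ∈ Finset.range (D.r s'),
        D.P2XCoeff s' k / (D.X s + x - D.X s') ^ (2 * D.r s' - k)) 0 := by
    refine ContinuousAt.add (tendsto_finsetSum _ fun k _ => ?_) ?_
    · exact ContinuousAt.tendsto (by split_ifs <;> fun_prop)
    · refine tendsto_finsetSum _ fun s' hs' => tendsto_finsetSum _ fun k _ => ?_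
      refine ContinuousAt.div continuousAt_const (by fun_prop) (pow_ne_zero _ ?_)
      rw [add_zero, sub_ne_zero]
      exact h.X_injective.ne (Finset.ne_of_mem_erase hs').symm
  have h2 := (HasTrunc.poly (D.r s) (∑ k ∈ Finset.range (D.r s), C (D.P2XCoeff s k) * X ^ k)).add
    ((hasTrunc_zero_of_continuousAt' hc (2 * D.r s)).mono (show D.r s ≤ 2 * D.r s by omega))
  have h3 := (h2.sub h1).isBigO_of_dvd (X_pow_dvd_iff.2 fun d hd => by
    rw [coeff_sub, coeff_add, coeff_sum_range, if_pos hd, coeff_zero, add_zero,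
      coeff_polarPoly_mul _ _ hd, sub_eq_zero]
    rfl)
  refine ((isBigO_refl (fun x : ℂ => (x ^ D.r s)⁻¹) (𝓝[≠] 0)).mul h3).congr' ?_ ?_
  · filter_upwards [self_mem_nhdsWithin] with x hx
    have hx : x ≠ 0 := hx
    have e : (x ^ D.r s)⁻¹ * ∑ k ∈ Finset.range (D.r s), D.P2XCoeff s k * x ^ k =
        x ^ D.r s * ∑ k ∈ Finset.range (D.r s), D.P2XCoeff s k / x ^ (2 * D.r s - k) := by
      rw [Finset.mul_sum, Finset.mul_sum]
      refine Finset.sum_congr rfl fun k hk => ?_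
      rw [Finset.mem_range] at hk
      obtain ⟨m, hm⟩ : ∃ m, D.r s = k + m := ⟨D.r s - k, by omega⟩
      rw [hm, show 2 * (k + m) - k = k + m + m by omega, pow_add _ (k + m), pow_add]
      field_simp
    rw [DeformationData.P2tilde, ← Finset.add_sum_erase _ _ (Finset.mem_univ s),
      add_sub_cancel_left]
    simp only [eval_finsetSum, eval_mul, eval_C, eval_pow, eval_X, mul_sub, mul_add]
    rw [e]
    have e2 : (x ^ D.r s)⁻¹ * x ^ (2 * D.r s) = x ^ D.r s := by
      rw [two_mul, pow_add]; field_simp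
    have e3 : (x ^ D.r s)⁻¹ * x ^ D.r s = 1 := inv_mul_cancel₀ (pow_ne_zero _ hx)
    generalize ∑ k ∈ Finset.range D.rInf, (if k + 4 ≤ 2 * D.rInf then
      D.P2InfCoeff k * (D.X s + x) ^ (2 * D.rInf - 4 - k) else 0) = S₁
    generalize ∑ s' ∈ Finset.univ.erase s, ∑ k ∈ Finset.range (D.r s'),
        D.P2XCoeff s' k / (D.X s + x - D.X s') ^ (2 * D.r s' - k) = S₂
    linear_combination (S₁ + S₂) * e2 - x ^ D.r s *
      (laxEntry D K 0 0 (D.X s + x) * laxEntry D K 1 1 (D.X s + x)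
        - laxEntry D K 0 1 (D.X s + x) * laxEntry D K 1 0 (D.X s + x)) * e3
  · filter_upwards [self_mem_nhdsWithin] with x hx
    exact inv_mul_cancel₀ (pow_ne_zero _ hx)

theorem X_dvd_euler (P : ℂ[X]) : X ∣ euler P := by
  rw [X_dvd_iff, coeff_euler]
  simp

/-- The spectral function has a pole of order at most `r_s` at `X_s`. -/
theorem IsLaxJet.isBigO_spectralFun (h : IsLaxJet D K K' B) (hq : ∀ i s, q i ≠ D.X s) (s : Fin n) :
    (fun x => x ^ D.r s * spectralFun D K q (D.X s + x)) =O[𝓝[≠] (0 : ℂ)] (fun _ => (1 : ℂ)) := by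
  have hr := h.one_le_r s
  have hl := hasTrunc_laxEntry D h.X_injective K s 0 0
  have hl1 := hl.isBigO_one
  have hd := hasTrunc_ratFnDeriv (D.rInf - 1) D.r h.X_injective (fun k => K.inf (k + 1) 0 0)
    (fun s k => K.fin s k 0 0) s
  -- the pole of order `r_s + 1` of the derivative is cancelled
  have h1 := ((hd.add (hl.const_mul (D.r s : ℂ))).mono hr).isBigO_of_dvd (by
    rw [pow_one]
    change X ∣ euler (finPoly D K s 0 0) - _ * (finPoly D K s 0 0) + _ * (finPoly D K s 0 0)
    rw [sub_add_cancel]; exact X_dvd_euler _)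
  have h2 : (fun x => x ^ D.r s * (deriv (laxEntry D K 0 0) (D.X s + x)
      + laxEntry D K 0 0 (D.X s + x) * (D.r s / x))) =O[𝓝[≠] (0 : ℂ)] (fun _ => (1 : ℂ)) := by
    refine ((isBigO_refl (fun x : ℂ => x⁻¹) (𝓝[≠] 0)).mul h1).congr' ?_ ?_
    · filter_upwards [self_mem_nhdsWithin, h.eventually_off_poles s] with x hx hx'
      have hx : x ≠ 0 := hx
      rw [deriv_laxEntry D K 0 0 hx', pow_succ]
      field_simp
    · filter_upwards [self_mem_nhdsWithin] with x hx
      rw [pow_one]; exact inv_mul_cancel₀ hx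
  have hc1 : ContinuousAt (fun x => ∑ s' ∈ Finset.univ.erase s,
      (D.r s' : ℂ) / (D.X s + x - D.X s')) 0 := by
    refine tendsto_finsetSum _ fun s' hs' => ContinuousAt.div continuousAt_const (by fun_prop) ?_
    rw [add_zero, sub_ne_zero]
    exact h.X_injective.ne (Finset.ne_of_mem_erase hs').symm
  have hc2 : ∀ i, ContinuousAt (fun x : ℂ => (D.X s + x - q i)⁻¹) 0 := by
    refine fun i => ContinuousAt.inv₀ (by fun_prop) ?_
    rw [add_zero, sub_ne_zero]
    exact (hq i s).symm
  have hc3 : ∀ i, ContinuousAt (fun x : ℂ => x ^ D.r s * laxEntry D K 0 0 (q i)) 0 := fun i => by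
    fun_prop
  have hc4 : ContinuousAt (fun x : ℂ => x ^ D.r s * if 3 ≤ D.rInf then
      D.hbar * D.tInf 0 (D.rInf - 1) * (D.X s + x) ^ (D.rInf - 3) else 0) 0 := by
    split_ifs <;> fun_prop
  have h3 := (hl1.mul (isBigO_one_of_continuousAt hc1)).congr_right fun x => one_mul _
  have h4 : (fun x => ∑ i, (x ^ D.r s * laxEntry D K 0 0 (D.X s + x)
      - x ^ D.r s * laxEntry D K 0 0 (q i)) * (D.X s + x - q i)⁻¹) =O[𝓝[≠] (0 : ℂ)]
      (fun _ => (1 : ℂ)) := by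
    refine IsBigO.fun_sum fun i _ => ?_
    exact ((hl1.sub (isBigO_one_of_continuousAt (hc3 i))).mul
      (isBigO_one_of_continuousAt (hc2 i))).congr_right fun x => one_mul _
  have h5 := ((h.isBigO_det_fin s).add (((h2.add h3).sub h4).const_mul_left D.hbar)).add
    (isBigO_one_of_continuousAt hc4)
  refine h5.congr' ?_ EventuallyEq.rfl
  have h6 : ∀ᶠ x in 𝓝[≠] (0 : ℂ), ∀ i, D.X s + x ≠ q i := by
    refine eventually_all.2 fun i => ?_
    have : ContinuousAt (fun x : ℂ => D.X s + x) 0 := by fun_prop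
    exact (this.eventually_ne (by rw [add_zero]; exact (hq i s).symm)).filter_mono
      nhdsWithin_le_nhds
  filter_upwards [h6] with x hx
  have e : ∑ i, (x ^ D.r s * laxEntry D K 0 0 (D.X s + x)
      - x ^ D.r s * laxEntry D K 0 0 (q i)) * (D.X s + x - q i)⁻¹ =
      x ^ D.r s * ∑ i, dslope (laxEntry D K 0 0) (q i) (D.X s + x) := by
    rw [Finset.mul_sum]
    refine Finset.sum_congr rfl fun i _ => ?_
    rw [dslope_eq_of_ne _ (hx i)]
    ring
  rw [e, spectralFun, ← Finset.add_sum_erase _ (fun s' => (D.r s' : ℂ) / (D.X s + x - D.X s'))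
    (Finset.mem_univ s), add_sub_cancel_left]
  ring

theorem hasTrunc_one_sub_pow_inv (b : ℂ) (m : ℕ) :
    HasTrunc 1 (fun x => ((1 - x * b) ^ m)⁻¹) 1 := by
  have hd : DifferentiableAt ℂ (fun x : ℂ => ((1 - x * b) ^ m)⁻¹) 0 :=
    DifferentiableAt.inv (by fun_prop) (by simp)
  have := hd.isBigO_sub.mono (nhdsWithin_le_nhds (s := {0}ᶜ))
  simpa [HasTrunc] using this

theorem inv_inv_sub_pow {x : ℂ} (hx : x ≠ 0) (b : ℂ) (m : ℕ) :
    ((x⁻¹ - b) ^ m)⁻¹ = x ^ m * ((1 - x * b) ^ m)⁻¹ := by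
  rw [show x⁻¹ - b = x⁻¹ * (1 - x * b) by field_simp, mul_pow, mul_inv, inv_pow, inv_inv]

/-- The first `rInf` coefficients of `det L` at infinity are the products `P2InfCoeff` of the times. -/
theorem IsLaxJet.hasTrunc_det_inv (h : IsLaxJet D K K' B) :
    HasTrunc D.rInf (fun x => (x ^ (D.rInf - 1) * x⁻¹) ^ 2 *
      (laxEntry D K 0 0 x⁻¹ * laxEntry D K 1 1 x⁻¹ - laxEntry D K 0 1 x⁻¹ * laxEntry D K 1 0 x⁻¹))
      (∑ k ∈ Finset.range D.rInf, C (D.P2InfCoeff k) * X ^ k) := by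
  have hl := hasTrunc_laxEntry_inv D h.one_le_rInf h.one_le_r K
  have h1 := (((hl 0 0).mul (hl 1 1)).sub ((hl 0 1).mul (hl 1 0))).congr_mod h.det_inf
  rw [neg_mul_neg] at h1
  refine (h1.congr_mod (X_pow_dvd_iff.2 fun d hd => ?_)).congr_of_ne fun x _ => by ring
  rw [coeff_sub, coeff_sum_range, if_pos hd, coeff_polarPoly_mul _ _ hd, sub_eq_zero]
  rfl

/-- The coefficient of `z^{rInf-3}`, up to `O(z^{rInf-4})`, of `P̃_2 - det L` at infinity. -/
noncomputable def detDefect (D : DeformationData n) : ℂ :=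
  if D.rInf = 1 then (∑ s, if D.r s = 1 then D.tX s 0 0 * D.tX s 1 0 else 0)
    - D.tInf 0 0 * D.tInf 1 0
  else if D.rInf = 2 then -(D.tInf 0 1 * D.tInf 1 0 + D.tInf 1 1 * D.tInf 0 0) else 0

/-- The difference `P̃_2 - det L` is `O(z^{rInf-4})` up to the explicit leading term, at order
`z^{rInf-3}`, that arises when `rInf ≤ 2`. -/
theorem IsLaxJet.hasTrunc_P2tilde_sub_det (h : IsLaxJet D K K' B) :
    HasTrunc 4 (fun x => x ^ D.rInf * (D.P2tilde x⁻¹ - (laxEntry D K 0 0 x⁻¹ * laxEntry D K 1 1 x⁻¹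
      - laxEntry D K 0 1 x⁻¹ * laxEntry D K 1 0 x⁻¹))) (C (detDefect D) * X ^ 3) := by
  have hR := h.one_le_rInf
  have h1 := h.hasTrunc_det_inv
  rcases Nat.lt_or_ge 1 D.rInf with h2 | h2
  · have hpol : HasTrunc D.rInf (fun x => x ^ (2 * D.rInf - 4) * D.P2tilde x⁻¹)
        (∑ k ∈ Finset.range D.rInf, if k + 4 ≤ 2 * D.rInf then C (D.P2InfCoeff k) * X ^ k else 0) := by
      have h3 := HasTrunc.sum Finset.univ fun s (_ : s ∈ Finset.univ) =>
        HasTrunc.sum (N := D.rInf) (Finset.range (D.r s)) fun k (hk : k ∈ Finset.range (D.r s)) =>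
        ((((hasTrunc_one_sub_pow_inv (D.X s) (2 * D.r s - k)).mono zero_le_one).const_mul
          (D.P2XCoeff s k)).pow_mul (2 * D.rInf - 4 + (2 * D.r s - k))).mono
          (by rw [Finset.mem_range] at hk; omega)
      have h4 := (HasTrunc.poly D.rInf (∑ k ∈ Finset.range D.rInf,
        if k + 4 ≤ 2 * D.rInf then C (D.P2InfCoeff k) * X ^ k else 0)).add h3
      refine (h4.congr_mod ?_).congr_of_ne fun x hx => ?_
      · rw [add_sub_cancel_left]
        refine Finset.dvd_sum fun s _ => Finset.dvd_sum fun k hk => ?_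
        rw [Finset.mem_range] at hk
        exact (pow_dvd_pow X (by omega)).mul_right _
      · rw [DeformationData.P2tilde, mul_add, eval_finsetSum, Finset.mul_sum, Finset.mul_sum]
        congr 1
        · refine Finset.sum_congr rfl fun k _ => ?_
          split_ifs with hk
          · obtain ⟨m, hm⟩ : ∃ m, 2 * D.rInf - 4 = k + m := ⟨2 * D.rInf - 4 - k, by omega⟩
            rw [hm, Nat.add_sub_cancel_left, pow_add]
            simp only [eval_mul, eval_C, eval_pow, eval_X]
            have e : x ^ m * x⁻¹ ^ m = 1 := by rw [← mul_pow, mul_inv_cancel₀ hx, one_pow]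
            linear_combination -(x ^ k * D.P2InfCoeff k) * e
          · simp
        · refine Finset.sum_congr rfl fun s _ => ?_
          rw [Finset.mul_sum]
          refine Finset.sum_congr rfl fun k _ => ?_
          rw [div_eq_mul_inv, inv_inv_sub_pow hx, pow_add]
          ring
    have h3 := hpol.sub h1
    have hpow : ∀ x : ℂ, x ≠ 0 → (x ^ (D.rInf - 1) * x⁻¹) ^ 2 = x ^ (2 * D.rInf - 4) := by
      intro x hx
      obtain ⟨m, hm⟩ : ∃ m, D.rInf = m + 2 := ⟨D.rInf - 2, by omega⟩
      rw [hm, show 2 * (m + 2) - 4 = 2 * m by omega, show m + 2 - 1 = m + 1 by omega,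
        pow_succ x m, mul_assoc, mul_inv_cancel₀ hx, mul_one, pow_mul']
    rcases Nat.lt_or_ge 2 D.rInf with h5 | h5
    · rw [detDefect, if_neg (by omega), if_neg (by omega), C_0, zero_mul]
      have h6 := h3.isBigO_of_dvd (by
        rw [← Finset.sum_sub_distrib]
        refine Finset.dvd_sum fun k hk => ?_
        rw [Finset.mem_range] at hk
        rw [if_pos (by omega), sub_self]
        exact dvd_zero _)
      refine HasTrunc.of_isBigO (((isBigO_refl (fun x : ℂ => (x ^ D.rInf)⁻¹ * x ^ 4) (𝓝[≠] 0)).mul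
        h6).congr' ?_ ?_)
      · filter_upwards [self_mem_nhdsWithin] with x hx
        have hx : x ≠ 0 := hx
        rw [hpow x hx]
        obtain ⟨m, hm⟩ : ∃ m, D.rInf = m + 2 := ⟨D.rInf - 2, by omega⟩
        rw [hm, show 2 * (m + 2) - 4 = m + m by omega]
        simp only [pow_add]
        field_simp
      · filter_upwards [self_mem_nhdsWithin] with x hx
        have hx : x ≠ 0 := hx
        field_simp
    · have h5 : D.rInf = 2 := by omega
      have h6 := h3
      rw [h5] at h6
      refine ((h6.pow_mul 2).congr_of_ne (g := fun x => x ^ D.rInf * (D.P2tilde x⁻¹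
        - (laxEntry D K 0 0 x⁻¹ * laxEntry D K 1 1 x⁻¹
          - laxEntry D K 0 1 x⁻¹ * laxEntry D K 1 0 x⁻¹))) fun x hx => ?_).congr_mod ?_
      · rw [h5]; simp [hx]
      · have e : detDefect D = -D.P2InfCoeff 1 := by
          rw [detDefect, if_neg (by omega), if_pos h5, DeformationData.P2InfCoeff, h5]
          simp [Finset.sum_range_succ]
          ring
        rw [e]
        simp only [Finset.sum_range_succ, Finset.sum_range_zero]
        norm_num
        refine ⟨0, ?_⟩
        ring
  · have h2 : D.rInf = 1 := by omega
    rw [h2] at h1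
    have h3 := (h1.pow_mul 3)
    have h4 := HasTrunc.sum Finset.univ fun s (_ : s ∈ Finset.univ) =>
        HasTrunc.sum (N := 4) (Finset.range (D.r s)) fun k (hk : k ∈ Finset.range (D.r s)) =>
        (((hasTrunc_one_sub_pow_inv (D.X s) (2 * D.r s - k)).const_mul
          (D.P2XCoeff s k)).pow_mul (2 * D.r s - k + 1)).mono
          (by rw [Finset.mem_range] at hk; omega)
    refine ((h4.sub h3).congr_of_ne fun x hx => ?_).congr_mod ?_
    · rw [h2, DeformationData.P2tilde, h2, Finset.sum_range_one, if_neg (by norm_num), zero_add,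
        pow_one, mul_sub x, Finset.mul_sum]
      congr 1
      · refine Finset.sum_congr rfl fun s _ => ?_
        rw [Finset.mul_sum]
        refine Finset.sum_congr rfl fun k _ => ?_
        rw [div_eq_mul_inv, inv_inv_sub_pow hx, pow_succ]
        ring
      · simp only [Nat.sub_self, pow_zero, one_mul]
        field_simp
    · have e : detDefect D = (∑ s, if D.r s = 1 then D.tX s 0 0 * D.tX s 1 0 else 0)
          - D.P2InfCoeff 0 := by
        rw [detDefect, if_pos h2, DeformationData.P2InfCoeff, h2]
        simp
      rw [e]
      have e2 : ∑ k ∈ Finset.range 1, C (D.P2InfCoeff k) * (X : ℂ[X]) ^ k = C (D.P2InfCoeff 0) := by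
        simp
      rw [e2, C_sub, sub_mul, map_sum, Finset.sum_mul, mul_comm (X ^ 3), sub_sub_sub_cancel_right,
        ← Finset.sum_sub_distrib]
      refine Finset.dvd_sum fun s _ => ?_
      have hr := h.one_le_r s
      split_ifs with h6
      · rw [h6, Finset.sum_range_one]
        have e3 : D.P2XCoeff s 0 = D.tX s 0 0 * D.tX s 1 0 := by
          rw [DeformationData.P2XCoeff, h6]; simp
        rw [e3]
        exact ⟨0, by ring⟩
      · rw [C_0, zero_mul, sub_zero]
        refine Finset.dvd_sum fun k hk => ?_
        rw [Finset.mem_range] at hk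
        exact (pow_dvd_pow X (by omega)).mul_right _

end

section

/-! ### The spectral function at infinity -/

variable {n g : ℕ} {D : DeformationData n} {K K' B : PolarCoeffs n} {q p : Fin g → ℂ}

/-- The leading term of `L₁₁` at infinity is fixed by the normalization. -/
theorem IsLaxJet.hasTrunc_lax00_inv (h : IsLaxJet D K K' B) :
    HasTrunc 1 (fun x => x ^ (D.rInf - 1) * x⁻¹ * laxEntry D K 0 0 x⁻¹)
      (C (-D.tInf 0 (D.rInf - 1))) := by
  refine ((hasTrunc_laxEntry_inv D h.one_le_rInf h.one_le_r K 0 0).mono h.one_le_rInf).congr_mod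
    (X_pow_dvd_iff.2 fun d hd => ?_)
  obtain rfl : d = 0 := by omega
  rw [coeff_sub, coeff_zero_infPoly D h.one_le_rInf, h.lead, coeff_C_zero]
  simp

/-- The leading term of the derivative of `L₁₁` at infinity. -/
theorem IsLaxJet.hasTrunc_deriv_lax00_inv (h : IsLaxJet D K K' B) :
    HasTrunc 4 (fun x => x ^ D.rInf * deriv (laxEntry D K 0 0) x⁻¹)
      (C (((D.rInf : ℂ) - 2) * -D.tInf 0 (D.rInf - 1)) * X ^ 3) := by
  have hR := h.one_le_rInf
  have hlead := congrFun (congrFun h.lead 0) 0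
  rw [Matrix.diagonal_apply_eq, leadAtInfinity] at hlead
  have h1 := hasTrunc_ratFn_inv (D.rInf - 2) (fun s => D.r s + 1) D.X
    (fun k => (k + 1) * K.inf (k + 1 + 1) 0 0) (fun s k => -(k : ℂ) * K.fin s (k - 1) 0 0)
  have h0 : polarMoment₀ (fun s => D.r s + 1) (fun s k => -(k : ℂ) * K.fin s (k - 1) 0 0) = 0 :=
    Finset.sum_eq_zero fun s _ => by simp
  have h2 : polarMoment₁ (fun s => D.r s + 1) D.X (fun s k => -(k : ℂ) * K.fin s (k - 1) 0 0) =
      -∑ s, K.fin s 0 0 0 := by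
    rw [polarMoment₁, ← Finset.sum_neg_distrib]
    refine Finset.sum_congr rfl fun s _ => ?_
    rw [if_pos (by have := h.one_le_r s; omega)]
    simp
  rw [h0, h2, C_0, zero_mul, zero_add] at h1
  have hne : ∀ᶠ x : ℂ in 𝓝[≠] 0, ∀ s, x⁻¹ ≠ D.X s :=
    IsLaxJet.eventually_off_poles_inv D.X
  rcases Nat.lt_or_ge 1 D.rInf with h3 | h3
  · rw [if_pos (show 2 ≤ D.rInf from h3)] at hlead
    refine (((h1.pow_mul 2).mono (show 4 ≤ _ by omega)).congr' ?_).congr_mod ?_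
    · filter_upwards [hne] with x hx
      rw [deriv_laxEntry D K 0 0 hx, ratFnDeriv, ← mul_assoc, ← pow_add,
        show 2 + (D.rInf - 2) = D.rInf by omega, show D.rInf - 1 - 1 = D.rInf - 2 by omega]
    · rw [mul_add, add_sub_right_comm]
      rcases Nat.lt_or_ge 2 D.rInf with h4 | h4
      · refine dvd_add ?_ ⟨X ^ (D.rInf - 2) * C (-∑ s, K.fin s 0 0 0), by ring⟩
        obtain ⟨m, hm⟩ : ∃ m, D.rInf - 2 = m + 1 := ⟨D.rInf - 3, by omega⟩
        have e : (D.rInf : ℂ) - 2 = m + 1 := by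
          rw [show D.rInf = m + 3 by omega]; push_cast; ring
        rw [hm, Finset.sum_range_succ, e, show m + 1 + 1 = D.rInf - 1 by omega, hlead,
          Nat.add_sub_cancel_left, pow_one, mul_add, add_sub_assoc]
        refine dvd_add ?_ ⟨0, by ring⟩
        rw [Finset.mul_sum]
        refine Finset.dvd_sum fun k hk => ?_
        rw [Finset.mem_range] at hk
        obtain ⟨l, hl⟩ : ∃ l, m + 1 - k = l + 2 := ⟨m - 1 - k, by omega⟩
        rw [hl]
        exact ⟨C (((k : ℂ) + 1) * K.inf (k + 1 + 1) 0 0) * X ^ l, by ring⟩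
      · have h4 : D.rInf = 2 := by omega
        rw [h4]
        simp only [Nat.sub_self, Finset.range_zero, Finset.sum_empty, mul_zero, pow_zero, one_mul,
          Nat.cast_ofNat, sub_self, zero_mul, C_0, zero_add]
        exact ⟨C (-∑ s, K.fin s 0 0 0), by ring⟩
  · have h3 : D.rInf = 1 := by omega
    rw [if_neg (by omega)] at hlead
    refine (((h1.pow_mul 1).mono (show 4 ≤ _ by omega)).congr' ?_).congr_mod ?_
    · filter_upwards [hne] with x hx
      rw [deriv_laxEntry D K 0 0 hx, ratFnDeriv, h3]
      simp
    · rw [Matrix.sum_apply] at hlead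
      rw [← hlead, h3, Nat.cast_one, show (1 : ℂ) - 2 = -1 by norm_num]
      refine ⟨0, ?_⟩
      simp only [show 1 - 2 = 0 from rfl, Finset.range_zero, Finset.sum_empty, neg_mul, one_mul]
      ring

/-- At infinity `evalH` is governed by its first two moments, up to `O(z^{rInf-4})`. -/
theorem hasTrunc_evalH_inv (D : DeformationData n) (hR : 1 ≤ D.rInf) (h : D.HType) :
    HasTrunc 4 (fun x => x ^ D.rInf * evalH D h x⁻¹)
      (C (residueSum D h) * X ^ (D.rInf + 1) + C (secondMoment D h) * X ^ (D.rInf + 2)) := by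
  have h1 := hasTrunc_ratFn_inv (D.rInf - 3) D.r D.X (entryAt h.1) (fun s => entryAt (h.2 s))
  obtain ⟨m, hm⟩ : ∃ m, D.rInf = (D.rInf - 3) + m := ⟨D.rInf - (D.rInf - 3), by omega⟩
  refine (((h1.pow_mul m).mono (show 4 ≤ _ by omega)).congr_of_ne fun x _ => ?_).congr_mod ?_
  · rw [← mul_assoc, ← pow_add, add_comm m, ← hm, evalH]
  · rw [mul_add, Finset.mul_sum, add_sub_assoc]
    refine dvd_add (Finset.dvd_sum fun k hk => ?_) ⟨0, ?_⟩
    · rw [Finset.mem_range] at hk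
      obtain ⟨l, hl⟩ : ∃ l, m + (D.rInf - 3 - k) = 4 + l := ⟨m + (D.rInf - 3 - k) - 4, by omega⟩
      rw [mul_left_comm, ← pow_add, hl, pow_add]
      exact ⟨C (entryAt h.1 k) * X ^ l, by ring⟩
    · rw [← mul_assoc, ← pow_add, add_comm m, ← hm, residueSum, secondMoment]
      ring

/-- The expansion of the spectral function at infinity. -/
theorem IsLaxJet.hasTrunc_spectralFun_inv (h : IsLaxJet D K K' B) (a : IsDarboux D K q p) :
    HasTrunc 4 (fun x => x ^ D.rInf * spectralFun D K q x⁻¹)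
      (C (residueTarget D p) * X ^ (D.rInf + 1)
        + C (secondMomentTarget D q p) * X ^ (D.rInf + 2)) := by
  have hR := h.one_le_rInf
  have hne : ∀ᶠ x : ℂ in 𝓝[≠] 0, ∀ s, x⁻¹ ≠ D.X s :=
    IsLaxJet.eventually_off_poles_inv D.X
  have hneq : ∀ᶠ x : ℂ in 𝓝[≠] 0, ∀ i, x⁻¹ ≠ q i :=
    IsLaxJet.eventually_off_poles_inv q
  have hgeom : ∀ b : ℂ, HasTrunc 1 (fun x => (1 - x * b)⁻¹) 1 := fun b => by
    simpa using hasTrunc_geom 1 b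
  have hw := h.hasTrunc_lax00_inv
  have t1 := h.hasTrunc_P2tilde_sub_det
  have t2 := h.hasTrunc_deriv_lax00_inv
  have t3 := HasTrunc.sum Finset.univ fun s (_ : s ∈ Finset.univ) =>
    (((hw.mul (hgeom (D.X s))).pow_mul 3).const_mul (D.r s : ℂ))
  have t4 := HasTrunc.sum Finset.univ fun i (_ : i ∈ Finset.univ) =>
    (((hw.mul (hgeom (q i))).pow_mul 3).sub
      ((((hasTrunc_geom 2 (q i)).pow_mul (D.rInf + 1)).mono (show 1 + 3 ≤ _ by omega)).const_mul
        (p i)))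
  have t5 := HasTrunc.poly 4 (if 3 ≤ D.rInf then
    C (D.hbar * D.tInf 0 (D.rInf - 1)) * X ^ 3 else 0)
  have t := (t1.add (((t2.add t3).sub t4).const_mul D.hbar)).add t5
  refine (t.congr' ?_).congr_mod ?_
  · filter_upwards [hne, hneq, self_mem_nhdsWithin] with x hx hq hx0
    have hx0 : x ≠ 0 := hx0
    obtain ⟨m, hm⟩ : ∃ m, D.rInf = m + 1 := ⟨D.rInf - 1, by omega⟩
    have e0 : ∀ b, x⁻¹ ≠ b → x⁻¹ - b = x⁻¹ * (1 - x * b) := fun b _ => by field_simp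
    have e3 : ∑ s, (D.r s : ℂ) * (x ^ 3 * (x ^ (D.rInf - 1) * x⁻¹ * laxEntry D K 0 0 x⁻¹ *
        (1 - x * D.X s)⁻¹)) =
        x ^ D.rInf * (laxEntry D K 0 0 x⁻¹ * ∑ s, D.r s / (x⁻¹ - D.X s)) := by
      rw [Finset.mul_sum, Finset.mul_sum]
      refine Finset.sum_congr rfl fun s _ => ?_
      rw [e0 _ (hx s), div_eq_mul_inv, mul_inv, inv_inv, hm, Nat.add_sub_cancel, pow_succ x m]
      field_simp
    have e4 : ∑ i, (x ^ 3 * (x ^ (D.rInf - 1) * x⁻¹ * laxEntry D K 0 0 x⁻¹ *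
        (1 - x * q i)⁻¹) - p i * (x ^ (D.rInf + 1) * (1 - x * q i)⁻¹)) =
        x ^ D.rInf * ∑ i, dslope (laxEntry D K 0 0) (q i) x⁻¹ := by
      rw [Finset.mul_sum]
      refine Finset.sum_congr rfl fun i _ => ?_
      rw [dslope_eq_of_ne _ (hq i), a.value, e0 _ (hq i), mul_inv, inv_inv, hm, Nat.add_sub_cancel,
        pow_succ x (m + 1), pow_succ x m]
      field_simp
    have e5 : eval x (if 3 ≤ D.rInf then C (D.hbar * D.tInf 0 (D.rInf - 1)) * X ^ 3 else 0) =
        x ^ D.rInf * if 3 ≤ D.rInf then D.hbar * D.tInf 0 (D.rInf - 1) * x⁻¹ ^ (D.rInf - 3)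
          else 0 := by
      split_ifs with h3
      · obtain ⟨l, hl⟩ : ∃ l, D.rInf = l + 3 := ⟨D.rInf - 3, by omega⟩
        rw [hl, Nat.add_sub_cancel, pow_add]
        have e : x ^ l * x⁻¹ ^ l = 1 := by rw [← mul_pow, mul_inv_cancel₀ hx0, one_pow]
        simp only [eval_mul, eval_C, eval_pow, eval_X]
        linear_combination -(D.hbar * D.tInf 0 (l + 3 - 1) * x ^ 3) * e
      · simp
    rw [e3, e4, e5, spectralFun]
    ring
  · -- the leading coefficient of `L₁₁` enters with the total weight `(rInf - 2) + ∑ r_s - g = 1`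
    have hg : (D.rInf : ℂ) + ∑ s, (D.r s : ℂ) = g + 3 := by exact_mod_cast a.genus
    have e3 : ∑ s, C (D.r s : ℂ) * (X ^ 3 * (C (-D.tInf 0 (D.rInf - 1)) * 1)) =
        C ((∑ s, (D.r s : ℂ)) * -D.tInf 0 (D.rInf - 1)) * X ^ 3 := by
      rw [C_mul, map_sum, Finset.sum_mul, Finset.sum_mul]
      exact Finset.sum_congr rfl fun s _ => by ring
    have e4 : ∑ i, (X ^ 3 * (C (-D.tInf 0 (D.rInf - 1)) * 1)
        - C (p i) * (X ^ (D.rInf + 1) * ∑ k ∈ Finset.range 2, C (q i ^ k) * X ^ k)) =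
        C ((g : ℂ) * -D.tInf 0 (D.rInf - 1)) * X ^ 3 - C (∑ i, p i) * X ^ (D.rInf + 1)
          - C (∑ i, q i * p i) * X ^ (D.rInf + 2) := by
      rw [Finset.sum_sub_distrib, sub_sub, map_sum, map_sum, Finset.sum_mul, Finset.sum_mul,
        ← Finset.sum_add_distrib]
      congr 1
      · simp
        ring
      · refine Finset.sum_congr rfl fun i _ => ?_
        rw [Finset.sum_range_succ, Finset.sum_range_one, C_mul]
        simp only [pow_zero, pow_one, C_1]
        ring
    rw [e3, e4, residueTarget, secondMomentTarget]
    have key : ((C (detDefect D) * X ^ 3 + C D.hbar * (C (((D.rInf : ℂ) - 2)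
        * -D.tInf 0 (D.rInf - 1)) * X ^ 3 + C ((∑ s, (D.r s : ℂ)) * -D.tInf 0 (D.rInf - 1)) * X ^ 3
        - (C ((g : ℂ) * -D.tInf 0 (D.rInf - 1)) * X ^ 3 - C (∑ i, p i) * X ^ (D.rInf + 1)
          - C (∑ i, q i * p i) * X ^ (D.rInf + 2)))
        + if 3 ≤ D.rInf then C (D.hbar * D.tInf 0 (D.rInf - 1)) * X ^ 3 else 0)
        - (C (D.hbar * ∑ j, p j + residueShift D) * X ^ (D.rInf + 1)
          + C (D.hbar * ∑ j, q j * p j + secondMomentShift D) * X ^ (D.rInf + 2))) =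
        C (detDefect D - D.hbar * D.tInf 0 (D.rInf - 1)
          + if 3 ≤ D.rInf then D.hbar * D.tInf 0 (D.rInf - 1) else 0) * X ^ 3
        - C (residueShift D) * X ^ (D.rInf + 1)
        - C (secondMomentShift D) * X ^ (D.rInf + 2) := by
      have e6 : C (detDefect D - D.hbar * D.tInf 0 (D.rInf - 1)
          + if 3 ≤ D.rInf then D.hbar * D.tInf 0 (D.rInf - 1) else 0) * (X : ℂ[X]) ^ 3 =
          C (detDefect D + D.hbar * (((D.rInf : ℂ) - 2) * -D.tInf 0 (D.rInf - 1)
            + (∑ s, (D.r s : ℂ)) * -D.tInf 0 (D.rInf - 1) - g * -D.tInf 0 (D.rInf - 1))) * X ^ 3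
          + if 3 ≤ D.rInf then C (D.hbar * D.tInf 0 (D.rInf - 1)) * X ^ 3 else 0 := by
        rw [C_add, add_mul]
        congr 2
        · congr 1
          linear_combination (D.hbar * D.tInf 0 (D.rInf - 1)) * hg
        · split_ifs <;> simp
      rw [e6]
      simp only [C_add, C_mul, C_sub]
      ring
    rw [key]
    rcases Nat.lt_trichotomy D.rInf 2 with h2 | h2 | h2
    · have h2 : D.rInf = 1 := by omega
      rw [detDefect, residueShift, secondMomentShift, if_pos h2, if_neg (by omega),
        if_neg (by omega), if_pos h2, h2]
      refine ⟨0, ?_⟩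
      simp only [C_sub, C_mul, C_add, C_0]
      ring
    · rw [detDefect, residueShift, secondMomentShift, if_neg (by omega), if_pos h2,
        if_neg (by omega), if_pos h2, if_neg (by omega), h2]
      refine ⟨0, ?_⟩
      simp only [C_sub, C_mul, C_add, C_0, C_neg]
      ring
    · rw [detDefect, residueShift, secondMomentShift, if_neg (by omega), if_neg (by omega),
        if_pos (by omega), if_neg (by omega), if_neg (by omega)]
      refine ⟨0, ?_⟩
      simp

/-- The isospectral coefficients are the partial fraction coefficients of the spectral function. -/
theorem IsLaxJet.spectralFun_eq (h : IsLaxJet D K K' B) (a : IsDarboux D K q p) {z : ℂ}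
    (hz : ∀ s, z ≠ D.X s) : spectralFun D K q z = evalH D (D.solH q p) z := by
  have hR := h.one_le_rInf
  have hH := (isH_iff D hR q p _).1
    (isH_solH D hR h.X_injective a.genus a.injective a.off_poles p)
  rw [← sub_eq_zero]
  refine eq_zero_of_interpolation a.genus a.injective a.off_poles
    (h := fun z => spectralFun D K q z - evalH D (D.solH q p) z) (fun z hz => ?_) (fun j => ?_)
    (fun s => ?_) ?_ z hz
  · exact (differentiableAt_spectralFun D K a.off_poles hz).fun_sub
      (hasDerivAt_evalH D _ hz).differentiableAt
  · rw [h.spectralFun_apply a, hH.1, sub_self]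
  · refine ((h.isBigO_spectralFun a.off_poles s).sub (hasTrunc_ratFn (D.rInf - 3) D.r
      (entryAt (D.solH q p).1) (fun s => entryAt ((D.solH q p).2 s)) h.X_injective
      s).isBigO_one).congr_left fun x => ?_
    rw [evalH]; ring
  · have t := ((h.hasTrunc_spectralFun_inv a).sub (hasTrunc_evalH_inv D hR (D.solH q p)))
    refine (t.isBigO_of_dvd ?_).congr_left fun x => by ring
    rcases Nat.lt_or_ge 2 D.rInf with h2 | h2
    · obtain ⟨m, hm⟩ : ∃ m, D.rInf = m + 3 := ⟨D.rInf - 3, by omega⟩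
      rw [hm]
      exact ⟨(C (residueTarget D p) - C (residueSum D (D.solH q p))) * X ^ m
        + (C (secondMomentTarget D q p) - C (secondMoment D (D.solH q p))) * X ^ (m + 1), by ring⟩
    · rw [hH.2.1 h2]
      rcases Nat.lt_or_ge 1 D.rInf with h1 | h1
      · rw [show D.rInf = 2 by omega]
        exact ⟨C (secondMomentTarget D q p) - C (secondMoment D (D.solH q p)), by ring⟩
      · rw [hH.2.2 (by omega), sub_self]
        exact dvd_zero _

end

section

/-! ### The evolution of the Darboux coordinates -/

theorem eventually_ne_poles {n : ℕ} {Y : Fin n → ℂ} {z : ℂ} (hz : ∀ s, z ≠ Y s) :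
    ∀ᶠ w in 𝓝 z, ∀ s, w ≠ Y s :=
  (isOpen_off_poles Y).mem_nhds hz

theorem hasDerivAt_dslope_of_ne {f : ℂ → ℂ} {f' a z : ℂ} (hf : HasDerivAt f f' z) (hz : z ≠ a) :
    HasDerivAt (dslope f a) (f' * (z - a)⁻¹ - (f z - f a) / (z - a) ^ 2) z := by
  have hza := sub_ne_zero.2 hz
  have h1 : HasDerivAt (fun w => (w - a)⁻¹ * (f w - f a))
      (f' * (z - a)⁻¹ - (f z - f a) / (z - a) ^ 2) z := by
    refine ((((hasDerivAt_id z).sub_const a).fun_inv hza).fun_mul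
      (hf.sub_const (f a))).congr_deriv ?_
    simp only [id]
    field_simp
    ring
  refine h1.congr_of_eventuallyEq ?_
  filter_upwards [eventually_ne_nhds hz] with w hw using dslope_eq_of_ne f hw

/-- The second derivative at `a` is twice the derivative of the difference quotient. -/
theorem hasDerivAt_deriv_of_dslope {n : ℕ} {Y : Fin n → ℂ} {f : ℂ → ℂ}
    (hf : ∀ z, (∀ s, z ≠ Y s) → DifferentiableAt ℂ f z) {a : ℂ} (ha : ∀ s, a ≠ Y s) :
    HasDerivAt (deriv f) (2 * deriv (dslope f a) a) a := by
  have hd : ∀ z, (∀ s, z ≠ Y s) → DifferentiableAt ℂ (dslope f a) z := fun z hz =>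
    differentiableAt_dslope hf ha hz
  have hU := isOpen_off_poles Y
  have h1 : DifferentiableOn ℂ (dslope f a) {z | ∀ s, z ≠ Y s} := fun z hz =>
    (hd z hz).differentiableWithinAt
  have hc : ContinuousAt (deriv (dslope f a)) a :=
    ((h1.deriv hU).differentiableAt (hU.mem_nhds ha)).continuousAt
  have h2 := hasDerivAt_mul_of_eq_zero hc ((hasDerivAt_id a).sub_const a) (sub_self a)
  refine (((hd a ha).hasDerivAt.add h2).congr_deriv (by ring)).congr_of_eventuallyEq ?_
  filter_upwards [eventually_ne_poles ha] with z hz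
  have h3 : HasDerivAt (fun z => f a + (z - a) * dslope f a z)
      (1 * dslope f a z + (z - a) * deriv (dslope f a) z) z :=
    ((((hasDerivAt_id z).sub_const a).fun_mul (hd z hz).hasDerivAt)).const_add (f a)
  have h4 : (fun z => f a + (z - a) * dslope f a z) = f := by
    funext z
    have := sub_smul_dslope f a z
    rw [smul_eq_mul] at this
    rw [this]; ring
  rw [h4] at h3
  rw [h3.deriv]
  simp only [Pi.add_apply, id]
  ring

/-- The derivative of `resolventMul` at one of the points `q_j`, where the resolvent itself has a pole. -/
theorem hasDerivAt_resolventMul {n g : ℕ} {Y : Fin n → ℂ} {f : ℂ → ℂ}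
    (hf : ∀ z, (∀ s, z ≠ Y s) → DifferentiableAt ℂ f z) {q : Fin g → ℂ}
    (hinj : Function.Injective q) (hq : ∀ i s, q i ≠ Y s) (y : ℂ × ℂ × (Fin g → ℂ)) (j : Fin g) :
    HasDerivAt (resolventMul q y f) (y.1 * f (q j) + (y.1 * q j + y.2.1) * deriv f (q j)
      + y.2.2 j * deriv (dslope f (q j)) (q j)
      + deriv f (q j) * ∑ i ∈ Finset.univ.erase j, y.2.2 i * (q j - q i)⁻¹
      - ∑ i ∈ Finset.univ.erase j, y.2.2 i * ((f (q j) - f (q i)) / (q j - q i) ^ 2)) (q j) := by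
  have hfj := (hf _ (hq j)).hasDerivAt
  have h1 : HasDerivAt (fun z => (y.1 * z + y.2.1) * f z)
      (y.1 * f (q j) + (y.1 * q j + y.2.1) * deriv f (q j)) (q j) :=
    ((((hasDerivAt_id (q j)).const_mul y.1).add_const y.2.1).fun_mul hfj).congr_deriv
      (by simp only [id]; ring)
  have h2 : HasDerivAt (fun z => ∑ i, y.2.2 i * dslope f (q i) z)
      (y.2.2 j * deriv (dslope f (q j)) (q j) + ∑ i ∈ Finset.univ.erase j,
        y.2.2 i * (deriv f (q j) * (q j - q i)⁻¹ - (f (q j) - f (q i)) / (q j - q i) ^ 2)) (q j) := by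
    simp only [← Finset.add_sum_erase _ _ (Finset.mem_univ j)]
    refine ((differentiableAt_dslope hf (hq j) (hq j)).hasDerivAt.const_mul _).fun_add
      (HasDerivAt.fun_sum fun i hi => (hasDerivAt_dslope_of_ne hfj ?_).const_mul _)
    exact fun e => (Finset.ne_of_mem_erase hi) (hinj e).symm
  refine (h1.fun_add h2).congr_deriv ?_
  rw [Finset.mul_sum, add_sub_assoc, add_assoc, add_assoc, ← Finset.sum_sub_distrib, ← add_assoc,
    ← add_assoc, ← add_assoc]
  congr 1
  exact Finset.sum_congr rfl fun i _ => by ring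

variable {n g : ℕ} {D : DeformationData n} {K K' B : PolarCoeffs n} {q p : Fin g → ℂ}

/-- The difference quotient of `L₁₂` at `q_j` is, up to a constant, `∏_{i ≠ j} (z - q_i) / ∏ (z - X_s)^{r_s}`,
which gives its logarithmic derivative. -/
theorem IsLaxJet.lax01_factor (h : IsLaxJet D K K' B) (a : IsDarboux D K q p) (j : Fin g) :
    ∃ N : ℂ → ℂ, N (q j) ≠ 0 ∧ dslope (laxEntry D K 0 1) (q j) =ᶠ[𝓝 (q j)] N ∧
      HasDerivAt N (N (q j) * (∑ i ∈ Finset.univ.erase j, (q j - q i)⁻¹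
        - ∑ s, (D.r s : ℂ) / (q j - D.X s))) (q j) := by
  set N : ℂ → ℂ := fun z => (∏ i ∈ Finset.univ.erase j, (z - q i))
    * (∏ s, (z - D.X s) ^ D.r s)⁻¹ with hN
  have hij : ∀ i ∈ Finset.univ.erase j, q j - q i ≠ 0 := fun i hi =>
    sub_ne_zero.2 fun e => (Finset.ne_of_mem_erase hi) (a.injective e).symm
  have hjs : ∀ s, q j - D.X s ≠ 0 := fun s => sub_ne_zero.2 (a.off_poles j s)
  have hne1 : ∏ i ∈ Finset.univ.erase j, (q j - q i) ≠ 0 := Finset.prod_ne_zero_iff.2 hij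
  have hne2 : ∏ s, (q j - D.X s) ^ D.r s ≠ 0 :=
    Finset.prod_ne_zero_iff.2 fun s _ => pow_ne_zero _ (hjs s)
  have hN0 : N (q j) ≠ 0 := mul_ne_zero hne1 (inv_ne_zero hne2)
  have hd1 : DifferentiableAt ℂ (fun z => ∏ i ∈ Finset.univ.erase j, (z - q i)) (q j) := by fun_prop
  have hd2 : DifferentiableAt ℂ (fun z => ∏ s, (z - D.X s) ^ D.r s) (q j) := by fun_prop
  have hNd : DifferentiableAt ℂ N (q j) := hd1.mul (hd2.inv hne2)
  have hlog : logDeriv N (q j) = ∑ i ∈ Finset.univ.erase j, (q j - q i)⁻¹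
      - ∑ s, (D.r s : ℂ) / (q j - D.X s) := by
    have e1 := logDeriv_div (q j) hne1 hne2 hd1 hd2
    rw [logDeriv_prod hij (fun i _ => by fun_prop),
      logDeriv_prod (f := fun s z => (z - D.X s) ^ D.r s) (fun s _ => pow_ne_zero _ (hjs s))
        (fun i _ => by fun_prop)] at e1
    simp only [hN, ← div_eq_mul_inv]
    rw [e1]
    congr 1
    · refine Finset.sum_congr rfl fun i _ => ?_
      simp [logDeriv_apply]
    · refine Finset.sum_congr rfl fun s _ => ?_
      rw [logDeriv_fun_pow (by fun_prop)]
      simp [logDeriv_apply, div_eq_mul_inv]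
  have hev : ∀ᶠ z in 𝓝 (q j), laxEntry D K 0 1 z = N z * (z - q j) := by
    filter_upwards [eventually_ne_poles (a.off_poles j)] with z hz
    rw [h.lax01_eq a hz, ← Finset.mul_prod_erase _ _ (Finset.mem_univ j), hN]
    ring
  refine ⟨N, hN0, ?_, hNd.hasDerivAt.congr_deriv ?_⟩
  · filter_upwards [hev] with z hz
    rcases eq_or_ne z (q j) with rfl | hne
    · have h1 := hasDerivAt_mul_of_eq_zero hNd.continuousAt
        ((hasDerivAt_id (q j)).sub_const (q j)) (sub_self _)
      rw [dslope_same, (h1.congr_of_eventuallyEq hev).deriv, mul_one]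
    · rw [dslope_eq_of_ne _ hne, a.zero, hz, sub_zero]
      have := sub_ne_zero.2 hne
      field_simp
  · rw [← hlog, logDeriv_apply, mul_div_cancel₀ _ hN0]

theorem IsLaxJet.deriv_lax01_ne_zero (h : IsLaxJet D K K' B) (a : IsDarboux D K q p) (j : Fin g) :
    deriv (laxEntry D K 0 1) (q j) ≠ 0 := by
  obtain ⟨N, h0, h1, _⟩ := h.lax01_factor a j
  rw [← dslope_same, h1.eq_of_nhds]
  exact h0

theorem IsLaxJet.deriv_dslope_lax01 (h : IsLaxJet D K K' B) (a : IsDarboux D K q p) (j : Fin g) :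
    deriv (dslope (laxEntry D K 0 1) (q j)) (q j) = deriv (laxEntry D K 0 1) (q j)
      * (∑ i ∈ Finset.univ.erase j, (q j - q i)⁻¹ - ∑ s, (D.r s : ℂ) / (q j - D.X s)) := by
  obtain ⟨N, _, h1, h2⟩ := h.lax01_factor a j
  rw [← dslope_same (laxEntry D K 0 1), h1.eq_of_nhds, h1.deriv_eq, h2.deriv]

theorem isNuMu_nuMu_of_jet (h : IsLaxJet D K K' B) (a : IsDarboux D K q p) :
    D.IsNuMu q (D.nuMu q) :=
  isNuMu_nuMu D h.one_le_rInf h.X_injective a.genus a.injective a.off_poles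

theorem IsLaxJet.aux01_apply (h : IsLaxJet D K K' B) (a : IsDarboux D K q p) (j : Fin g) :
    auxEntry D B 0 1 (q j) = D.mu q j * deriv (laxEntry D K 0 1) (q j) := by
  rw [h.aux01_eq a (isNuMu_nuMu_of_jet h a) (a.off_poles j), resolventMul, a.zero, mul_zero, zero_add,
    Finset.sum_eq_single j, dslope_same]
  · rfl
  · intro i _ hi
    rw [dslope_eq_of_ne _ (fun e => hi (a.injective e).symm), a.zero, a.zero, sub_zero, mul_zero,
      mul_zero]
  · exact fun hj => absurd (Finset.mem_univ j) hj

theorem auxEntryDeriv_eq (D : DeformationData n) (B : PolarCoeffs n) (i j : Fin 2) {z : ℂ}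
    (hz : ∀ s, z ≠ D.X s) : auxEntryDeriv D B i j z = deriv (auxEntry D B i j) z :=
  (hasDerivAt_ratFn _ _ _ _ _ hz).deriv.symm

/-- The derivative of `A₁₂` at `q_j`. -/
theorem IsLaxJet.auxDeriv01_apply (h : IsLaxJet D K K' B) (a : IsDarboux D K q p) (j : Fin g) :
    auxEntryDeriv D B 0 1 (q j) = deriv (laxEntry D K 0 1) (q j)
      * (D.nuInfNegOne q * q j + D.nuInfZero q + D.mu q j
          * (∑ i ∈ Finset.univ.erase j, (q j - q i)⁻¹ - ∑ s, (D.r s : ℂ) / (q j - D.X s))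
        + ∑ i ∈ Finset.univ.erase j, D.mu q i * (q j - q i)⁻¹) := by
  have hev : auxEntry D B 0 1 =ᶠ[𝓝 (q j)] resolventMul q (D.nuMu q) (laxEntry D K 0 1) := by
    filter_upwards [eventually_ne_poles (a.off_poles j)] with z hz using
      h.aux01_eq a (isNuMu_nuMu_of_jet h a) hz
  rw [auxEntryDeriv_eq D B 0 1 (a.off_poles j), hev.deriv_eq, (hasDerivAt_resolventMul
    (fun z hz => differentiableAt_laxEntry D K 0 1 hz) a.injective a.off_poles _ j).deriv,
    h.deriv_dslope_lax01 a]
  simp only [a.zero, sub_self, zero_div, mul_zero, Finset.sum_const_zero, DeformationData.nuInfZero,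
    DeformationData.nuInfNegOne, DeformationData.mu]
  ring

/-- The derivative of `A₁₁` at `q_j`. -/
theorem IsLaxJet.auxDeriv00_apply (h : IsLaxJet D K K' B) (a : IsDarboux D K q p) (j : Fin g) :
    auxEntryDeriv D B 0 0 (q j) = D.nuInfNegOne q * p j
      + (D.nuInfNegOne q * q j + D.nuInfZero q) * deriv (laxEntry D K 0 0) (q j)
      + D.mu q j * deriv (dslope (laxEntry D K 0 0) (q j)) (q j)
      + deriv (laxEntry D K 0 0) (q j) * ∑ i ∈ Finset.univ.erase j, D.mu q i * (q j - q i)⁻¹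
      - ∑ i ∈ Finset.univ.erase j, D.mu q i * ((p j - p i) / (q j - q i) ^ 2)
      + (∑ k ∈ Finset.Icc 1 (D.rInf - 1), (k : ℂ) * D.cInf k * q j ^ (k - 1)
      - ∑ s, ∑ k ∈ Finset.Icc 1 (D.r s - 1), (k : ℂ) * D.cX s k / (q j - D.X s) ^ (k + 1)) := by
  obtain ⟨κ, hκ⟩ := h.aux00_eq a (isNuMu_nuMu_of_jet h a)
  have hev : auxEntry D B 0 0 =ᶠ[𝓝 (q j)]
      fun z => resolventMul q (D.nuMu q) (laxEntry D K 0 0) z + cFun D κ z := by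
    filter_upwards [eventually_ne_poles (a.off_poles j)] with z hz using hκ z hz
  rw [auxEntryDeriv_eq D B 0 0 (a.off_poles j), hev.deriv_eq, ((hasDerivAt_resolventMul
    (fun z hz => differentiableAt_laxEntry D K 0 0 hz) a.injective a.off_poles _ j).fun_add
    (hasDerivAt_cFun D κ (a.off_poles j))).deriv]
  simp only [a.value]
  rfl

/-- The value of `L₂₁` at `q_j`, from the derivative of the expression of `det L` in terms of the
isospectral coefficients. -/
theorem IsLaxJet.deriv_lax01_mul_lax10 (h : IsLaxJet D K K' B) (a : IsDarboux D K q p) (j : Fin g) :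
    deriv (laxEntry D K 0 1) (q j) * laxEntry D K 1 0 (q j) =
      deriv (laxEntry D K 0 0) (q j) * (D.P1 (q j) - 2 * p j) + p j * deriv D.P1 (q j)
      - deriv D.P2tilde (q j)
      + (∑ k ∈ Finset.Icc 1 (D.rInf - 4), (k : ℂ) * D.HInf q p k * q j ^ (k - 1)
        - ∑ s, ∑ k ∈ Finset.Icc 1 (D.r s), (k : ℂ) * D.HX q p s k / (q j - D.X s) ^ (k + 1))
      - D.hbar * (deriv (dslope (laxEntry D K 0 0) (q j)) (q j)
        + deriv (laxEntry D K 0 0) (q j) * (∑ s, (D.r s : ℂ) / (q j - D.X s)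
          - ∑ i ∈ Finset.univ.erase j, (q j - q i)⁻¹)
        - p j * ∑ s, (D.r s : ℂ) / (q j - D.X s) ^ 2
        + ∑ i ∈ Finset.univ.erase j, (p j - p i) / (q j - q i) ^ 2)
      - if 3 ≤ D.rInf then
          D.hbar * ((D.rInf - 3 : ℕ) : ℂ) * D.tInf 0 (D.rInf - 1) * q j ^ (D.rInf - 4) else 0 := by
  have hz := a.off_poles j
  have hL := fun i k => (differentiableAt_laxEntry D K i k hz).hasDerivAt
  have hf00 : ∀ z, (∀ s, z ≠ D.X s) → DifferentiableAt ℂ (laxEntry D K 0 0) z := fun z hz =>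
    differentiableAt_laxEntry D K 0 0 hz
  have h11 : deriv (laxEntry D K 1 1) (q j) = deriv D.P1 (q j) - deriv (laxEntry D K 0 0) (q j) := by
    have : D.P1 = fun z => laxEntry D K 0 0 z + laxEntry D K 1 1 z := by
      funext z; rw [h.trace_eq]
    rw [this, ((hL 0 0).fun_add (hL 1 1)).deriv]; ring
  have hsum : HasDerivAt (fun z => ∑ i, dslope (laxEntry D K 0 0) (q i) z)
      (deriv (dslope (laxEntry D K 0 0) (q j)) (q j)
        + ∑ i ∈ Finset.univ.erase j, (deriv (laxEntry D K 0 0) (q j) * (q j - q i)⁻¹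
          - (p j - p i) / (q j - q i) ^ 2)) (q j) := by
    simp only [← Finset.add_sum_erase _ _ (Finset.mem_univ j)]
    refine (differentiableAt_dslope hf00 hz hz).hasDerivAt.fun_add
      (HasDerivAt.fun_sum fun i hi => ?_)
    have := hasDerivAt_dslope_of_ne (hL 0 0) (a := q i)
      fun e => (Finset.ne_of_mem_erase hi) (a.injective e).symm
    rwa [a.value, a.value] at this
  have hshift : HasDerivAt (fun z => if 3 ≤ D.rInf then
      D.hbar * D.tInf 0 (D.rInf - 1) * z ^ (D.rInf - 3) else 0) (if 3 ≤ D.rInf then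
      D.hbar * ((D.rInf - 3 : ℕ) : ℂ) * D.tInf 0 (D.rInf - 1) * q j ^ (D.rInf - 4) else 0) (q j) := by
    split_ifs
    · refine ((hasDerivAt_pow (D.rInf - 3) (q j)).const_mul _).congr_deriv ?_
      rw [show D.rInf - 3 - 1 = D.rInf - 4 by omega]; ring
    · exact hasDerivAt_const _ _
  have hS := (((differentiableAt_P2tilde D hz).hasDerivAt.fun_sub
    (((hL 0 0).fun_mul (hL 1 1)).fun_sub ((hL 0 1).fun_mul (hL 1 0)))).fun_add
    ((((hasDerivAt_deriv_of_dslope hf00 hz).fun_add ((hL 0 0).fun_mul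
      (hasDerivAt_sum_div_sub (fun s => (D.r s : ℂ)) D.X hz))).fun_sub hsum).const_mul
        D.hbar)).fun_add hshift
  have hev : spectralFun D K q =ᶠ[𝓝 (q j)] evalH D (D.solH q p) := by
    filter_upwards [eventually_ne_poles hz] with z hz using h.spectralFun_eq a hz
  have hH := (hasDerivAt_evalH D (D.solH q p) hz).congr_of_eventuallyEq hev
  have key := hS.unique hH
  have htr := h.trace_eq (q j)
  rw [Finset.sum_sub_distrib, ← Finset.mul_sum, a.value, a.zero, h11] at key
  rw [a.value] at htr
  have hH' : ∑ k ∈ Finset.Icc 1 (D.rInf - 4), (k : ℂ) * D.HInf q p k * q j ^ (k - 1)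
        - ∑ s, ∑ k ∈ Finset.Icc 1 (D.r s), (k : ℂ) * D.HX q p s k / (q j - D.X s) ^ (k + 1) =
      ∑ k ∈ Finset.Icc 1 (D.rInf - 4), (k : ℂ) * entryAt (D.solH q p).1 k * q j ^ (k - 1)
      - ∑ s, ∑ k ∈ Finset.Icc 1 (D.r s),
        (k : ℂ) * entryAt ((D.solH q p).2 s) (k - 1) / (q j - D.X s) ^ (k + 1) := rfl
  rw [hH', ← key, ← htr]
  ring

/-- If `q_j` moves with the zero of `L₁₂`, then its velocity is the one prescribed by the evolution
equation. -/
theorem IsLaxJet.eq_qEvolution (h : IsLaxJet D K K' B) (a : IsDarboux D K q p) (j : Fin g) {v : ℂ}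
    (hv : D.hbar * laxVelocity D K K' 0 1 (q j) + deriv (laxEntry D K 0 1) (q j) * v = 0) :
    v = D.qEvolution q p j := by
  have hl := h.deriv_lax01_ne_zero a j
  have hzc := h.zero_curvature (q j) (a.off_poles j) 0 1
  have htr := h.trace_eq (q j)
  have e1 : ∑ s, D.hbar * D.r s / (q j - D.X s) = D.hbar * ∑ s, (D.r s : ℂ) / (q j - D.X s) := by
    rw [Finset.mul_sum]; exact Finset.sum_congr rfl fun s _ => by ring
  have e2 : ∑ i ∈ Finset.univ.erase j, (D.mu q j + D.mu q i) / (q j - q i) =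
      D.mu q j * ∑ i ∈ Finset.univ.erase j, (q j - q i)⁻¹
        + ∑ i ∈ Finset.univ.erase j, D.mu q i * (q j - q i)⁻¹ := by
    rw [Finset.mul_sum, ← Finset.sum_add_distrib]
    exact Finset.sum_congr rfl fun s _ => by ring
  rw [Fin.sum_univ_two, a.zero, a.value, h.aux01_apply a, h.auxDeriv01_apply a] at hzc
  rw [a.value] at htr
  refine mul_left_cancel₀ hl ?_
  rw [DeformationData.qEvolution, e1, e2]
  linear_combination hv - hzc - (deriv (laxEntry D K 0 1) (q j) * D.mu q j) * htr

/-- The evolution equation of `p_j = L₁₁(q_j)`. -/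
theorem IsLaxJet.pEvolution_eq (h : IsLaxJet D K K' B) (a : IsDarboux D K q p) (j : Fin g) :
    D.hbar * laxVelocity D K K' 0 0 (q j) + deriv (laxEntry D K 0 0) (q j) * D.qEvolution q p j =
      D.pEvolution q p j := by
  have hzc := h.zero_curvature (q j) (a.off_poles j) 0 0
  have h10 := h.deriv_lax01_mul_lax10 a j
  have e1 : ∑ s, D.hbar * D.r s / (q j - D.X s) = D.hbar * ∑ s, (D.r s : ℂ) / (q j - D.X s) := by
    rw [Finset.mul_sum]; exact Finset.sum_congr rfl fun s _ => by ring
  have e1' : ∑ s, D.hbar * D.r s / (q j - D.X s) ^ 2 =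
      D.hbar * ∑ s, (D.r s : ℂ) / (q j - D.X s) ^ 2 := by
    rw [Finset.mul_sum]; exact Finset.sum_congr rfl fun s _ => by ring
  have e2 : ∑ i ∈ Finset.univ.erase j, (D.mu q j + D.mu q i) / (q j - q i) =
      D.mu q j * ∑ i ∈ Finset.univ.erase j, (q j - q i)⁻¹
        + ∑ i ∈ Finset.univ.erase j, D.mu q i * (q j - q i)⁻¹ := by
    rw [Finset.mul_sum, ← Finset.sum_add_distrib]
    exact Finset.sum_congr rfl fun s _ => by ring
  have e3 : ∑ i ∈ Finset.univ.erase j, (D.mu q i + D.mu q j) * (p i - p j) / (q j - q i) ^ 2 =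
      -(∑ i ∈ Finset.univ.erase j, D.mu q i * ((p j - p i) / (q j - q i) ^ 2))
        - D.mu q j * ∑ i ∈ Finset.univ.erase j, (p j - p i) / (q j - q i) ^ 2 := by
    rw [Finset.mul_sum, ← Finset.sum_neg_distrib, ← Finset.sum_sub_distrib]
    exact Finset.sum_congr rfl fun s _ => by ring
  rw [Fin.sum_univ_two, a.zero, a.value, h.aux01_apply a, h.auxDeriv00_apply a] at hzc
  rw [DeformationData.qEvolution, DeformationData.pEvolution, e1, e1', e2, e3]
  linear_combination hzc + D.mu q j * h10

end

section

/-! ### First variation of the family of connections -/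

/-- Coefficientwise derivative of a family of polynomials. -/
def HasCoeffDerivAt (P : ℂ → ℂ[X]) (P' : ℂ[X]) (t : ℂ) : Prop :=
  ∀ d, HasDerivAt (fun e => (P e).coeff d) (P'.coeff d) t

namespace HasCoeffDerivAt

variable {P Q : ℂ → ℂ[X]} {P' Q' : ℂ[X]} {t : ℂ}

theorem add (hP : HasCoeffDerivAt P P' t) (hQ : HasCoeffDerivAt Q Q' t) :
    HasCoeffDerivAt (fun e => P e + Q e) (P' + Q') t := fun d => by
  simpa only [coeff_add] using (hP d).fun_add (hQ d)

theorem neg (hP : HasCoeffDerivAt P P' t) : HasCoeffDerivAt (fun e => -P e) (-P') t := fun d => by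
  simpa only [coeff_neg] using (hP d).fun_neg

theorem sub (hP : HasCoeffDerivAt P P' t) (hQ : HasCoeffDerivAt Q Q' t) :
    HasCoeffDerivAt (fun e => P e - Q e) (P' - Q') t := fun d => by
  simpa only [coeff_sub] using (hP d).fun_sub (hQ d)

theorem mul (hP : HasCoeffDerivAt P P' t) (hQ : HasCoeffDerivAt Q Q' t) :
    HasCoeffDerivAt (fun e => P e * Q e) (P' * Q t + P t * Q') t := fun d => by
  simp only [coeff_add, coeff_mul, ← Finset.sum_add_distrib]
  exact HasDerivAt.fun_sum fun x _ => (hP x.1).fun_mul (hQ x.2)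

theorem sum {ι : Type*} (s : Finset ι) {P : ι → ℂ → ℂ[X]} {P' : ι → ℂ[X]}
    (h : ∀ i ∈ s, HasCoeffDerivAt (P i) (P' i) t) :
    HasCoeffDerivAt (fun e => ∑ i ∈ s, P i e) (∑ i ∈ s, P' i) t := fun d => by
  simp only [finsetSum_coeff]
  exact HasDerivAt.fun_sum fun i hi => h i hi d

theorem C_mul {c : ℂ → ℂ} {c' : ℂ} (hc : HasDerivAt c c' t) (P : ℂ[X]) :
    HasCoeffDerivAt (fun e => C (c e) * P) (C c' * P) t := fun d => by
  simp only [coeff_C_mul]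
  exact hc.mul_const _

theorem dvd {N : ℕ} (hP : HasCoeffDerivAt P P' t) (h : ∀ᶠ e in 𝓝 t, X ^ N ∣ P e) : X ^ N ∣ P' := by
  refine X_pow_dvd_iff.2 fun d hd => ?_
  refine (hP d).unique ((hasDerivAt_const t (0 : ℂ)).congr_of_eventuallyEq ?_)
  filter_upwards [h] with e he using X_pow_dvd_iff.1 he d hd

end HasCoeffDerivAt

theorem hasCoeffDerivAt_polarPoly {R : ℕ} {β : ℂ → ℕ → ℂ} {β' : ℕ → ℂ} {t : ℂ}
    (h : ∀ k < R, HasDerivAt (fun e => β e k) (β' k) t) :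
    HasCoeffDerivAt (fun e => polarPoly R (β e)) (polarPoly R β') t :=
  HasCoeffDerivAt.sum _ fun k hk => HasCoeffDerivAt.C_mul (h k (Finset.mem_range.1 hk)) _

/-- Reordering of the variation of a determinant given by the Leibniz rule. -/
theorem dvd_det_variation {N a b c d a' b' c' d' e f e' f' : ℂ[X]}
    (h : N ∣ a' * d + a * d' - (b' * c + b * c') - (e' * f + e * f')) :
    N ∣ d * a' + a * d' - b * c' - c * b' - (e' * f + e * f') := by
  rwa [show d * a' + a * d' - b * c' - c * b' = a' * d + a * d' - (b' * c + b * c') by ring]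

variable {n g rInf : ℕ} {r : Fin n → ℕ}

/-- The velocity of the coefficients `C` at `τ` in the direction `v`. -/
noncomputable def coeffVelocity (C : TimeSpace n rInf r → PolarCoeffs n) (τ v : TimeSpace n rInf r) :
    PolarCoeffs n where
  inf k := Matrix.of fun i j => fderiv ℂ (fun σ => (C σ).inf k i j) τ v
  fin s k := Matrix.of fun i j => fderiv ℂ (fun σ => (C σ).fin s k i j) τ v

theorem hasDerivAt_line {f : TimeSpace n rInf r → ℂ} {τ : TimeSpace n rInf r}
    (hf : DifferentiableAt ℂ f τ) (v : TimeSpace n rInf r) :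
    HasDerivAt (fun ε : ℂ => f (τ + ε • v)) (fderiv ℂ f τ v) 0 :=
  hf.hasFDerivAt.hasLineDerivAt v

theorem eventually_line {U : Set (TimeSpace n rInf r)} (hU : IsOpen U) {τ : TimeSpace n rInf r}
    (hτ : τ ∈ U) (v : TimeSpace n rInf r) : ∀ᶠ ε : ℂ in 𝓝 0, τ + ε • v ∈ U := by
  have hc : ContinuousAt (fun ε : ℂ => τ + ε • v) 0 := by fun_prop
  exact hc.eventually_mem (hU.mem_nhds (by simpa using hτ))

theorem hasDerivAt_withZeroth {m : ℕ} (a : ℂ) (u v : Fin m → ℂ) (k : ℕ) :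
    HasDerivAt (fun ε : ℂ => withZeroth a (u + ε • v) k) (withZeroth 0 v k) 0 := by
  unfold withZeroth
  split_ifs with h1 h2
  · exact hasDerivAt_const _ _
  · have := ((hasDerivAt_id (0 : ℂ)).mul_const (v ⟨k - 1, h2⟩)).const_add (u ⟨k - 1, h2⟩)
    simpa using this
  · exact hasDerivAt_const _ _

theorem differentiableAt_ratFn_family {E : Type*} [NormedAddCommGroup E] [NormedSpace ℂ E] (N : ℕ)
    {Y : E → Fin n → ℂ} {c : E → ℕ → ℂ} {b : E → Fin n → ℕ → ℂ} {ζ : E → ℂ} {τ : E}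
    (hY : ∀ s, DifferentiableAt ℂ (fun σ => Y σ s) τ)
    (hc : ∀ k < N, DifferentiableAt ℂ (fun σ => c σ k) τ)
    (hb : ∀ s, ∀ k < r s, DifferentiableAt ℂ (fun σ => b σ s k) τ)
    (hζ : DifferentiableAt ℂ ζ τ) (hne : ∀ s, ζ τ ≠ Y τ s) :
    DifferentiableAt ℂ (fun σ => ratFn N r (Y σ) (c σ) (b σ) (ζ σ)) τ := by
  unfold ratFn
  refine DifferentiableAt.fun_add (DifferentiableAt.fun_sum fun k hk => ?_)
    (DifferentiableAt.fun_sum fun s _ => DifferentiableAt.fun_sum fun k hk => ?_)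
  · exact (hc k (Finset.mem_range.1 hk)).fun_mul (hζ.fun_pow k)
  · exact (hb s k (Finset.mem_range.1 hk)).fun_mul (((hζ.fun_sub (hY s)).fun_pow (k + 1)).fun_inv
      (pow_ne_zero _ (sub_ne_zero.2 (hne s))))

theorem differentiableAt_pole (τ : TimeSpace n rInf r) (s : Fin n) :
    DifferentiableAt ℂ (fun σ : TimeSpace n rInf r => σ.2.2 s) τ := by fun_prop

section Family

variable {hbar : ℂ} {mInf : Fin 2 → ℂ} {mX : Fin n → Fin 2 → ℂ} {U : Set (TimeSpace n rInf r)}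
  {C : TimeSpace n rInf r → PolarCoeffs n} {α : TimeSpace n rInf r → TimeSpace n rInf r}

theorem differentiableAt_laxMatrix (hU : IsOpen U)
    (hCInf : ∀ k ∈ Finset.Icc 1 (rInf - 1), ∀ i j,
      DifferentiableOn ℂ (fun τ => (C τ).inf k i j) U)
    (hCFin : ∀ s, ∀ k ∈ Finset.range (r s), ∀ i j,
      DifferentiableOn ℂ (fun τ => (C τ).fin s k i j) U)
    {τ : TimeSpace n rInf r} (hτ : τ ∈ U) {ζ : TimeSpace n rInf r → ℂ}
    (hζ : DifferentiableAt ℂ ζ τ) (hne : ∀ s, ζ τ ≠ τ.2.2 s) (i j : Fin 2) :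
    DifferentiableAt ℂ (fun σ => laxMatrix rInf r σ.2.2 (C σ) (ζ σ) i j) τ := by
  simp only [laxMatrix_apply]
  exact differentiableAt_ratFn_family _ (differentiableAt_pole τ)
    (fun k hk => (hCInf (k + 1) (Finset.mem_Icc.2 ⟨by omega, by omega⟩) i j).differentiableAt
      (hU.mem_nhds hτ))
    (fun s k hk => (hCFin s k (Finset.mem_range.2 hk) i j).differentiableAt (hU.mem_nhds hτ)) hζ hne

/-- The derivative of `L(ζ)` in the direction of the deformation, for a moving argument `ζ`. -/
theorem deformationOp_laxMatrix (hU : IsOpen U)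
    (hCInf : ∀ k ∈ Finset.Icc 1 (rInf - 1), ∀ i j,
      DifferentiableOn ℂ (fun τ => (C τ).inf k i j) U)
    (hCFin : ∀ s, ∀ k ∈ Finset.range (r s), ∀ i j,
      DifferentiableOn ℂ (fun τ => (C τ).fin s k i j) U)
    {τ : TimeSpace n rInf r} (hτ : τ ∈ U) {ζ : TimeSpace n rInf r → ℂ}
    (hζ : DifferentiableAt ℂ ζ τ) (hne : ∀ s, ζ τ ≠ τ.2.2 s) (i j : Fin 2) :
    deformationOp hbar α (fun σ => laxMatrix rInf r σ.2.2 (C σ) (ζ σ) i j) τ =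
      hbar * laxVelocity (deformationData hbar mInf mX τ (α τ)) (C τ) (coeffVelocity C τ (α τ)) i j
          (ζ τ)
        + deriv (laxEntry (deformationData hbar mInf mX τ (α τ)) (C τ) i j) (ζ τ)
          * deformationOp hbar α ζ τ := by
  have h1 := hasDerivAt_line (differentiableAt_laxMatrix hU hCInf hCFin hτ hζ hne i j) (α τ)
  have h2 := hasDerivAt_ratFn_curve (rInf - 1) r (X := fun ε : ℂ => (τ + ε • α τ).2.2)
    (c := fun ε k => (C (τ + ε • α τ)).inf (k + 1) i j)
    (b := fun ε s k => (C (τ + ε • α τ)).fin s k i j) (ζ := fun ε => ζ (τ + ε • α τ))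
    (X' := (α τ).2.2) (c' := fun k => (coeffVelocity C τ (α τ)).inf (k + 1) i j)
    (b' := fun s k => (coeffVelocity C τ (α τ)).fin s k i j) (e := 0)
    (fun s => by
      have := ((hasDerivAt_id (0 : ℂ)).mul_const ((α τ).2.2 s)).const_add (τ.2.2 s)
      simpa using this)
    (fun k hk => hasDerivAt_line ((hCInf (k + 1) (Finset.mem_Icc.2 ⟨by omega, by omega⟩) i
      j).differentiableAt (hU.mem_nhds hτ)) _)
    (fun s k hk => hasDerivAt_line ((hCFin s k (Finset.mem_range.2 hk) i j).differentiableAt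
      (hU.mem_nhds hτ)) _)
    (hasDerivAt_line hζ (α τ)) (by simpa using hne)
  simp only [laxMatrix_apply] at h1
  have h3 := h1.unique h2
  simp only [zero_smul, add_zero] at h3
  rw [deformationOp, deformationOp, deriv_laxEntry _ _ _ _ hne]
  simp only [laxMatrix_apply]
  rw [h3, mul_add]
  exact congrArg₂ (· + ·) rfl (mul_left_comm _ _ _)

/-- At every point of the parameter space, the family of connections gives a solution of the
algebraic first-order conditions. -/
theorem exists_isLaxJet (hrInf : 1 ≤ rInf) (hr : ∀ s, 1 ≤ r s) (h_hbar : hbar ≠ 0)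
    (h_res : ∀ s, r s = 1 → mX s 0 - mX s 1 ≠ hbar ∧ mX s 0 - mX s 1 ≠ -hbar)
    (hU : IsOpen U) (hX : ∀ τ ∈ U, Function.Injective τ.2.2)
    (hInf : ∀ τ ∈ U, DistinctLeading rInf (fun i => withZeroth (mInf i) (τ.1 i)))
    (hFin : ∀ τ ∈ U, ∀ s, DistinctLeading (r s) (fun i => withZeroth (mX s i) (τ.2.1 s i)))
    (hCInf : ∀ k ∈ Finset.Icc 1 (rInf - 1), ∀ i j,
      DifferentiableOn ℂ (fun τ => (C τ).inf k i j) U)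
    (hCFin : ∀ s, ∀ k ∈ Finset.range (r s), ∀ i j,
      DifferentiableOn ℂ (fun τ => (C τ).fin s k i j) U)
    (hNorm : ∀ τ ∈ U,
      NormalizedAtInfinity rInf r τ.2.2 (fun i => withZeroth (mInf i) (τ.1 i)) (C τ))
    (hTimesInf : ∀ τ ∈ U, HasTimesAtInfinity hbar (laxMatrix rInf r τ.2.2 (C τ)) rInf
      (fun i => withZeroth (mInf i) (τ.1 i)))
    (hTimesFin : ∀ τ ∈ U, ∀ s, HasTimesAt hbar (laxMatrix rInf r τ.2.2 (C τ)) (τ.2.2 s) (r s)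
      (fun i => withZeroth (mX s i) (τ.2.1 s i)))
    (hIso : IsIsomonodromicAlong hbar U α C) {τ : TimeSpace n rInf r} (hτ : τ ∈ U) :
    ∃ B, IsLaxJet (deformationData hbar mInf mX τ (α τ)) (C τ) (coeffVelocity C τ (α τ)) B := by
  obtain ⟨B, hB⟩ := hIso τ hτ
  set D := deformationData hbar mInf mX τ (α τ)
  have hfin : ∀ σ ∈ U, ∀ s, X ^ r s ∣ finPoly D (C σ) s 0 0 + finPoly D (C σ) s 1 1
        - (polarPoly (r s) (withZeroth (mX s 0) (σ.2.1 s 0))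
          + polarPoly (r s) (withZeroth (mX s 1) (σ.2.1 s 1))) ∧
      X ^ r s ∣ finPoly D (C σ) s 0 0 * finPoly D (C σ) s 1 1
        - finPoly D (C σ) s 0 1 * finPoly D (C σ) s 1 0
        - polarPoly (r s) (withZeroth (mX s 0) (σ.2.1 s 0))
          * polarPoly (r s) (withZeroth (mX s 1) (σ.2.1 s 1)) := fun σ hσ s =>
    trace_det_dvd_of_hasTimesAt (t := fun i => withZeroth (mX s i) (σ.2.1 s i))
      (f := fun i j => finPoly D (C σ) s i j)
      (fun i j => by
        simp only [laxMatrix_apply]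
        exact hasTrunc_ratFn _ _ _ _ (hX σ hσ) s) (hTimesFin σ hσ s)
  have hinf : ∀ σ ∈ U, X ^ rInf ∣ infPoly D (C σ) 0 0 + infPoly D (C σ) 1 1
        - (-polarPoly rInf (withZeroth (mInf 0) (σ.1 0))
          + -polarPoly rInf (withZeroth (mInf 1) (σ.1 1))) ∧
      X ^ rInf ∣ infPoly D (C σ) 0 0 * infPoly D (C σ) 1 1
        - infPoly D (C σ) 0 1 * infPoly D (C σ) 1 0
        - (-polarPoly rInf (withZeroth (mInf 0) (σ.1 0)))
          * (-polarPoly rInf (withZeroth (mInf 1) (σ.1 1))) := fun σ hσ =>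
    trace_det_dvd_of_hasTimesAtInfinity hrInf (t := fun i => withZeroth (mInf i) (σ.1 i))
      (f := fun i j => infPoly D (C σ) i j)
      (fun i j => by
        simp only [laxMatrix_apply]
        exact hasTrunc_ratFn_inv_pred' hrInf hr _ _ _) (hTimesInf σ hσ)
  -- the congruences `hfin` and `hinf` hold along the line `τ + ε • α τ` and can be differentiated at
  -- `ε = 0`
  have hline := eventually_line hU hτ (α τ)
  have h0 : τ + (0 : ℂ) • α τ = τ := by simp
  have dInf : ∀ k ∈ Finset.Icc 1 (rInf - 1), ∀ i j, HasDerivAt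
      (fun ε : ℂ => (C (τ + ε • α τ)).inf k i j) ((coeffVelocity C τ (α τ)).inf k i j) 0 :=
    fun k hk i j => hasDerivAt_line ((hCInf k hk i j).differentiableAt (hU.mem_nhds hτ)) _
  have dFin : ∀ s, ∀ k < r s, ∀ i j, HasDerivAt
      (fun ε : ℂ => (C (τ + ε • α τ)).fin s k i j) ((coeffVelocity C τ (α τ)).fin s k i j) 0 :=
    fun s k hk i j => hasDerivAt_line ((hCFin s k (Finset.mem_range.2 hk) i j).differentiableAt
      (hU.mem_nhds hτ)) _
  have pFin : ∀ s i j, HasCoeffDerivAt (fun ε : ℂ => finPoly D (C (τ + ε • α τ)) s i j)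
      (finPoly D (coeffVelocity C τ (α τ)) s i j) 0 := fun s i j =>
    hasCoeffDerivAt_polarPoly fun k hk => dFin s k hk i j
  have pInf : ∀ i j, HasCoeffDerivAt (fun ε : ℂ => infPoly D (C (τ + ε • α τ)) i j)
      (infPoly D (coeffVelocity C τ (α τ)) i j) 0 := fun i j => by
    refine HasCoeffDerivAt.add (HasCoeffDerivAt.sum _ fun k hk => HasCoeffDerivAt.C_mul
      (dInf _ ?_ i j) _) (HasCoeffDerivAt.C_mul (HasDerivAt.fun_sum fun s _ => dFin s 0 (hr s) i j) _)
    have hk : k < rInf - 1 := Finset.mem_range.1 hk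
    exact Finset.mem_Icc.2 ⟨by omega, by omega⟩
  have tFin : ∀ s i, HasCoeffDerivAt (fun ε : ℂ => polarPoly (r s)
      (withZeroth (mX s i) ((τ + ε • α τ).2.1 s i))) (polarPoly (r s) (D.aX s i)) 0 := fun s i =>
    hasCoeffDerivAt_polarPoly fun k _ => hasDerivAt_withZeroth _ _ _ k
  have tInf : ∀ i, HasCoeffDerivAt (fun ε : ℂ => -polarPoly rInf
      (withZeroth (mInf i) ((τ + ε • α τ).1 i))) (-polarPoly rInf (D.aInf i)) 0 := fun i =>
    (hasCoeffDerivAt_polarPoly fun k _ => hasDerivAt_withZeroth _ _ _ k).neg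
  refine ⟨B, ?_⟩
  refine
    { one_le_rInf := hrInf
      one_le_r := hr
      hbar_ne := h_hbar
      X_injective := hX τ hτ
      distinct_inf := hInf τ hτ
      distinct_fin := hFin τ hτ
      not_resonant := fun s hs => h_res s hs
      lead := (hNorm τ hτ).1
      lead_velocity := fun i j hij => ?_
      sublead := (hNorm τ hτ).2
      trace_fin := fun s => (hfin τ hτ s).1
      det_fin := fun s => (hfin τ hτ s).2
      trace_inf := (hinf τ hτ).1
      det_inf := (hinf τ hτ).2
      trace_fin' := fun s => ?_
      det_fin' := fun s => ?_
      trace_inf' := ?_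
      det_inf' := ?_
      zero_curvature := fun z hz i j => ?_ }
  · have h1 : HasDerivAt (fun ε : ℂ => leadAtInfinity rInf (C (τ + ε • α τ)) i j)
        (leadAtInfinity rInf (coeffVelocity C τ (α τ)) i j) 0 := by
      unfold leadAtInfinity
      split_ifs with h2
      · exact dInf _ (Finset.mem_Icc.2 ⟨by omega, le_rfl⟩) i j
      · simp only [Matrix.sum_apply]
        exact HasDerivAt.fun_sum fun s _ => dFin s 0 (hr s) i j
    refine h1.unique ((hasDerivAt_const (0 : ℂ) (0 : ℂ)).congr_of_eventuallyEq ?_)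
    filter_upwards [hline] with ε hε
    rw [(hNorm _ hε).1, Matrix.diagonal_apply_ne _ hij]
  · exact HasCoeffDerivAt.dvd (((pFin s 0 0).add (pFin s 1 1)).sub ((tFin s 0).add (tFin s 1)))
      (hline.mono fun ε hε => (hfin _ hε s).1)
  · have h1 := HasCoeffDerivAt.dvd ((((pFin s 0 0).mul (pFin s 1 1)).sub
      ((pFin s 0 1).mul (pFin s 1 0))).sub ((tFin s 0).mul (tFin s 1)))
      (hline.mono fun ε hε => (hfin _ hε s).2)
    rw [h0] at h1
    exact dvd_det_variation h1
  · exact HasCoeffDerivAt.dvd (((pInf 0 0).add (pInf 1 1)).sub ((tInf 0).add (tInf 1)))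
      (hline.mono fun ε hε => (hinf _ hε).1)
  · have h1 := HasCoeffDerivAt.dvd ((((pInf 0 0).mul (pInf 1 1)).sub
      ((pInf 0 1).mul (pInf 1 0))).sub ((tInf 0).mul (tInf 1)))
      (hline.mono fun ε hε => (hinf _ hε).2)
    rw [h0] at h1
    exact dvd_det_variation h1
  · have h1 := hB z hz i j
    have h2 := deformationOp_laxMatrix (hbar := hbar) (mInf := mInf) (mX := mX) (α := α) hU hCInf
      hCFin hτ (differentiableAt_const z) hz i j
    have h3 : deformationOp hbar α (fun _ => z) τ = 0 := by simp [deformationOp]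
    rw [h3, mul_zero, add_zero, h1] at h2
    rw [auxEntryDeriv_eq D B i j hz]
    simp only [Matrix.sub_apply, Matrix.mul_apply, laxMatrix_apply, auxMatrix_apply] at h2
    rw [Finset.sum_sub_distrib]
    exact h2.symm

end Family

end

end Isomonodromy

theorem mainTheorem1 {n g rInf : ℕ} {r : Fin n → ℕ}
    (hrInf : 1 ≤ rInf) (hr : ∀ s, 1 ≤ r s) (hg : 0 < g) (hgenus : rInf + ∑ s, r s = g + 3)
    (hbar : ℂ) (h_hbar : hbar ≠ 0)
    -- fixed monodromies at infinity and at the finite poles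
    (mInf : Fin 2 → ℂ) (mX : Fin n → Fin 2 → ℂ)
    (h_res : ∀ s, r s = 1 → mX s 0 - mX s 1 ≠ hbar ∧ mX s 0 - mX s 1 ≠ -hbar)
    -- the domain of deformation parameters
    (U : Set (TimeSpace n rInf r)) (hU : IsOpen U)
    (hX : ∀ τ ∈ U, Function.Injective τ.2.2)
    (hInf : ∀ τ ∈ U, DistinctLeading rInf (fun i => withZeroth (mInf i) (τ.1 i)))
    (hFin : ∀ τ ∈ U, ∀ s, DistinctLeading (r s) (fun i => withZeroth (mX s i) (τ.2.1 s i)))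
    -- the family of connections, normalized at infinity, with the given times and monodromies
    (C : TimeSpace n rInf r → PolarCoeffs n)
    (hCInf : ∀ k ∈ Finset.Icc 1 (rInf - 1), ∀ i j,
      DifferentiableOn ℂ (fun τ => (C τ).inf k i j) U)
    (hCFin : ∀ s, ∀ k ∈ Finset.range (r s), ∀ i j,
      DifferentiableOn ℂ (fun τ => (C τ).fin s k i j) U)
    (hNorm : ∀ τ ∈ U,
      NormalizedAtInfinity rInf r τ.2.2 (fun i => withZeroth (mInf i) (τ.1 i)) (C τ))
    (hTimesInf : ∀ τ ∈ U, HasTimesAtInfinity hbar (laxMatrix rInf r τ.2.2 (C τ)) rInf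
      (fun i => withZeroth (mInf i) (τ.1 i)))
    (hTimesFin : ∀ τ ∈ U, ∀ s, HasTimesAt hbar (laxMatrix rInf r τ.2.2 (C τ)) (τ.2.2 s) (r s)
      (fun i => withZeroth (mX s i) (τ.2.1 s i)))
    -- the deformation vector field, along which the family is isomonodromic
    (α : TimeSpace n rInf r → TimeSpace n rInf r)
    (hIso : IsIsomonodromicAlong hbar U α C)
    -- the Darboux coordinates
    (q p : TimeSpace n rInf r → Fin g → ℂ)
    (hqDiff : ∀ j, DifferentiableOn ℂ (fun τ => q τ j) U)
    (hqInj : ∀ τ ∈ U, Function.Injective (q τ))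
    (hqX : ∀ τ ∈ U, ∀ j s, q τ j ≠ τ.2.2 s)
    (hq : ∀ τ ∈ U, ∀ j, laxMatrix rInf r τ.2.2 (C τ) (q τ j) 0 1 = 0)
    (hp : ∀ τ ∈ U, ∀ j, p τ j = laxMatrix rInf r τ.2.2 (C τ) (q τ j) 0 0) :
    ∀ τ ∈ U,
      -- the coefficients are well defined
      (∀ q' : Fin g → ℂ, Function.Injective q' → (∀ j s, q' j ≠ τ.2.2 s) →
        (∃! y, (deformationData hbar mInf mX τ (α τ)).IsNuMu q' y) ∧
        ∀ p' : Fin g → ℂ, ∃! h, (deformationData hbar mInf mX τ (α τ)).IsH q' p' h) ∧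
      -- the evolutions, and their Hamiltonian form
      ∀ j : Fin g,
        deformationOp hbar α (fun σ => q σ j) τ =
          (deformationData hbar mInf mX τ (α τ)).qEvolution (q τ) (p τ) j ∧
        deformationOp hbar α (fun σ => p σ j) τ =
          (deformationData hbar mInf mX τ (α τ)).pEvolution (q τ) (p τ) j ∧
        ∀ c0 : ℂ,
          HasDerivAt (fun x => (deformationData hbar mInf mX τ (α τ)).Ham c0 (q τ)
              (Function.update (p τ) j x))
            (deformationOp hbar α (fun σ => q σ j) τ) (p τ j) ∧
          HasDerivAt (fun x => (deformationData hbar mInf mX τ (α τ)).Ham c0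
              (Function.update (q τ) j x) (p τ))
            (-deformationOp hbar α (fun σ => p σ j) τ) (q τ j) := by

  intro τ hτ
  obtain ⟨B, h⟩ := Isomonodromy.exists_isLaxJet hrInf hr h_hbar h_res hU hX hInf hFin hCInf hCFin
    hNorm hTimesInf hTimesFin hIso hτ
  have a : Isomonodromy.IsDarboux (deformationData hbar mInf mX τ (α τ)) (C τ) (q τ) (p τ) :=
    { genus := hgenus
      injective := hqInj τ hτ
      off_poles := hqX τ hτ
      zero := fun j => by
        have := hq τ hτ j
        rwa [Isomonodromy.laxMatrix_apply] at this
      value := fun j => by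
        have := hp τ hτ j
        rw [Isomonodromy.laxMatrix_apply] at this
        exact this.symm }
  have hqd : ∀ j, DifferentiableAt ℂ (fun σ => q σ j) τ := fun j =>
    (hqDiff j).differentiableAt (hU.mem_nhds hτ)
  have hL := fun i k j => Isomonodromy.deformationOp_laxMatrix (hbar := hbar) (mInf := mInf)
    (mX := mX) (α := α) hU hCInf hCFin hτ (hqd j) (hqX τ hτ j) i k
  have hqev : ∀ j, deformationOp hbar α (fun σ => q σ j) τ =
      (deformationData hbar mInf mX τ (α τ)).qEvolution (q τ) (p τ) j := fun j => by
    refine h.eq_qEvolution a j ((hL 0 1 j).symm.trans ?_)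
    -- `L₁₂(q_j)` vanishes identically, so its total derivative does
    have h0 : (fun σ => laxMatrix rInf r σ.2.2 (C σ) (q σ j) 0 1) =ᶠ[𝓝 τ] fun _ => 0 := by
      filter_upwards [hU.mem_nhds hτ] with σ hσ using hq σ hσ j
    rw [deformationOp, h0.fderiv_eq]
    simp
  have hpev : ∀ j, deformationOp hbar α (fun σ => p σ j) τ =
      (deformationData hbar mInf mX τ (α τ)).pEvolution (q τ) (p τ) j := fun j => by
    have h0 : (fun σ => p σ j) =ᶠ[𝓝 τ] fun σ => laxMatrix rInf r σ.2.2 (C σ) (q σ j) 0 0 := by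
      filter_upwards [hU.mem_nhds hτ] with σ hσ using hp σ hσ j
    have h1 := hL 0 0 j
    rw [hqev j] at h1
    rw [← h.pEvolution_eq a j]
    refine Eq.trans ?_ h1
    rw [deformationOp, deformationOp, h0.fderiv_eq]
  refine ⟨fun q' hq' hqX' => ⟨Isomonodromy.existsUnique_isNuMu _ hrInf (hX τ hτ) hgenus hq' hqX',
    fun p' => Isomonodromy.existsUnique_isH _ hrInf (hX τ hτ) hgenus hq' hqX' p'⟩,
    fun j => ⟨hqev j, hpev j, fun c0 => ⟨?_, ?_⟩⟩⟩
  · rw [hqev j]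
    exact Isomonodromy.hasDerivAt_ham_p _ hrInf hr (hX τ hτ) hgenus (hqInj τ hτ) (hqX τ hτ) _ c0 j
  · rw [hpev j]
    exact Isomonodromy.hasDerivAt_ham_q _ hrInf hr (hX τ hτ) hgenus (hqInj τ hτ) (hqX τ hτ) _ c0 j
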